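/- **Setting.** An sc-Banach space $E$ is a decreasing sequence of Banach spaces $E=E_0\supseteq E_1\supseteq\cdots$ such that every inclusion $E_{m+1}\hookrightarrow E_m$ is compact and $\bigcap_i E_i$ is dense in every $E_m$; $E^j$ is $E_j$ with the levels $E_{j+m}$, and finite-dimensional spaces carry the constant scale. For $U\subseteq E_0$ open, $U_m=U\cap E_m$, a map $f:U\to F$ is sc$^0$ if it restricts to continuous maps $U_m\to F_m$ for all $m$; it is sc$^1$ if it is sc$^0$, for each $x\in U_1$ there is a bounded operator $Df(x):E_0\to F_0$ with $\|f(x+h)-f(x)-Df(x)h\|_0/\|h\|_1\to0$ as $\|h\|_1\to 0$, and $Tf(x,h)=(f(x),Df(x)h)$ is sc$^0$ from $U^1\oplus E$ to $F^1\oplus F$; it is sc-smooth if all its iterated tangent maps are sc$^1$. If $r:E\to E$ is sc-smooth with $r\circ r=r$, then $X=r(E)$ is an M-polyfold with one global chart, $X_m=X\cap E_m$, $T_pX=\operatorname{im}Dr(p)\subseteq E_0$ for $p\in X_1$, and $TX=Tr(TE)$; a map on (an open part of) such a retract is sc-smooth if its composition with the retraction is. $X$ is even-dimensional if every $T_pX$,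 $p\in X_1$, has even or infinite dimension. **The M-polyfold $\Gamma_n^k$.** Let $0=\delta_0<\delta_1<\cdots$, let $\beta:\mathbb R\to[-1,1]$ be smooth and odd with $\beta(s)=1$ for $s\ge1$, and let $L^2(\mathbb R)$ have the levels $$\Big\{f\in L^2(\mathbb R):\int_{\mathbb R}\big(|f|^2+|Df|^2+\cdots+|D^mf|^2\big)e^{\delta_m s\beta(s)}\,ds<\infty\Big\},\qquad m\ge0 .$$ Let $\gamma_1,\dots,\gamma_k\in C_c^\infty(\mathbb R)$ be orthonormal in $L^2(\mathbb R)$, and put $\gamma_{j,t}=\gamma_j(\cdot+e^{1/t})$ for $t>0$. Let $\pi_t(f)=\sum_j\langle f,\gamma_{j,t}\rangle\gamma_{j,t}$ for $t>0$ and $\pi_t=0$ for $t\le0$. Then $\Gamma_n^k$ is the image of the retraction $r(x,t,f)=(x,t,\pi_t(f))$ of $\mathbb R^n\oplus\mathbb R\oplus L^2(\mathbb R)$. Let $p=(x,t,f)\in X_1$. If $t\le 0$, then $T_pX$ consists of the vectors $(\delta x,\delta t,0)$. If $t>0$, put $\xi_t=\sum_j\langle f,\gamma_{j,t}\rangle\frac{d}{dt}\gamma_{j,t}$;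 then every tangent vector at $p$ is uniquely of the form $(\delta x,\delta t,\delta f+\delta t\,\xi_t)$ with $\delta f\in\operatorname{span}\{\gamma_{1,t},\dots,\gamma_{k,t}\}$. **The tensors.** Let $X=\Gamma_n^k$ be even-dimensional (so $n$ is odd and $k$ is even). Put $(\delta x',\delta t')=(-\delta x_2,\delta x_1,\dots,-\delta x_{n-1},\delta x_{n-2},-\delta t,\delta x_n)$. Define $J_p(\delta x,\delta t,0)=(\delta x',\delta t',0)$ for $t\le0$ and, for $t>0$, $$J_p(\delta x,\delta t,\delta f+\delta t\,\xi_t)=\Big(\delta x',\delta t',\sum_{j=1}^{k/2}\big(\langle\delta f,\gamma_{2j-1,t}\rangle\gamma_{2j,t}-\langle\delta f,\gamma_{2j,t}\rangle\gamma_{2j-1,t}\big)+\delta t'\,\xi_t\Big).$$ Let $$g_p\big((\delta x,\delta t,\delta f+\delta t\,\xi_t),(\delta y,\delta s,\delta h+\delta s\,\xi_t)\big)=\sum_i\delta x_i\delta y_i+\delta t\,\delta s+\sum_j\langle\delta f,\gamma_{j,t}\rangle\langle\delta h,\gamma_{j,t}\rangle$$ (without the last sum for $t\le0$) and $\omega=g(J\cdot,\cdot)$.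 **Claim.** 1. $(X,J)$ is a complex M-polyfold. That is, $X$ is an even-dimensional M-polyfold modelled on a reflexive sc-Banach space (all levels are reflexive); $J:TX\to TX$ is an sc-smooth $(1,1)$-tensor field with $J_p^2=-\mathrm{id}$ for all $p\in X_1$; and $J$ is integrable: with $[\mu,\nu](p)=D\nu(p)\mu(p)-D\mu(p)\nu(p)$, $p\in X_2$, extended complex bilinearly, for all sc-smooth local sections $\mu,\nu$ of $T^{1,0}X$ (the $i$-eigenbundle of $J$ in $\mathbb C\otimes TX$, over an open subset $V$ of $X^1$) the bracket $[\mu,\nu]$ is an sc-smooth section of $T^{1,0}X$ over $V\cap X_2$, with $V\cap X_2$ carrying the scale of $X^2$. 2. The Nijenhuis tensor of $J$ vanishes: for all sc-smooth vector fields $\mu,\nu$ on an open subset $V$ of $X^1$ and all $p\in V\cap X_2$, $$[\mu,\nu]_p+J[\mu,J\nu]_p+J[J\mu,\nu]_p-[J\mu,J\nu]_p=0 .$$ 3. $(X,J,g,\omega)$ is a strong Kähler M-polyfold: $g$ is an sc-smooth, symmetric, positive definite $(0,2)$-tensor field such that $v\mapsto g_p(v,\cdot)$ is a topological isomorphism $T_pX\to(T_pX)^*$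 for every $p\in X_1$; $g(J\cdot,J\cdot)=g$; and $\omega$ is a strong symplectic form, i.e. an sc-smooth alternating two-form such that $v\mapsto\omega_p(v,\cdot)$ is a topological isomorphism $T_pX\to(T_pX)^*$ for every $p\in X_1$ and such that $d\omega=0$, that is, for all sc-smooth vector fields $\mu_0,\mu_1,\mu_2$ on an open subset $V$ of $X^1$ the usual expression $$D(\omega(\mu_1,\mu_2))\mu_0-D(\omega(\mu_0,\mu_2))\mu_1+D(\omega(\mu_0,\mu_1))\mu_2-\omega([\mu_0,\mu_1],\mu_2)+\omega([\mu_0,\mu_2],\mu_1)-\omega([\mu_1,\mu_2],\mu_0)$$ vanishes on $V\cap X_2$. -/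

import Mathlib

open MeasureTheory Topology Set
open scoped ContDiff ENNReal

noncomputable section

/-! ### Scales of normed spaces and sc-Banach spaces -/

/-- The data of a scale `⋯ → X 2 → X 1 → X 0`: real normed spaces together with linear maps `ι m`,
to be read as the inclusions `E_{m+1} ⊆ E_m`. -/
structure ScScale where
  X : ℕ → Type
  [ng : ∀ m, NormedAddCommGroup (X m)]
  [ns : ∀ m, NormedSpace ℝ (X m)]
  ι : ∀ m, X (m + 1) →ₗ[ℝ] X m

attribute [instance] ScScale.ng ScScale.ns

namespace ScScale

/-- The inclusion of the level `m` into the level `0`. -/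
def incl (E : ScScale) : ∀ m, E.X m →ₗ[ℝ] E.X 0
  | 0 => LinearMap.id
  | m + 1 => (E.incl m).comp (E.ι m)

/-- A scale is an sc-Banach space: the levels are Banach spaces, the maps between consecutive levels
are injective (so that the levels form a decreasing sequence of subspaces of `E_0`) and compact, and
the smooth points (those which lie in every level) are dense in every level. -/
structure IsScBanach (E : ScScale) : Prop where
  complete : ∀ m, CompleteSpace (E.X m)
  injective : ∀ m, Function.Injective (E.ι m)
  compact : ∀ m, IsCompactOperator (E.ι m)
  dense : ∀ m, Dense {x : E.X m | ∃ y : ∀ i, E.X i, (∀ i, E.ι i (y (i + 1)) = y i) ∧ y m = x}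

/-- All levels are reflexive. -/
def IsReflexive (E : ScScale) : Prop :=
  ∀ m, Function.Surjective (NormedSpace.inclusionInDoubleDual ℝ (E.X m))

/-- The constant scale. -/
abbrev const (V : Type) [NormedAddCommGroup V] [NormedSpace ℝ V] : ScScale where
  X := fun _ => V
  ι := fun _ => LinearMap.id

/-- The shifted scale `E^1`, whose level `m` is `E_{m+1}`. -/
abbrev shift (E : ScScale) : ScScale where
  X := fun m => E.X (m + 1)
  ι := fun m => E.ι (m + 1)

/-- The direct sum of two scales. -/
abbrev prod (E F : ScScale) : ScScale where
  X := fun m => E.X m × F.X m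
  ι := fun m => (E.ι m).prodMap (F.ι m)

/-- `TE = E^1 ⊕ E`. -/
abbrev tangent (E : ScScale) : ScScale := E.shift.prod E

/-- `E^1 ⊕ E ⊕ E`, which carries the Whitney sum of two copies of the tangent bundle. -/
abbrev whitney (E : ScScale) : ScScale := E.shift.prod (E.prod E)

end ScScale

/-! ### Sc-calculus

A map between scales is given by its restrictions `f m : E_m → F_m` to all levels; these are
compatible with the inclusions on the domain of the map as soon as the map is sc-continuous. -/

/-- Maps given on all levels. -/
abbrev ScFun (E F : ScScale) : Type := ∀ m, E.X m → F.X m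

/-- The filtration `U_m = U ∩ E_m` of a subset `U ⊆ E_0`. -/
def levelSet (E : ScScale) (U : Set (E.X 0)) (m : ℕ) : Set (E.X m) := E.incl m ⁻¹' U

/-- The tangent `TU = U^1 ⊕ E` of a subset `U ⊆ E_0`. -/
def tangentSet (E : ScScale) (U : Set (E.X 0)) : Set (E.tangent.X 0) :=
  {y : E.X 1 × E.X 0 | E.ι 0 y.1 ∈ U}

/-- `f` is sc-continuous (of class sc⁰) on `U`. -/
def IsSc0 (E F : ScScale) (U : Set (E.X 0)) (f : ScFun E F) : Prop :=
  (∀ m, ContinuousOn (f m) (levelSet E U m)) ∧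
  ∀ m, ∀ x ∈ levelSet E U (m + 1), F.ι m (f (m + 1) x) = f m (E.ι m x)

/-- The bounded operator `A : E_0 → F_0` is an sc-derivative of `f` at the point `x` of regularity
one. -/
def HasScDerivAt (E F : ScScale) (U : Set (E.X 0)) (f : ScFun E F) (x : E.X 1)
    (A : E.X 0 →L[ℝ] F.X 0) : Prop :=
  (fun h : E.X 1 => f 0 (E.ι 0 (x + h)) - f 0 (E.ι 0 x) - A (E.ι 0 h))
    =o[𝓝[{h : E.X 1 | E.ι 0 (x + h) ∈ U}] 0] (fun h : E.X 1 => h)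

open Classical in
/-- The sc-derivative `Df(x) : E_0 → F_0` at a point `x ∈ U_1` (zero if there is none). -/
def scDeriv (E F : ScScale) (U : Set (E.X 0)) (f : ScFun E F) (x : E.X 1) : E.X 0 →L[ℝ] F.X 0 :=
  if h : ∃ A, HasScDerivAt E F U f x A then h.choose else 0

/-- `f` is of class sc¹ on `U`, with tangent map `Tf = g : TU → TF`. -/
def IsTangentMap (E F : ScScale) (U : Set (E.X 0)) (f : ScFun E F)
    (g : ScFun E.tangent F.tangent) : Prop :=
  IsSc0 E F U f ∧
  (∀ x : E.X 1, E.ι 0 x ∈ U → ∃ A : E.X 0 →L[ℝ] F.X 0, HasScDerivAt E F U f x A ∧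
    ∀ h : E.X 0, g 0 (x, h) = (f 1 x, A h)) ∧
  IsSc0 E.tangent F.tangent (tangentSet E U) g

open Classical in
/-- The tangent map `Tf` of a map of class sc¹ on `U` (zero if `f` is not of this class). -/
def scTangentMap (E F : ScScale) (U : Set (E.X 0)) (f : ScFun E F) : ScFun E.tangent F.tangent :=
  if h : ∃ g, IsTangentMap E F U f g then h.choose else fun _ _ => 0

/-- `f` is of class sc^k on `U`: it is sc⁰ if `k = 0`; for `k + 1`, it is sc¹ and its tangent map is
of class sc^k. -/
def IsSc : ℕ → ∀ (E F : ScScale) (_ : Set (E.X 0)) (_ : ScFun E F), Prop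
  | 0, E, F, U, f => IsSc0 E F U f
  | k + 1, E, F, U, f =>
      ∃ g, IsTangentMap E F U f g ∧ IsSc k E.tangent F.tangent (tangentSet E U) g

/-- `f` is sc-smooth on `U`. -/
def IsScSmooth (E F : ScScale) (U : Set (E.X 0)) (f : ScFun E F) : Prop :=
  ∀ k, IsSc k E F U f

/-! ### Sc-smooth retracts and the M-polyfolds which they carry -/

/-- The data of a retract `X = r(E)` in a scale `E`. The identity map of `X` is a global chart, in
which all objects on `X` below are written. -/
structure ScRetract where
  E : ScScale
  r : ScFun E E

namespace ScRetract

variable (M : ScRetract)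

/-- `X_m`, the points of `X` of regularity `m`. -/
def pts (m : ℕ) : Set (M.E.X m) := Set.range (M.r m)

/-- `X = r(E)` is an M-polyfold: `E` is an sc-Banach space, `r` is an sc-smooth retraction and the
topology of `X` is Hausdorff and paracompact. -/
structure IsMPolyfold : Prop where
  scBanach : M.E.IsScBanach
  smooth : IsScSmooth M.E M.E univ M.r
  retraction : ∀ m x, M.r m (M.r m x) = M.r m x
  hausdorff : T2Space (M.pts 0)
  paracompact : ParacompactSpace (M.pts 0)

/-- The tangent space `T_p X = im Dr(p) ⊆ E_0` at a point `p ∈ X_1`. -/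
def tangentSpace (p : M.E.X 1) : Submodule ℝ (M.E.X 0) :=
  LinearMap.range (scDeriv M.E M.E univ M.r p : M.E.X 0 →ₗ[ℝ] M.E.X 0)

/-- Every tangent space has infinite or even dimension. -/
def IsEvenDimensional : Prop :=
  ∀ p ∈ M.pts 1, ¬ FiniteDimensional ℝ (M.tangentSpace p) ∨
    Even (Module.finrank ℝ (M.tangentSpace p))

/-- The retraction `Tr` of `TE` onto the tangent bundle `TX`. -/
def Tr : ScFun M.E.tangent M.E.tangent := scTangentMap M.E M.E univ M.r

/-- The retraction `(p, v, w) ↦ (r(p), Dr(p)v, Dr(p)w)` onto the Whitney sum `TX ⊕ TX`. -/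
def whitneyR : ScFun M.E.whitney M.E.whitney := fun m y =>
  (M.r (m + 1) y.1, (M.Tr m (y.1, y.2.1)).2, (M.Tr m (y.1, y.2.2)).2)

/-- For a subset `W` of `E_1`, the preimage of `W` under the retraction `r` of `E^1` onto `X^1`. -/
def pre (W : Set (M.E.X 1)) : Set (M.E.shift.X 0) := {x : M.E.X 1 | M.r 1 x ∈ W}

/-- The part of `pre W` in the scale `E^2`. -/
def pre₂ (W : Set (M.E.X 1)) : Set (M.E.shift.shift.X 0) :=
  {x : M.E.X 2 | M.E.ι 1 (M.r 2 x) ∈ W}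

/-! ### Vector fields and the Lie bracket -/

/-- `p ↦ (p, σ p)` is an sc-smooth vector field on the open subset `X_1 ∩ W` of `X^1`, that is, an
sc-smooth map from this set to `TX` over the identity. As always for maps on retracts, sc-smoothness
is that of the composition with the retraction. -/
def IsVectorField (W : Set (M.E.X 1)) (σ : ScFun M.E.shift M.E) : Prop :=
  IsScSmooth M.E.shift M.E.tangent (M.pre W)
    (fun m x => (M.r (m + 1) x, σ m (M.r (m + 1) x))) ∧
  ∀ p ∈ M.pts 1, p ∈ W → σ 0 p ∈ M.tangentSpace p

/-- `Dτ(p) h` for a vector field `τ` on `X_1 ∩ W`, at `p ∈ X_2` and `h ∈ T_p X^1`, on all levels. -/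
def fieldDeriv (W : Set (M.E.X 1)) (τ : ScFun M.E.shift M.E) (m : ℕ)
    (p : M.E.X (m + 2)) (h : M.E.X (m + 1)) : M.E.X m :=
  (scTangentMap M.E.shift M.E (M.pre W) (fun m x => τ m (M.r (m + 1) x)) m (p, h)).2

/-- The Lie bracket `[σ, τ](p) = Dτ(p)σ(p) - Dσ(p)τ(p)`, `p ∈ X_2`. This is the sign for
which the usual formula for the exterior derivative defines a tensor; vanishing of the Nijenhuis tensor
and integrability do not depend on it. -/
def bracket (W : Set (M.E.X 1)) (σ τ : ScFun M.E.shift M.E) : ScFun M.E.shift.shift M.E :=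
  fun m p => M.fieldDeriv W τ m p (σ (m + 1) p) - M.fieldDeriv W σ m p (τ (m + 1) p)

/-- `p ↦ (p, η p)` is an sc-smooth map from the open subset `X_2 ∩ W` of `X^2` to `TX`, with
`η p ∈ T_p X` for all `p`. -/
def IsVectorField₂ (W : Set (M.E.X 1)) (η : ScFun M.E.shift.shift M.E) : Prop :=
  IsScSmooth M.E.shift.shift M.E.tangent (M.pre₂ W)
    (fun m x => (M.E.ι (m + 1) (M.r (m + 2) x), η m (M.r (m + 2) x))) ∧
  ∀ p ∈ M.pts 2, M.E.ι 1 p ∈ W → η 0 p ∈ M.tangentSpace (M.E.ι 1 p)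

/-! ### Almost complex structures, integrability and the Nijenhuis tensor -/

/-- The linear-algebraic part `J_p v` of a fibre-preserving map `J : TX → TX`, for `p ∈ X_1` and
`v ∈ T_p X`. -/
def fib (J : ScFun M.E.tangent M.E.tangent) (p : M.E.X 1) (v : M.E.X 0) : M.E.X 0 := (J 0 (p, v)).2

/-- `J : TX → TX` is an sc-smooth `(1,1)`-tensor field: it is an sc-smooth map which restricts, for
every `p ∈ X_1`, to a linear sc-continuous map `T_p X → T_p X`. -/
structure IsTensor11 (J : ScFun M.E.tangent M.E.tangent) : Prop where
  smooth : IsScSmooth M.E.tangent M.E.tangent univ (fun m y => J m (M.Tr m y))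
  base : ∀ p ∈ M.pts 1, ∀ v ∈ M.tangentSpace p, (J 0 (p, v)).1 = p
  mem : ∀ p ∈ M.pts 1, ∀ v ∈ M.tangentSpace p, M.fib J p v ∈ M.tangentSpace p
  add : ∀ p ∈ M.pts 1, ∀ v ∈ M.tangentSpace p, ∀ w ∈ M.tangentSpace p,
    M.fib J p (v + w) = M.fib J p v + M.fib J p w
  smul : ∀ p ∈ M.pts 1, ∀ (c : ℝ), ∀ v ∈ M.tangentSpace p, M.fib J p (c • v) = c • M.fib J p v
  scContinuous : ∀ p ∈ M.pts 1, ∃ A : ScFun M.E M.E, ∀ m,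
    ContinuousOn (A m) (levelSet M.E (M.tangentSpace p) m) ∧
    ∀ v ∈ levelSet M.E (M.tangentSpace p) m, M.E.incl m (A m v) = M.fib J p (M.E.incl m v)

/-- `(X, J)` is an almost complex M-polyfold. -/
structure IsAlmostComplex (J : ScFun M.E.tangent M.E.tangent) : Prop where
  mpolyfold : M.IsMPolyfold
  even : M.IsEvenDimensional
  reflexive : M.E.IsReflexive
  tensor : M.IsTensor11 J
  square : ∀ p ∈ M.pts 1, ∀ v ∈ M.tangentSpace p, M.fib J p (M.fib J p v) = -v

/-- The vector field `Jσ`. -/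
def applyJ (J : ScFun M.E.tangent M.E.tangent) (σ : ScFun M.E.shift M.E) : ScFun M.E.shift M.E :=
  fun m p => (J m (p, σ m p)).2

/-- `a + i b` is an sc-smooth section of `T^{1,0} X` over `X_1 ∩ W`; being in the `i`-eigenspace of
the complexification of `J` means `J a = -b` and `J b = a`. -/
def IsSection10 (J : ScFun M.E.tangent M.E.tangent) (W : Set (M.E.X 1))
    (a b : ScFun M.E.shift M.E) : Prop :=
  M.IsVectorField W a ∧ M.IsVectorField W b ∧
  ∀ p ∈ M.pts 1, p ∈ W → M.fib J p (a 0 p) = -b 0 p ∧ M.fib J p (b 0 p) = a 0 p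

/-- `a + i b` is an sc-smooth section of `T^{1,0} X` over `X_2 ∩ W`. -/
def IsSection10₂ (J : ScFun M.E.tangent M.E.tangent) (W : Set (M.E.X 1))
    (a b : ScFun M.E.shift.shift M.E) : Prop :=
  M.IsVectorField₂ W a ∧ M.IsVectorField₂ W b ∧
  ∀ p ∈ M.pts 2, M.E.ι 1 p ∈ W →
    M.fib J (M.E.ι 1 p) (a 0 p) = -b 0 p ∧ M.fib J (M.E.ι 1 p) (b 0 p) = a 0 p

/-- `J` is integrable: for all sc-smooth local sections `a + i b` and `c + i d` of `T^{1,0} X`, the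
complex bilinear extension `[a + i b, c + i d] = ([a,c] - [b,d]) + i ([a,d] + [b,c])` of the bracket
is again an sc-smooth local section of `T^{1,0} X`, over the points of regularity two. -/
def IsIntegrable (J : ScFun M.E.tangent M.E.tangent) : Prop :=
  ∀ W : Set (M.E.X 1), IsOpen W → ∀ a b c d : ScFun M.E.shift M.E,
    M.IsSection10 J W a b → M.IsSection10 J W c d →
    M.IsSection10₂ J W
      (fun m p => M.bracket W a c m p - M.bracket W b d m p)
      (fun m p => M.bracket W a d m p + M.bracket W b c m p)

/-- `(X, J)` is a complex M-polyfold. -/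
structure IsComplexMPolyfold (J : ScFun M.E.tangent M.E.tangent) : Prop where
  almostComplex : M.IsAlmostComplex J
  integrable : M.IsIntegrable J

/-- The Nijenhuis tensor
`N_J(σ, τ) = [σ, τ] + J[σ, Jτ] + J[Jσ, τ] - [Jσ, Jτ]` at `p ∈ X_2`, for vector fields `σ`, `τ` on
`X_1 ∩ W`. -/
def nijenhuis (J : ScFun M.E.tangent M.E.tangent) (W : Set (M.E.X 1))
    (σ τ : ScFun M.E.shift M.E) (p : M.E.X 2) : M.E.X 0 :=
  M.bracket W σ τ 0 p
    + M.fib J (M.E.ι 1 p) (M.bracket W σ (M.applyJ J τ) 0 p)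
    + M.fib J (M.E.ι 1 p) (M.bracket W (M.applyJ J σ) τ 0 p)
    - M.bracket W (M.applyJ J σ) (M.applyJ J τ) 0 p

/-- The Nijenhuis tensor vanishes on all local vector fields. -/
def NijenhuisVanishes (J : ScFun M.E.tangent M.E.tangent) : Prop :=
  ∀ W : Set (M.E.X 1), IsOpen W → ∀ σ τ : ScFun M.E.shift M.E,
    M.IsVectorField W σ → M.IsVectorField W τ →
    ∀ p ∈ M.pts 2, M.E.ι 1 p ∈ W → M.nijenhuis J W σ τ p = 0

/-! ### Tensors of type `(0,2)`, Riemannian metrics, two-forms, Kähler structures -/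

/-- `b : TX ⊕ TX → ℝ`, `(p, v, w) ↦ b p v w`, is an sc-smooth `(0,2)`-tensor field: it is an sc-smooth
map which restricts, for every `p ∈ X_1`, to a continuous bilinear form on `T_p X`. (As the scale of
`ℝ` is constant, this continuity gives that on the other levels of `T_p X`.) -/
structure IsTensor02 (b : M.E.X 1 → M.E.X 0 → M.E.X 0 → ℝ) : Prop where
  smooth : IsScSmooth M.E.whitney (ScScale.const ℝ) univ (fun m y =>
    b (M.E.whitney.incl m (M.whitneyR m y)).1 (M.E.whitney.incl m (M.whitneyR m y)).2.1
      (M.E.whitney.incl m (M.whitneyR m y)).2.2)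
  add_left : ∀ p ∈ M.pts 1, ∀ v ∈ M.tangentSpace p, ∀ v' ∈ M.tangentSpace p,
    ∀ w ∈ M.tangentSpace p, b p (v + v') w = b p v w + b p v' w
  smul_left : ∀ p ∈ M.pts 1, ∀ (c : ℝ), ∀ v ∈ M.tangentSpace p, ∀ w ∈ M.tangentSpace p,
    b p (c • v) w = c * b p v w
  add_right : ∀ p ∈ M.pts 1, ∀ v ∈ M.tangentSpace p, ∀ w ∈ M.tangentSpace p,
    ∀ w' ∈ M.tangentSpace p, b p v (w + w') = b p v w + b p v w'
  smul_right : ∀ p ∈ M.pts 1, ∀ (c : ℝ), ∀ v ∈ M.tangentSpace p, ∀ w ∈ M.tangentSpace p,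
    b p v (c • w) = c * b p v w
  continuous : ∀ p ∈ M.pts 1, ContinuousOn (fun vw : M.E.X 0 × M.E.X 0 => b p vw.1 vw.2)
    ((M.tangentSpace p : Set (M.E.X 0)) ×ˢ (M.tangentSpace p : Set (M.E.X 0)))

/-- For every `p ∈ X_1`, `v ↦ b p v ·` is an isomorphism of topological vector spaces from `T_p X` to
its dual. -/
def IsStronglyNondegenerate (b : M.E.X 1 → M.E.X 0 → M.E.X 0 → ℝ) : Prop :=
  ∀ p ∈ M.pts 1, ∃ e : M.tangentSpace p ≃L[ℝ] StrongDual ℝ (M.tangentSpace p),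
    ∀ v w : M.tangentSpace p, e v w = b p v w

/-- `g` is a strong Riemannian metric. -/
structure IsStrongRiemannian (g : M.E.X 1 → M.E.X 0 → M.E.X 0 → ℝ) : Prop where
  tensor : M.IsTensor02 g
  symm : ∀ p ∈ M.pts 1, ∀ v ∈ M.tangentSpace p, ∀ w ∈ M.tangentSpace p, g p v w = g p w v
  strong : M.IsStronglyNondegenerate g
  pos : ∀ p ∈ M.pts 1, ∀ v ∈ M.tangentSpace p, v ≠ 0 → 0 < g p v v

/-- `Ω` is an sc-differential two-form. -/
structure IsTwoForm (Ω : M.E.X 1 → M.E.X 0 → M.E.X 0 → ℝ) : Prop where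
  tensor : M.IsTensor02 Ω
  alt : ∀ p ∈ M.pts 1, ∀ v ∈ M.tangentSpace p, Ω p v v = 0

/-- The derivative at `p ∈ X_2`, in the direction `h ∈ T_p X^1`, of a function on `X_1 ∩ W`. -/
def funDeriv (W : Set (M.E.X 1)) (F : M.E.X 1 → ℝ) (p : M.E.X 2) (h : M.E.X 1) : ℝ :=
  scDeriv M.E.shift (ScScale.const ℝ) (M.pre W)
    (fun m x => F (M.E.shift.incl m (M.r (m + 1) x))) p h

/-- The exterior derivative `dΩ(σ₀, σ₁, σ₂)` at `p ∈ X_2` of a two-form `Ω`. -/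
def extDeriv₂ (Ω : M.E.X 1 → M.E.X 0 → M.E.X 0 → ℝ) (W : Set (M.E.X 1))
    (σ₀ σ₁ σ₂ : ScFun M.E.shift M.E) (p : M.E.X 2) : ℝ :=
  M.funDeriv W (fun q => Ω q (σ₁ 0 q) (σ₂ 0 q)) p (σ₀ 1 p)
    - M.funDeriv W (fun q => Ω q (σ₀ 0 q) (σ₂ 0 q)) p (σ₁ 1 p)
    + M.funDeriv W (fun q => Ω q (σ₀ 0 q) (σ₁ 0 q)) p (σ₂ 1 p)
    - Ω (M.E.ι 1 p) (M.bracket W σ₀ σ₁ 0 p) (σ₂ 0 (M.E.ι 1 p))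
    + Ω (M.E.ι 1 p) (M.bracket W σ₀ σ₂ 0 p) (σ₁ 0 (M.E.ι 1 p))
    - Ω (M.E.ι 1 p) (M.bracket W σ₁ σ₂ 0 p) (σ₀ 0 (M.E.ι 1 p))

/-- `dΩ = 0`. -/
def IsClosedForm (Ω : M.E.X 1 → M.E.X 0 → M.E.X 0 → ℝ) : Prop :=
  ∀ W : Set (M.E.X 1), IsOpen W → ∀ σ₀ σ₁ σ₂ : ScFun M.E.shift M.E,
    M.IsVectorField W σ₀ → M.IsVectorField W σ₁ → M.IsVectorField W σ₂ →
    ∀ p ∈ M.pts 2, M.E.ι 1 p ∈ W → M.extDeriv₂ Ω W σ₀ σ₁ σ₂ p = 0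

/-- `Ω` is a strong symplectic form. -/
structure IsStrongSymplectic (Ω : M.E.X 1 → M.E.X 0 → M.E.X 0 → ℝ) : Prop where
  twoForm : M.IsTwoForm Ω
  closed : M.IsClosedForm Ω
  strong : M.IsStronglyNondegenerate Ω

/-- `(X, J, g, Ω)` is a strong Kähler M-polyfold: `(X, J)` is a complex M-polyfold, `g` is a strong
Riemannian metric compatible with `J`, and `Ω = g(J ·, ·)` is a strong symplectic form. -/
structure IsStrongKaehler (J : ScFun M.E.tangent M.E.tangent)
    (g Ω : M.E.X 1 → M.E.X 0 → M.E.X 0 → ℝ) : Prop where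
  complex : M.IsComplexMPolyfold J
  metric : M.IsStrongRiemannian g
  compatible : ∀ p ∈ M.pts 1, ∀ v ∈ M.tangentSpace p, ∀ w ∈ M.tangentSpace p,
    g p (M.fib J p v) (M.fib J p w) = g p v w
  fundamental : ∀ p ∈ M.pts 1, ∀ v ∈ M.tangentSpace p, ∀ w ∈ M.tangentSpace p,
    Ω p v w = g p (M.fib J p v) w
  symplectic : M.IsStrongSymplectic Ω

end ScRetract

/-! ### Weighted Sobolev spaces on the line -/

/-- The choices in the construction of the weights: a strictly increasing sequence `δ` with
`δ 0 = 0` and a smooth odd function `β : ℝ → [-1, 1]` which is `1` on `[1, ∞)`. -/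
structure SobolevWeights where
  δ : ℕ → ℝ
  δ_mono : StrictMono δ
  δ_zero : δ 0 = 0
  β : ℝ → ℝ
  β_smooth : ContDiff ℝ ∞ β
  β_odd : ∀ s, β (-s) = -β s
  β_le : ∀ s, |β s| ≤ 1
  β_one : ∀ s, 1 ≤ s → β s = 1

/-- Smooth functions with compact support on the line. -/
structure CcFun where
  toFun : ℝ → ℝ
  smooth : ContDiff ℝ ∞ toFun
  compact : HasCompactSupport toFun

namespace CcFun

/-- The translate `φ(· + T)`. -/
def shift (φ : CcFun) (T : ℝ) : CcFun where
  toFun := fun s => φ.toFun (s + T)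
  smooth := φ.smooth.comp (contDiff_id.add contDiff_const)
  compact := φ.compact.comp_homeomorph (Homeomorph.addRight T)

/-- The derivative `φ'`. -/
def deriv (φ : CcFun) : CcFun where
  toFun := _root_.deriv φ.toFun
  smooth := by
    have h := φ.smooth
    rw [contDiff_infty_iff_deriv] at h
    exact h.2
  compact := φ.compact.deriv

/-- The derivative of order `i`. -/
def iter (φ : CcFun) : ℕ → CcFun
  | 0 => φ
  | i + 1 => (φ.iter i).deriv

end CcFun

namespace SobolevWeights

variable (w : SobolevWeights)

/-- The measure `e^{a s β(s)} ds`. -/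
def expMeasure (a : ℝ) : Measure ℝ :=
  volume.withDensity (fun s => ENNReal.ofReal (Real.exp (a * (s * w.β s))))

/-- The measure `e^{δ_m s β(s)} ds`. -/
abbrev μ (m : ℕ) : Measure ℝ := w.expMeasure (w.δ m)

theorem mul_β_ge (s : ℝ) : -1 ≤ s * w.β s := by
  have hb := abs_le.1 (w.β_le s)
  rcases le_total 1 s with h | h
  · rw [w.β_one s h]; linarith
  rcases le_total s (-1) with h' | h'
  · have h1 := w.β_one (-s) (by linarith)
    rw [w.β_odd] at h1
    nlinarith
  · have : |s * w.β s| ≤ 1 := by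
      rw [abs_mul]
      exact mul_le_one₀ (abs_le.2 ⟨h', h⟩) (abs_nonneg _) (w.β_le s)
    exact (abs_le.1 this).1

theorem expMeasure_zero : w.expMeasure 0 = volume := by
  simp [expMeasure]

theorem expMeasure_le {a b : ℝ} (h : a ≤ b) :
    w.expMeasure a ≤ ENNReal.ofReal (Real.exp (b - a)) • w.expMeasure b := by
  have hm : Measurable fun s => ENNReal.ofReal (Real.exp (b * (s * w.β s))) := by
    have := w.β_smooth.continuous
    fun_prop
  unfold expMeasure
  rw [← withDensity_smul _ hm]
  refine withDensity_mono (Filter.Eventually.of_forall fun s => ?_)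
  simp only [Pi.smul_apply, smul_eq_mul]
  rw [← ENNReal.ofReal_mul (Real.exp_pos _).le, ← Real.exp_add]
  refine ENNReal.ofReal_le_ofReal (Real.exp_le_exp.2 ?_)
  nlinarith [w.mul_β_ge s]

theorem volume_le (m : ℕ) : (volume : Measure ℝ) ≤ ENNReal.ofReal (Real.exp (w.δ m)) • w.μ m := by
  have h := w.expMeasure_le (a := 0) (b := w.δ m)
    (by rw [← w.δ_zero]; exact w.δ_mono.monotone (Nat.zero_le m))
  rwa [expMeasure_zero, sub_zero] at h

theorem volume_ac (m : ℕ) : (volume : Measure ℝ) ≪ w.μ m :=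
  Measure.absolutelyContinuous_of_le_smul (w.volume_le m)

instance (m : ℕ) : IsLocallyFiniteMeasure (w.μ m) := by
  have := w.β_smooth.continuous
  exact IsLocallyFiniteMeasure.withDensity_ofReal (by fun_prop)

theorem integrable_mul {m : ℕ} (g : Lp ℝ 2 (w.μ m)) {φ : ℝ → ℝ} (h : Continuous φ)
    (hc : HasCompactSupport φ) : Integrable (fun s => g s * φ s) :=
  have hg : MemLp g 2 volume :=
    (Lp.memLp g).of_measure_le_smul ENNReal.ofReal_ne_top (w.volume_le m)
  hg.integrable_mul (q := 2) (h.memLp_of_hasCompactSupport hc)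

/-- `g` is the weak derivative of `f`. -/
def IsWeakDeriv {m : ℕ} (f g : Lp ℝ 2 (w.μ m)) : Prop :=
  ∀ φ : CcFun, ∫ s, f s * φ.deriv.toFun s = -∫ s, g s * φ.toFun s

/-- The weighted Sobolev space `W^{m,δ_m}`: an element is a function `f` together with its weak
derivatives, that is, a family `(f, Df, …, D^m f)` of elements of `L²(e^{δ_m s β(s)} ds)` each of
which is the weak derivative of the previous one. The norm is the Hilbert space norm
`(∫ (|f|² + |Df|² + ⋯ + |D^m f|²) e^{δ_m s β(s)} ds)^{1/2}`. -/
def sobolev (m : ℕ) : Submodule ℝ (PiLp 2 (fun _ : Fin (m + 1) => Lp ℝ 2 (w.μ m))) where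
  carrier := {f | ∀ i : Fin m, w.IsWeakDeriv (f i.castSucc) (f i.succ)}
  zero_mem' := fun i φ => by
    have h : ((0 : Lp ℝ 2 (w.μ m)) : ℝ → ℝ) =ᵐ[volume] 0 := (w.volume_ac m).ae_eq (Lp.coeFn_zero _ _ _)
    have h' : ∀ ψ : ℝ → ℝ, ∫ s, (0 : Lp ℝ 2 (w.μ m)) s * ψ s = 0 := fun ψ => by
      rw [integral_congr_ae (g := fun _ => (0 : ℝ)) (h.mono fun s hs => by
        simp only [hs, Pi.zero_apply, zero_mul])]; simp
    simp only [PiLp.zero_apply, h', neg_zero]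
  add_mem' := fun {f g} hf hg i φ => by
    have h : ∀ (a b : Lp ℝ 2 (w.μ m)) (ψ : CcFun),
        ∫ s, (a + b : Lp ℝ 2 (w.μ m)) s * ψ.toFun s
          = (∫ s, a s * ψ.toFun s) + ∫ s, b s * ψ.toFun s := fun a b ψ => by
      rw [← integral_add (w.integrable_mul a ψ.smooth.continuous ψ.compact)
        (w.integrable_mul b ψ.smooth.continuous ψ.compact)]
      refine integral_congr_ae (((w.volume_ac m).ae_eq (Lp.coeFn_add a b)).mono fun s hs => ?_)
      change _ * _ = _ + _; rw [hs, Pi.add_apply, add_mul]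
    simp only [PiLp.add_apply, h, hf i φ, hg i φ, neg_add]
  smul_mem' := fun c f hf i φ => by
    have h : ∀ (a : Lp ℝ 2 (w.μ m)) (ψ : CcFun),
        ∫ s, (c • a : Lp ℝ 2 (w.μ m)) s * ψ.toFun s = c * ∫ s, a s * ψ.toFun s := fun a ψ => by
      rw [← integral_const_mul]
      refine integral_congr_ae (((w.volume_ac m).ae_eq (Lp.coeFn_smul c a)).mono fun s hs => ?_)
      change _ * _ = _ * _; rw [hs, Pi.smul_apply, smul_eq_mul, mul_assoc]
    simp only [PiLp.smul_apply, h, hf i φ, mul_neg]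

/-- The map `L²(e^{δ_{m+1} s β(s)} ds) → L²(e^{δ_m s β(s)} ds)`, `f ↦ f`. -/
def lower (m : ℕ) : Lp ℝ 2 (w.μ (m + 1)) →L[ℝ] Lp ℝ 2 (w.μ m) :=
  Lp.LpToLpOfMeasureLeSMul ENNReal.ofReal_ne_top
    (w.expMeasure_le (w.δ_mono.monotone (Nat.le_succ m)))

theorem lower_coe (m : ℕ) (f : Lp ℝ 2 (w.μ (m + 1))) :
    (w.lower m f : ℝ → ℝ) =ᵐ[volume] f :=
  (w.volume_ac m).ae_eq (Lp.coeFn_LpToLpOfMeasureLeSMul _ _ f)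

/-- The inclusion `W^{m+1,δ_{m+1}} ⊆ W^{m,δ_m}`. -/
def sobolevIncl (m : ℕ) : w.sobolev (m + 1) →ₗ[ℝ] w.sobolev m where
  toFun := fun f => ⟨WithLp.toLp 2 fun i => w.lower m (f.1 i.castSucc), fun i φ => by
    have h := f.2 i.castSucc φ
    have h1 : ∀ (a : Lp ℝ 2 (w.μ (m + 1))) (ψ : ℝ → ℝ),
        ∫ s, w.lower m a s * ψ s = ∫ s, a s * ψ s := fun a ψ =>
      integral_congr_ae ((w.lower_coe m a).mono fun s hs => by simp [hs])
    simp only [h1]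
    exact h⟩
  map_add' := fun f g => by ext1; ext1 i; simp
  map_smul' := fun c f => by ext1; ext1 i; simp

/-- The scale of the spaces `E_m = W^{m,δ_m}`; its level `0` is `L²(ℝ)`. -/
abbrev scale : ScScale where
  X := fun m => w.sobolev m
  ι := fun m => w.sobolevIncl m

theorem memLp_cc (m : ℕ) (φ : CcFun) : MemLp φ.toFun 2 (w.μ m) :=
  φ.smooth.continuous.memLp_of_hasCompactSupport φ.compact

/-- A smooth function with compact support, as an element of `W^{m,δ_m}`. -/
def ofCc (m : ℕ) (φ : CcFun) : w.sobolev m :=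
  ⟨WithLp.toLp 2 fun i => (w.memLp_cc m (φ.iter i)).toLp (φ.iter i).toFun, fun i ψ => by
    have h : ∀ (χ : CcFun) (η : ℝ → ℝ),
        ∫ s, (w.memLp_cc m χ).toLp χ.toFun s * η s = ∫ s, χ.toFun s * η s := fun χ η =>
      integral_congr_ae (((w.volume_ac m).ae_eq (MemLp.coeFn_toLp _)).mono fun s hs => by
        change _ * _ = _ * _; rw [hs])
    have hd : ∀ χ : CcFun, ∀ s, HasDerivAt χ.toFun (χ.deriv.toFun s) s := fun χ s =>
      (χ.smooth.differentiable (by simp) s).hasDerivAt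
    have hi : ∀ χ η : CcFun, Integrable fun s => χ.toFun s * η.toFun s := fun χ η =>
      (χ.smooth.continuous.mul η.smooth.continuous).integrable_of_hasCompactSupport
        χ.compact.mul_right
    refine (h _ _).trans (Eq.trans ?_ (congrArg Neg.neg (h _ _).symm))
    exact integral_mul_deriv_eq_deriv_mul_of_integrable (fun s _ => hd _ s) (fun s _ => hd _ s)
      (hi _ _) (hi (φ.iter i).deriv _) (hi _ _)⟩

/-- The `L²(ℝ)` inner product of `f ∈ W^{m,δ_m}` and `φ`. -/
def pair {m : ℕ} (f : w.sobolev m) (φ : CcFun) : ℝ := ∫ s, (f.1 0) s * φ.toFun s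

end SobolevWeights

/-! ### The M-polyfolds of class Γ -/

/-- The data from which an M-polyfold `Γ_n^k` is built: weights as above and `k` smooth compactly
supported functions which are orthonormal in `L²(ℝ)`. -/
structure GammaData (n k : ℕ) extends SobolevWeights where
  γ : Fin k → CcFun
  orthonormal : ∀ i j, ∫ s, (γ i).toFun s * (γ j).toFun s = if i = j then 1 else 0

/-- The linear map `(c_0, c_1, c_2, c_3, …) ↦ (-c_1, c_0, -c_3, c_2, …)`. -/
def pairRotation (c : ℕ → ℝ) (i : ℕ) : ℝ := if Even i then -c (i + 1) else c (i - 1)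

namespace GammaData

variable {n k : ℕ} (Γ : GammaData n k)

/-- The sc-Banach space `ℝⁿ ⊕ ℝ ⊕ L²(ℝ)`; its elements are written `((x, t), f)`. -/
abbrev space : ScScale :=
  ((ScScale.const (EuclideanSpace ℝ (Fin n))).prod (ScScale.const ℝ)).prod Γ.scale

/-- The function `γ_j(· + e^{1/t})`. -/
def moved (t : ℝ) (j : Fin k) : CcFun := (Γ.γ j).shift (Real.exp (1 / t))

/-- The function `ρ_{j,t} = d/dt γ_j(· + e^{1/t}) = -(e^{1/t} / t²) γ_j'(· + e^{1/t})`, `t > 0`. -/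
def rho (m : ℕ) (t : ℝ) (j : Fin k) : Γ.sobolev m :=
  (-(Real.exp (1 / t) / t ^ 2)) • Γ.ofCc m ((Γ.γ j).deriv.shift (Real.exp (1 / t)))

/-- `π_t(f) = ∑_j ⟨f, γ_j(· + e^{1/t})⟩ γ_j(· + e^{1/t})` for `t > 0`, and `π_t = 0` for `t ≤ 0`. -/
def proj (m : ℕ) (t : ℝ) (f : Γ.sobolev m) : Γ.sobolev m :=
  if t ≤ 0 then 0 else ∑ j, Γ.pair f (Γ.moved t j) • Γ.ofCc m (Γ.moved t j)

/-- The M-polyfold `Γ_n^k`, the image of the retraction `r(x, t, f) = (x, t, π_t(f))`. -/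
def X : ScRetract where
  E := Γ.space
  r := fun m p => (p.1, Γ.proj m p.1.2 p.2)

/-- `ξ_t = ∑_j ⟨f, γ_j(· + e^{1/t})⟩ ρ_{j,t}`. -/
def xi (m : ℕ) (t : ℝ) (f : Γ.sobolev (m + 1)) : Γ.sobolev m :=
  ∑ j, Γ.pair f (Γ.moved t j) • Γ.rho m t j

/-- For a tangent vector `v = (δx, δt, δf + δt ξ_t)` at `p = (x, t, f)`, where `t > 0` and `δf` lies in
the span of the `γ_j(· + e^{1/t})`, the coefficient `⟨δf, γ_i(· + e^{1/t})⟩`, indexed by the natural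
numbers (with value `0` for `k ≤ i`). -/
def vert (m : ℕ) (p : Γ.space.X (m + 1)) (v : Γ.space.X m) (i : ℕ) : ℝ :=
  if h : i < k then Γ.pair (v.2 - v.1.2 • Γ.xi m p.1.2 p.2) (Γ.moved p.1.2 ⟨i, h⟩) else 0

/-- The coordinates `(δx_1, …, δx_n, δt)` of a tangent vector, indexed by the natural numbers from `0`
on (with value `0` for `n < i`). -/
def horiz (y : EuclideanSpace ℝ (Fin n) × ℝ) (i : ℕ) : ℝ :=
  if h : i < n then y.1 ⟨i, h⟩ else if i = n then y.2 else 0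

/-- For odd `n`, the linear map
`(δx_1, …, δx_n, δt) ↦ (-δx_2, δx_1, …, -δx_{n-1}, δx_{n-2}, -δt, δx_n)`. -/
def horizJ (y : EuclideanSpace ℝ (Fin n) × ℝ) : EuclideanSpace ℝ (Fin n) × ℝ :=
  (WithLp.toLp 2 fun i => pairRotation (horiz y) i, pairRotation (horiz y) n)

/-- The almost complex structure `J` on `Γ_n^k`, for odd `n` and even `k`. It sends a tangent vector
`(δx, δt, δf + δt ξ_t)` at `(x, t, f)` to `(δx', δt', δf' + δt' ξ_t)`, where
`(δx', δt') = (-δx_2, δx_1, …, -δt, δx_n)` and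
`δf' = ∑_j (⟨δf, γ_{2j-1}⟩ γ_{2j} - ⟨δf, γ_{2j}⟩ γ_{2j-1})` with the translates by `e^{1/t}` of the
`γ_i`; for `t ≤ 0` the last component is `0`. -/
def J : ScFun Γ.X.E.tangent Γ.X.E.tangent := fun m (y : Γ.space.X (m + 1) × Γ.space.X m) =>
  (y.1, (horizJ y.2.1,
    if y.1.1.2 ≤ 0 then 0 else
      (∑ j : Fin k, pairRotation (Γ.vert m y.1 y.2) j • Γ.ofCc m (Γ.moved y.1.1.2 j))
        + (horizJ y.2.1).2 • Γ.xi m y.1.1.2 y.1.2))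

/-- The Riemannian metric on `Γ_n^k` given at `(x, t, f)` by
`∑ δx_i δy_i + δt δs + ∑_j ⟨δf, γ_j(· + e^{1/t})⟩ ⟨δh, γ_j(· + e^{1/t})⟩` on the tangent vectors
`(δx, δt, δf + δt ξ_t)` and `(δy, δs, δh + δs ξ_t)`; for `t ≤ 0` the last sum is absent. -/
def g (p : Γ.X.E.X 1) (v w : Γ.X.E.X 0) : ℝ :=
  let p : Γ.space.X 1 := p
  let v : Γ.space.X 0 := v
  let w : Γ.space.X 0 := w
  (∑ i, v.1.1 i * w.1.1 i) + v.1.2 * w.1.2 +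
    if p.1.2 ≤ 0 then 0 else ∑ j : Fin k, Γ.vert 0 p v j * Γ.vert 0 p w j

/-- The fundamental form `g(J ·, ·)`. -/
def fundForm (p : Γ.X.E.X 1) (v w : Γ.X.E.X 0) : ℝ := Γ.g p (Γ.X.fib Γ.J p v) w

end GammaData

end

open Filter Asymptotics

/-! ### Levels of scales -/

namespace ScScale

variable (E F : ScScale)

/-! The geometry of X is pulled back from a constant structure on the finite-dimensional space V =
ℝⁿ × ℝ × ℝᵏ. Let Φ(x, t, f) = (x, t, (⟨f, γ_{j,t}⟩)_j), with last component 0 for t ≤ 0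
(`GammaData.flat`). It is sc-smooth on the whole ambient scale, Φ ∘ r = Φ, and the derivative of the
retraction factors as Dr(p) = F_p ∘ DΦ(p) with F_p linear (`isTangentMap_retr`). As Dr(p) is the
identity on T_pX, DΦ(p) is injective there (`isImmersion_flat`). It maps T_pX onto V for t > 0 and
onto ℝⁿ⁺¹ × 0 for t ≤ 0, so Φ is not a chart; but injectivity is enough to check identities between
tangent vectors. Through DΦ(p) the tensors J, g and ω become the rotation of coordinate pairs, the
Euclidean product and the resulting form, independently of p (`flatDeriv_fib_J`, `g_eq`).

The differential identities reduce to the constant case by DΦ[σ, τ] = D(DΦ τ)σ - D(DΦ σ)τ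
(`IsVectorField.apply_bracket`): the terms with D²Φ cancel because second sc-derivatives are
symmetric (`IsTangentMap.second_symm`). A constant operator commutes with differentiation, so the
Nijenhuis expression and the (0,1)-part of a bracket of (1,0)-fields cancel algebraically; dω
vanishes by the product rule and antisymmetry. That brackets are tangent to X is the same formula
with r in place of Φ. Strong nondegeneracy is linear algebra, as the tangent spaces are
finite-dimensional.

The analytic point is sc-smoothness across t = 0. With T = e^{1/t} the translates sit near -T, where
the weight of level m is about e^{δ_m T}. Hence f ↦ ⟨f, φ(· + T)⟩ ψ(· + T) has norm at most a
constant times e^{-(δ_l - δ_m)T/2} from level l to level m (`exists_norm_rank_le`). For m < l this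
decay in T beats every power of T and of 1/t, so the family extended by 0 is C^∞ in operator norm;
for l = m it is bounded, and strongly continuous by density. Those two facts give sc-smoothness
(`isSc_and_isTangentMap_flatFamily`).

Two foundations are needed. The sc-calculus (chain rule, `IsTangentMap.comp`, and passage to E¹,
`IsTangentMap.shift`) rests on the compactness of the inclusions. The weighted Sobolev spaces form
an sc-Banach space (`isScBanach_scale`): density of test functions comes from cutting off and
mollifying, compactness from averaging over short intervals together with the gain of weight at
infinity. -/

theorem incl_succ_apply (m : ℕ) (x : E.X (m + 1)) : E.incl (m + 1) x = E.incl m (E.ι m x) := rfl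

theorem shift_incl (m : ℕ) (x : E.X (m + 1)) : E.ι 0 (E.shift.incl m x) = E.incl (m + 1) x := by
  induction m with
  | zero => rfl
  | succ k ih => exact ih (E.ι (k + 1) x)

theorem const_incl (V : Type) [NormedAddCommGroup V] [NormedSpace ℝ V] (m : ℕ) (x : V) :
    (const V).incl m x = x := by
  induction m with
  | zero => rfl
  | succ k ih => exact ih

theorem prod_incl (m : ℕ) (x : (E.prod F).X m) :
    (E.prod F).incl m x = (E.incl m x.1, F.incl m x.2) := by
  induction m with
  | zero => rfl
  | succ k ih => exact ih ((E.prod F).ι k x)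

variable {E F}

namespace IsScBanach

theorem continuous_ι (h : E.IsScBanach) (m : ℕ) : Continuous (E.ι m) := (h.compact m).continuous

theorem continuous_incl (h : E.IsScBanach) (m : ℕ) : Continuous (E.incl m) := by
  induction m with
  | zero => exact continuous_id
  | succ k ih => exact ih.comp (h.continuous_ι k)

theorem injective_incl (h : E.IsScBanach) (m : ℕ) : Function.Injective (E.incl m) := by
  induction m with
  | zero => exact Function.injective_id
  | succ k ih => exact ih.comp (h.injective k)

theorem shift (h : E.IsScBanach) : E.shift.IsScBanach where
  complete := fun m => h.complete (m + 1)
  injective := fun m => h.injective (m + 1)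
  compact := fun m => h.compact (m + 1)
  dense := fun m => (h.dense (m + 1)).mono (by
    rintro _ ⟨y, hy, hx⟩
    exact ⟨fun i => y (i + 1), fun i => hy (i + 1), hx⟩)

theorem prod (hE : E.IsScBanach) (hF : F.IsScBanach) : (E.prod F).IsScBanach where
  complete := fun m => by
    have := hE.complete m; have := hF.complete m
    infer_instance
  injective := fun m => (hE.injective m).prodMap (hF.injective m)
  compact := fun m => by
    obtain ⟨K, hK, h⟩ := hE.compact m
    obtain ⟨K', hK', h'⟩ := hF.compact m
    refine ⟨K ×ˢ K', hK.prod hK', ?_⟩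
    exact prod_mem_nhds h h'
  dense := fun m => by
    refine ((hE.dense m).prod (hF.dense m)).mono ?_
    rintro ⟨a, b⟩ ⟨⟨y, hy, hx⟩, ⟨y', hy', hx'⟩⟩
    exact ⟨fun i => (y i, y' i), fun i => Prod.ext (hy i) (hy' i), Prod.ext hx hx'⟩

theorem tangent (h : E.IsScBanach) : E.tangent.IsScBanach := h.shift.prod h

theorem whitney (h : E.IsScBanach) : E.whitney.IsScBanach := h.shift.prod (h.prod h)

theorem const (V : Type) [NormedAddCommGroup V] [NormedSpace ℝ V] [FiniteDimensional ℝ V] :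
    (ScScale.const V).IsScBanach where
  complete := fun _ => FiniteDimensional.complete ℝ V
  injective := fun _ => Function.injective_id
  compact := fun _ => by
    have : ProperSpace V := FiniteDimensional.proper ℝ V
    exact ⟨Metric.closedBall 0 1, isCompact_closedBall 0 1, Metric.closedBall_mem_nhds _ one_pos⟩
  dense := fun _ => by
    convert dense_univ
    exact eq_univ_of_forall fun x => ⟨fun _ => x, fun _ => rfl, rfl⟩

theorem denseRange_ι (h : E.IsScBanach) (m : ℕ) : DenseRange (E.ι m) :=
  (h.dense m).mono (by
    rintro _ ⟨y, hy, hx⟩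
    exact ⟨y (m + 1), (hy m).trans hx⟩)

end IsScBanach

end ScScale

/-! ### Level sets -/

section LevelSet

variable {E F G : ScScale} {U : Set (E.X 0)} {V : Set (F.X 0)}

theorem mem_levelSet_one {x : E.X 1} : x ∈ levelSet E U 1 ↔ E.ι 0 x ∈ U := Iff.rfl

theorem mem_levelSet_succ {m : ℕ} {x : E.X (m + 1)} :
    x ∈ levelSet E U (m + 1) ↔ E.ι m x ∈ levelSet E U m := Iff.rfl

theorem levelSet_mono {U' : Set (E.X 0)} (h : U' ⊆ U) (m : ℕ) : levelSet E U' m ⊆ levelSet E U m :=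
  fun _ hx => h hx

theorem levelSet_shift (U : Set (E.X 0)) (m : ℕ) :
    levelSet E.shift (levelSet E U 1) m = levelSet E U (m + 1) := by
  ext x
  change E.ι 0 (E.shift.incl m x) ∈ U ↔ E.incl (m + 1) x ∈ U
  rw [E.shift_incl]

theorem mem_levelSet_tangent {m : ℕ} {x : E.tangent.X m} :
    x ∈ levelSet E.tangent (tangentSet E U) m ↔ x.1 ∈ levelSet E U (m + 1) := by
  change E.ι 0 ((E.tangent.incl m x).1) ∈ U ↔ E.incl (m + 1) x.1 ∈ U
  rw [ScScale.prod_incl, E.shift_incl]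

theorem isOpen_levelSet (hE : E.IsScBanach) (hU : IsOpen U) (m : ℕ) : IsOpen (levelSet E U m) :=
  hU.preimage (hE.continuous_incl m)

theorem isOpen_tangentSet (hE : E.IsScBanach) (hU : IsOpen U) : IsOpen (tangentSet E U) :=
  hU.preimage ((hE.continuous_ι 0).comp continuous_fst)

end LevelSet

/-! ### Maps of class sc⁰ -/

section Sc0

variable {E F G : ScScale} {U : Set (E.X 0)} {V : Set (F.X 0)} {f f' : ScFun E F} {g : ScFun F G}

theorem IsSc0.incl_apply (h : IsSc0 E F U f) (m : ℕ) {x : E.X m} (hx : x ∈ levelSet E U m) :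
    F.incl m (f m x) = f 0 (E.incl m x) := by
  induction m with
  | zero => rfl
  | succ k ih =>
    rw [F.incl_succ_apply, h.2 k x hx, ih (mem_levelSet_succ.1 hx), E.incl_succ_apply]

theorem IsSc0.mapsTo (h : IsSc0 E F U f) (hm : MapsTo (f 0) U V) (m : ℕ) :
    MapsTo (f m) (levelSet E U m) (levelSet F V m) := fun x hx => by
  change F.incl m (f m x) ∈ V
  rw [h.incl_apply m hx]
  exact hm hx

theorem IsSc0.comp (hg : IsSc0 F G V g) (hf : IsSc0 E F U f) (hm : MapsTo (f 0) U V) :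
    IsSc0 E G U (fun m x => g m (f m x)) :=
  ⟨fun m => (hg.1 m).comp (hf.1 m) (hf.mapsTo hm m), fun m x hx => by
    rw [hg.2 m _ (hf.mapsTo hm (m + 1) hx), hf.2 m x hx]⟩

theorem IsSc0.congr (hf : IsSc0 E F U f) (h : ∀ m, EqOn (f' m) (f m) (levelSet E U m)) :
    IsSc0 E F U f' :=
  ⟨fun m => (hf.1 m).congr (h m), fun m x hx => by
    rw [h (m + 1) hx, h m (mem_levelSet_succ.1 hx), hf.2 m x hx]⟩

theorem IsSc0.mono {U' : Set (E.X 0)} (hf : IsSc0 E F U f) (h : U' ⊆ U) : IsSc0 E F U' f :=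
  ⟨fun m => (hf.1 m).mono (levelSet_mono h m), fun m x hx => hf.2 m x (levelSet_mono h _ hx)⟩

theorem IsSc0.shift (hf : IsSc0 E F U f) :
    IsSc0 E.shift F.shift (levelSet E U 1) (fun m => f (m + 1)) :=
  ⟨fun m => by rw [levelSet_shift]; exact hf.1 (m + 1),
    fun m x hx => hf.2 (m + 1) x (by rwa [levelSet_shift] at hx)⟩

theorem IsSc0.prodMk {f₂ : ScFun E G} (hf : IsSc0 E F U f) (hf₂ : IsSc0 E G U f₂) :
    IsSc0 E (F.prod G) U (fun m x => (f m x, f₂ m x)) :=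
  ⟨fun m => (hf.1 m).prodMk (hf₂.1 m), fun m x hx => Prod.ext (hf.2 m x hx) (hf₂.2 m x hx)⟩

end Sc0

/-! ### Sc-derivatives -/

section ScDeriv

variable {E F G : ScScale} {U : Set (E.X 0)} {V : Set (F.X 0)} {f f' : ScFun E F} {g : ScFun F G}

/-- On a compact set of directions, the derivative depends uniformly on the base point. -/
theorem eventually_norm_sub_le_of_isCompactOperator {X Y Z H : Type*} [NormedAddCommGroup X]
    [NormedSpace ℝ X] [NormedAddCommGroup Y] [NormedSpace ℝ Y] [NormedAddCommGroup H]
    [NormedSpace ℝ H] [TopologicalSpace Z] {L : X →ₗ[ℝ] Y} (hL : IsCompactOperator L)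
    {D : Z → Y → H} {z₀ : Z} (hD : ∀ k, ContinuousAt (fun p : Z × Y => D p.1 p.2) (z₀, k))
    (hs : ∀ᶠ z in 𝓝 z₀, ∀ (c : ℝ) k, D z (c • k) = c • D z k) {η : ℝ} (hη : 0 < η) :
    ∀ᶠ z in 𝓝 z₀, ∀ h, ‖D z (L h) - D z₀ (L h)‖ ≤ η * ‖h‖ := by
  obtain ⟨K, hK, hK'⟩ := hL
  obtain ⟨ε, hε, hb⟩ := Metric.mem_nhds_iff.1 hK'
  have h1 : ∀ᶠ z in 𝓝 z₀, ∀ k ∈ K, ‖D z k - D z₀ k‖ < η * (ε / 2) := by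
    refine hK.eventually_forall_of_forall_eventually fun k _ => ?_
    have hc : ContinuousAt (fun p : Z × Y => ‖D p.1 p.2 - D z₀ p.2‖) (z₀, k) := by
      have h2 : ContinuousAt (fun p : Z × Y => D z₀ p.2) (z₀, k) :=
        ContinuousAt.comp' (f := fun p : Z × Y => (z₀, p.2)) (x := (z₀, k)) (hD k) (by fun_prop)
      exact ((hD k).sub h2).norm
    refine hc.eventually_lt continuousAt_const ?_
    simp only [sub_self, norm_zero]
    positivity
  filter_upwards [h1, hs] with z hz hsz h
  rcases eq_or_ne h 0 with rfl | hh
  · have e1 : D z 0 = 0 := by simpa using hsz 0 0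
    have e2 : D z₀ 0 = 0 := by simpa using hs.self_of_nhds 0 0
    simp [e1, e2]
  have hn : 0 < ‖h‖ := norm_pos_iff.2 hh
  -- The factor c scales h to norm ε/2, inside the ball that `L` maps into K; homogeneity of `D`
  -- then scales the estimate back.
  set c : ℝ := ε / 2 / ‖h‖ with hc
  have hcp : 0 < c := by positivity
  have hm : L (c • h) ∈ K := hb (by
    rw [mem_ball_zero_iff, norm_smul, Real.norm_of_nonneg hcp.le, hc, div_mul_cancel₀ _ hn.ne']
    linarith)
  have h3 := (hz _ hm).le
  rw [map_smul, hsz, hs.self_of_nhds, ← smul_sub, norm_smul, Real.norm_of_nonneg hcp.le] at h3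
  have h4 : η * (ε / 2) = c * (η * ‖h‖) := by rw [hc]; field_simp
  rw [h4] at h3
  exact le_of_mul_le_mul_left h3 hcp

theorem nhdsWithin_translate_eq (hE : E.IsScBanach) (hU : IsOpen U) {x : E.X 1} (hx : E.ι 0 x ∈ U) :
    𝓝[{h : E.X 1 | E.ι 0 (x + h) ∈ U}] (0 : E.X 1) = 𝓝 0 := by
  refine IsOpen.nhdsWithin_eq (hU.preimage ((hE.continuous_ι 0).comp (by fun_prop))) ?_
  simpa using hx

/-- The remainder estimates only see directions from E_1, where A - B is a Fréchet derivative of the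
zero map. Density of E_1 in E_0 extends A = B to all directions. -/
theorem HasScDerivAt.unique (hE : E.IsScBanach) (hU : IsOpen U) {x : E.X 1} (hx : E.ι 0 x ∈ U)
    {A B : E.X 0 →L[ℝ] F.X 0} (hA : HasScDerivAt E F U f x A) (hB : HasScDerivAt E F U f x B) :
    A = B := by
  unfold HasScDerivAt at hA hB
  rw [nhdsWithin_translate_eq hE hU hx] at hA hB
  have h := hB.sub hA
  simp only [sub_sub_sub_cancel_left] at h
  let ι' : E.X 1 →L[ℝ] E.X 0 := ⟨E.ι 0, hE.continuous_ι 0⟩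
  have hf : HasFDerivAt (fun h : E.X 1 => (A - B) (E.ι 0 h)) (0 : E.X 1 →L[ℝ] F.X 0) 0 := by
    rw [hasFDerivAt_iff_isLittleO]
    simpa using h
  have h' : HasFDerivAt (fun h : E.X 1 => (A - B) (E.ι 0 h)) ((A - B).comp ι') 0 :=
    ((A - B).comp ι').hasFDerivAt
  have h0 := h'.unique hf
  have : (A : E.X 0 → F.X 0) = B := by
    refine (hE.denseRange_ι 0).equalizer A.continuous B.continuous (funext fun y => ?_)
    have := congrArg (fun T => T y) h0
    simpa [ι', sub_eq_zero] using this
  exact DFunLike.coe_injective this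

theorem HasScDerivAt.scDeriv_eq (hE : E.IsScBanach) (hU : IsOpen U) {x : E.X 1} (hx : E.ι 0 x ∈ U)
    {A : E.X 0 →L[ℝ] F.X 0} (hA : HasScDerivAt E F U f x A) : scDeriv E F U f x = A := by
  have h : ∃ A, HasScDerivAt E F U f x A := ⟨A, hA⟩
  rw [scDeriv, dif_pos h]
  exact h.choose_spec.unique hE hU hx hA

theorem HasScDerivAt.congr {x : E.X 1} {A : E.X 0 →L[ℝ] F.X 0} (hx : E.ι 0 x ∈ U)
    (hA : HasScDerivAt E F U f x A) (h : EqOn (f' 0) (f 0) U) : HasScDerivAt E F U f' x A := by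
  refine IsLittleO.congr' hA ?_ EventuallyEq.rfl
  filter_upwards [self_mem_nhdsWithin] with y hy
  rw [h hy, h hx]

theorem IsTangentMap.congr {g : ScFun E.tangent F.tangent} (hf : IsTangentMap E F U f g)
    (h : ∀ m, EqOn (f' m) (f m) (levelSet E U m)) : IsTangentMap E F U f' g := by
  refine ⟨hf.1.congr h, fun x hx => ?_, hf.2.2⟩
  obtain ⟨A, hA, hA'⟩ := hf.2.1 x hx
  exact ⟨A, hA.congr hx (h 0), fun k => by rw [hA', h 1 (mem_levelSet_one.2 hx)]⟩

theorem IsTangentMap.mono {g : ScFun E.tangent F.tangent} {U' : Set (E.X 0)}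
    (hf : IsTangentMap E F U f g) (h : U' ⊆ U) : IsTangentMap E F U' f g := by
  refine ⟨hf.1.mono h, fun x hx => ?_, hf.2.2.mono fun y hy => h hy⟩
  obtain ⟨A, hA, hA'⟩ := hf.2.1 x (h hx)
  exact ⟨A, hA.mono (nhdsWithin_mono _ fun y hy => h hy), hA'⟩

/-- The derivative determines a tangent map only on level 0. The higher levels follow because they
are compatible with the inclusions, which are injective. -/
theorem IsTangentMap.eqOn (hE : E.IsScBanach) (hF : F.IsScBanach) (hU : IsOpen U)
    {g g' : ScFun E.tangent F.tangent} (h : IsTangentMap E F U f g) (h' : IsTangentMap E F U f g')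
    (m : ℕ) : EqOn (g m) (g' m) (levelSet E.tangent (tangentSet E U) m) := fun y hy => by
  apply hF.tangent.injective_incl m
  rw [h.2.2.incl_apply m hy, h'.2.2.incl_apply m hy]
  have hy' : E.ι 0 (E.tangent.incl m y).1 ∈ U := hy
  obtain ⟨A, hA, hA'⟩ := h.2.1 _ hy'
  obtain ⟨B, hB, hB'⟩ := h'.2.1 _ hy'
  obtain rfl := hA.unique hE hU hy' hB
  exact (hA' _).trans (hB' _).symm

theorem IsTangentMap.hasScDerivAt {g : ScFun E.tangent F.tangent} (h : IsTangentMap E F U f g)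
    {x : E.X 1} (hx : E.ι 0 x ∈ U) :
    ∃ A : E.X 0 →L[ℝ] F.X 0, HasScDerivAt E F U f x A ∧ ∀ k, (g 0 (x, k)).2 = A k := by
  obtain ⟨A, hA, hA'⟩ := h.2.1 x hx
  exact ⟨A, hA, fun k => by rw [hA']⟩

theorem IsTangentMap.fst_apply (hF : F.IsScBanach) {g : ScFun E.tangent F.tangent}
    (h : IsTangentMap E F U f g) (m : ℕ) {y : E.tangent.X m}
    (hy : y.1 ∈ levelSet E U (m + 1)) : (g m y).1 = f (m + 1) y.1 := by
  apply hF.shift.injective_incl m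
  have h1 := h.2.2.incl_apply m (mem_levelSet_tangent.2 hy)
  have h2 := h.1.shift.incl_apply (x := y.1) m (by rwa [levelSet_shift])
  have h3 : E.ι 0 (E.shift.incl m y.1) ∈ U := by rw [E.shift_incl]; exact hy
  obtain ⟨A, _, hA⟩ := h.2.1 _ h3
  refine Eq.trans ?_ h2.symm
  have h4 := congrArg Prod.fst h1
  rw [ScScale.prod_incl] at h4
  refine h4.trans ?_
  have h5 := congrArg Prod.fst (hA (E.incl m y.2))
  rw [ScScale.prod_incl]
  exact h5

theorem IsTangentMap.continuousAt (hE : E.IsScBanach) (hU : IsOpen U)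
    {g : ScFun E.tangent F.tangent} (h : IsTangentMap E F U f g) (m : ℕ) {x : E.X (m + 1)}
    (hx : x ∈ levelSet E U (m + 1)) (k : E.X m) :
    ContinuousAt (fun p : E.X (m + 1) × E.X m => (g m p).2) (x, k) := by
  have h1 := (h.2.2.1 m).continuousAt (x := ((x, k) : E.tangent.X m))
    ((isOpen_levelSet hE.tangent (isOpen_tangentSet hE hU) m).mem_nhds (mem_levelSet_tangent.2 hx))
  exact continuous_snd.continuousAt.comp' h1

/-- Along a line whose direction lies in E_1 the sc-derivative is an ordinary derivative with values
in F_0, so one-variable calculus applies. -/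
theorem HasScDerivAt.hasDerivAt_line (hE : E.IsScBanach) (hU : IsOpen U) {x v : E.X 1} {s : ℝ}
    {A : E.X 0 →L[ℝ] F.X 0} (hs : E.ι 0 (x + s • v) ∈ U)
    (hA : HasScDerivAt E F U f (x + s • v) A) :
    HasDerivAt (fun s : ℝ => f 0 (E.ι 0 (x + s • v))) (A (E.ι 0 v)) s := by
  unfold HasScDerivAt at hA
  rw [nhdsWithin_translate_eq hE hU hs] at hA
  rw [hasDerivAt_iff_isLittleO_nhds_zero]
  have ht : Tendsto (fun t : ℝ => t • v) (𝓝 0) (𝓝 0) := by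
    have : Continuous fun t : ℝ => t • v := by fun_prop
    simpa using this.tendsto 0
  have h1 := hA.comp_tendsto ht
  have h2 : (fun t : ℝ => t • v) =O[𝓝 0] (fun t : ℝ => t) :=
    IsBigO.of_bound ‖v‖ (Eventually.of_forall fun t => by rw [norm_smul, mul_comm])
  refine (h1.trans_isBigO h2).congr_left fun t => ?_
  simp only [Function.comp_apply, add_smul, map_smul, map_add, add_assoc]

theorem IsTangentMap.hasDerivAt_line (hE : E.IsScBanach) (hU : IsOpen U)
    {g : ScFun E.tangent F.tangent} (h : IsTangentMap E F U f g) {x v : E.X 1} {s : ℝ}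
    (hs : E.ι 0 (x + s • v) ∈ U) :
    HasDerivAt (fun s : ℝ => f 0 (E.ι 0 (x + s • v))) (g 0 (x + s • v, E.ι 0 v)).2 s := by
  obtain ⟨A, hA, hA'⟩ := h.hasScDerivAt hs
  rw [hA']
  exact hA.hasDerivAt_line hE hU hs

theorem IsTangentMap.norm_sub_sub_le (hE : E.IsScBanach) (hU : IsOpen U)
    {g : ScFun E.tangent F.tangent} (h : IsTangentMap E F U f g) {x y : E.X 1} {w : F.X 0} {C : ℝ}
    (hs : ∀ s ∈ Icc (0 : ℝ) 1, E.ι 0 (x + s • (y - x)) ∈ U ∧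
      ‖(g 0 (x + s • (y - x), E.ι 0 (y - x))).2 - w‖ ≤ C) :
    ‖f 0 (E.ι 0 y) - f 0 (E.ι 0 x) - w‖ ≤ C := by
  have := norm_image_sub_le_of_norm_deriv_le_segment_01'
    (f := fun s : ℝ => f 0 (E.ι 0 (x + s • (y - x))) - s • w)
    (f' := fun s => (g 0 (x + s • (y - x), E.ι 0 (y - x))).2 - w) (C := C)
    (fun s hs' => by
      have h1 := (h.hasDerivAt_line hE hU (hs s hs').1).hasDerivWithinAt (s := Icc 0 1)
      have h2 := ((hasDerivAt_id s).smul_const w).hasDerivWithinAt (s := Icc 0 1)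
      rw [one_smul] at h2
      exact h1.sub h2)
    (fun s hs' => (hs s ⟨hs'.1, hs'.2.le⟩).2)
  simpa [sub_right_comm] using this

/-- The map z ↦ Df(z) need not be continuous in operator norm, but joint continuity at (x, 0) bounds
Df(z)k for small k, and homogeneity then bounds the operator norms locally. -/
theorem IsTangentMap.exists_norm_le (hE : E.IsScBanach) (hU : IsOpen U)
    {g : ScFun E.tangent F.tangent} (h : IsTangentMap E F U f g) {x : E.X 1} (hx : E.ι 0 x ∈ U) :
    ∃ C > 0, ∀ᶠ z in 𝓝 x, ∀ k, ‖(g 0 (z, k)).2‖ ≤ C * ‖k‖ := by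
  obtain ⟨A, _, hA⟩ := h.hasScDerivAt hx
  have hc := (h.continuousAt hE hU 0 (mem_levelSet_one.2 hx) 0).norm
  have h1 : ∀ᶠ p : E.X 1 × E.X 0 in 𝓝 (x, 0), ‖(g 0 p).2‖ < 1 :=
    hc.eventually_lt continuousAt_const (by rw [hA, map_zero, norm_zero]; exact one_pos)
  rw [nhds_prod_eq] at h1
  obtain ⟨p, hp, q, hq, hpq⟩ := eventually_prod_iff.1 h1
  obtain ⟨ε, hε, hb⟩ := Metric.eventually_nhds_iff.1 hq
  have hU' : ∀ᶠ z in 𝓝 x, E.ι 0 z ∈ U := (hU.preimage (hE.continuous_ι 0)).mem_nhds hx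
  refine ⟨2 / ε, by positivity, ?_⟩
  filter_upwards [hp, hU'] with z hz hzU k
  obtain ⟨B, _, hB⟩ := h.hasScDerivAt hzU
  rw [hB]
  rcases eq_or_ne k 0 with rfl | hk
  · simp
  have hn : 0 < ‖k‖ := norm_pos_iff.2 hk
  have h3 := hpq hz (hb (y := (ε / 2 / ‖k‖) • k) (by
    rw [dist_zero_right, norm_smul, Real.norm_of_nonneg (by positivity), div_mul_cancel₀ _ hn.ne']
    linarith))
  rw [hB, map_smul, norm_smul, Real.norm_of_nonneg (by positivity), div_mul_eq_mul_div,
    div_lt_one hn] at h3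
  rw [div_mul_eq_mul_div, le_div_iff₀ hε]
  linarith

end ScDeriv

/-! ### The chain rule and the shift of a map -/

section ChainRule

variable {E F G : ScScale} {U : Set (E.X 0)} {V : Set (F.X 0)} {f : ScFun E F} {g : ScFun F G}
  {f' : ScFun E.tangent F.tangent} {g' : ScFun F.tangent G.tangent}

theorem IsTangentMap.mapsTo (hf : IsTangentMap E F U f f') (hm : MapsTo (f 0) U V) :
    MapsTo (f' 0) (tangentSet E U) (tangentSet F V) := by
  rintro ⟨x, k⟩ hx
  have hx' : E.ι 0 x ∈ U := hx
  obtain ⟨A, _, hA⟩ := hf.2.1 x hx'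
  rw [hA]
  change F.ι 0 (f 1 x) ∈ V
  rw [hf.1.2 0 x hx']
  exact hm hx'

theorem IsTangentMap.eventually_homogeneous (hE : E.IsScBanach) (hU : IsOpen U)
    (hf : IsTangentMap E F U f f') {x : E.X 1} (hx : E.ι 0 x ∈ U) :
    ∀ᶠ z in 𝓝 x, ∀ (c : ℝ) (k : E.X 0), (f' 0 (z, c • k)).2 = c • (f' 0 (z, k)).2 := by
  have hU' : ∀ᶠ z in 𝓝 x, E.ι 0 z ∈ U := (hU.preimage (hE.continuous_ι 0)).mem_nhds hx
  filter_upwards [hU'] with z hz c k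
  obtain ⟨A, _, hA⟩ := hf.hasScDerivAt hz
  rw [hA, hA, map_smul]

/-- Since f is continuous into F_1, the segment from f(x) to f(x + h) stays in F_1 and the mean
value inequality for g applies on it. Its increment is Ah + r with r = o(‖h‖_1) in F_0. On Ah the
derivative of g varies by at most a small multiple of ‖h‖_1, because h ↦ Ah is compact on E_1; on r
the local operator bound of `exists_norm_le` suffices. -/
theorem IsTangentMap.comp (hE : E.IsScBanach) (hF : F.IsScBanach) (hU : IsOpen U) (hV : IsOpen V)
    (hg : IsTangentMap F G V g g') (hf : IsTangentMap E F U f f') (hm : MapsTo (f 0) U V) :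
    IsTangentMap E G U (fun m x => g m (f m x)) (fun m y => g' m (f' m y)) := by
  refine ⟨hg.1.comp hf.1 hm, fun x hx => ?_, hg.2.2.comp hf.2.2 (hf.mapsTo hm)⟩
  obtain ⟨A, hA, hA'⟩ := hf.2.1 x hx
  have hy : F.ι 0 (f 1 x) ∈ V := by rw [hf.1.2 0 x hx]; exact hm hx
  obtain ⟨B, hB, hB'⟩ := hg.2.1 (f 1 x) hy
  refine ⟨B.comp A, ?_, fun h => by
    change g' 0 (f' 0 (x, h)) = _
    rw [hA', hB']
    rfl⟩
  set y₀ := f 1 x with hy₀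
  have hyx : f 0 (E.ι 0 x) = F.ι 0 y₀ := (hf.1.2 0 x hx).symm
  have hcA : IsCompactOperator ((A : E.X 0 →ₗ[ℝ] F.X 0).comp (E.ι 0)) := (hE.compact 0).clm_comp A
  obtain ⟨C, hC, hCb⟩ := hg.exists_norm_le hF hV hy
  have hVn : ∀ᶠ z in 𝓝 y₀, F.ι 0 z ∈ V := (hV.preimage (hF.continuous_ι 0)).mem_nhds hy
  have hBk : ∀ k, (g' 0 (y₀, k)).2 = B k := fun k => by rw [hB']
  unfold HasScDerivAt at hA ⊢
  rw [nhdsWithin_translate_eq hE hU hx] at hA ⊢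
  rw [isLittleO_iff] at hA ⊢
  intro η hη
  have hη1 : 0 < η / 2 := by positivity
  have hη2 : 0 < η / 2 / (2 * C) := by positivity
  have htube := eventually_norm_sub_le_of_isCompactOperator hcA
    (D := fun z k => (g' 0 (z, k)).2) (z₀ := y₀)
    (fun k => hg.continuousAt hF hV 0 (mem_levelSet_one.2 hy) k)
    (hg.eventually_homogeneous hF hV hy) hη1
  obtain ⟨δ, hδ, hball⟩ := Metric.eventually_nhds_iff_ball.1 (htube.and (hCb.and hVn))
  have hcont : ∀ᶠ h in 𝓝 (0 : E.X 1), f 1 (x + h) ∈ Metric.ball y₀ δ := by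
    have h1 : ContinuousAt (f 1) x :=
      (hf.1.1 1).continuousAt ((isOpen_levelSet hE hU 1).mem_nhds (mem_levelSet_one.2 hx))
    have h2 : ContinuousAt (fun h : E.X 1 => f 1 (x + h)) 0 :=
      ContinuousAt.comp' (f := fun h : E.X 1 => x + h) (x := 0) (by simpa using h1) (by fun_prop)
    have := h2.tendsto
    rw [add_zero] at this
    exact this (Metric.ball_mem_nhds _ hδ)
  have hUn : ∀ᶠ h in 𝓝 (0 : E.X 1), E.ι 0 (x + h) ∈ U := by
    have h1 : Continuous fun h : E.X 1 => E.ι 0 (x + h) :=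
      (hE.continuous_ι 0).comp (by fun_prop)
    exact (hU.preimage h1).mem_nhds (by simpa using hx)
  filter_upwards [hA hη2, hcont, hUn] with h h1 h2 h3
  have hy1 : f 0 (E.ι 0 (x + h)) = F.ι 0 (f 1 (x + h)) := (hf.1.2 0 _ h3).symm
  rw [hy1, hyx] at h1 ⊢
  refine hg.norm_sub_sub_le hF hV fun s hs => ?_
  have hmem : y₀ + s • (f 1 (x + h) - y₀) ∈ Metric.ball y₀ δ :=
    (convex_ball y₀ δ).add_smul_sub_mem (Metric.mem_ball_self hδ) h2 hs
  obtain ⟨t1, t2, t3⟩ := hball _ hmem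
  refine ⟨t3, ?_⟩
  set z := y₀ + s • (f 1 (x + h) - y₀)
  obtain ⟨D, _, hD⟩ := hg.hasScDerivAt t3
  have t1' := t1 h
  simp only [LinearMap.comp_apply, ContinuousLinearMap.coe_coe, hD, hBk] at t1'
  obtain ⟨-, u2, -⟩ := hball _ (Metric.mem_ball_self hδ)
  set r := F.ι 0 (f 1 (x + h)) - F.ι 0 y₀ - A (E.ι 0 h) with hr
  have e : F.ι 0 (f 1 (x + h) - y₀) = A (E.ι 0 h) + r := by rw [map_sub, hr]; abel
  have t2' := t2 r
  have u2' := u2 r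
  rw [hD] at t2'
  rw [hBk] at u2'
  rw [hD, e, map_add, ContinuousLinearMap.comp_apply]
  calc ‖D (A (E.ι 0 h)) + D r - B (A (E.ι 0 h))‖
      ≤ ‖D (A (E.ι 0 h)) - B (A (E.ι 0 h))‖ + ‖D r‖ := by
        rw [add_sub_right_comm]; exact norm_add_le _ _
    _ ≤ η / 2 * ‖h‖ + C * (η / 2 / (2 * C) * ‖h‖) := by
        gcongr
        exact t2'.trans (by gcongr)
    _ ≤ η * ‖h‖ := by
        have : C * (η / 2 / (2 * C) * ‖h‖) = η / 4 * ‖h‖ := by field_simp; ring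
        rw [this]
        nlinarith [norm_nonneg h]

/-- Linearity on level m is inherited from level 0 through the injective inclusion; boundedness is
continuity of the tangent map on level m. -/
theorem IsTangentMap.snd_linear (hE : E.IsScBanach) (hF : F.IsScBanach) (hU : IsOpen U)
    (hf : IsTangentMap E F U f f') (m : ℕ) {x : E.X (m + 1)} (hx : x ∈ levelSet E U (m + 1)) :
    ∃ A : E.X m →L[ℝ] F.X m, ∀ k, (f' m (x, k)).2 = A k := by
  have hx' : E.ι 0 (E.shift.incl m x) ∈ U := by rw [E.shift_incl]; exact hx
  obtain ⟨A, _, hA⟩ := hf.hasScDerivAt hx'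
  have key : ∀ k, F.incl m (f' m (x, k)).2 = A (E.incl m k) := fun k => by
    have h1 := hf.2.2.incl_apply (x := ((x, k) : E.tangent.X m)) m (mem_levelSet_tangent.2 hx)
    have h2 := congrArg Prod.snd h1
    rw [ScScale.prod_incl, ScScale.prod_incl] at h2
    exact h2.trans (hA _)
  have hc : Continuous fun k : E.X m => (f' m (x, k)).2 :=
    continuous_iff_continuousAt.2 fun k =>
      ContinuousAt.comp' (f := fun k : E.X m => (x, k)) (x := k)
        (hf.continuousAt hE hU m hx k) (by fun_prop)
  refine ⟨⟨⟨⟨fun k => (f' m (x, k)).2, fun a b => ?_⟩, fun c a => ?_⟩, hc⟩, fun k => rfl⟩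
  · apply hF.injective_incl m
    simp only [map_add, key]
  · apply hF.injective_incl m
    simp only [map_smul, key, RingHom.id_apply]

/-- The fundamental theorem of calculus on the level one. -/
theorem IsTangentMap.integral_eq (hE : E.IsScBanach) (hF : F.IsScBanach) (hU : IsOpen U)
    (hf : IsTangentMap E F U f f') {x h : E.X 2}
    (hs : ∀ s ∈ Icc (0 : ℝ) 1, x + s • h ∈ levelSet E U 2) :
    ∫ s in (0 : ℝ)..1, (f' 1 (x + s • h, E.ι 1 h)).2 = f 1 (E.ι 1 (x + h)) - f 1 (E.ι 1 x) := by
  have := hF.complete 0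
  have := hF.complete 1
  have hc : ContinuousOn (fun s : ℝ => (f' 1 (x + s • h, E.ι 1 h)).2) (uIcc 0 1) := by
    rw [uIcc_of_le zero_le_one]
    intro s hs'
    refine ContinuousAt.continuousWithinAt ?_
    exact ContinuousAt.comp' (f := fun s : ℝ => (x + s • h, E.ι 1 h)) (x := s)
      (hf.continuousAt hE hU 1 (hs s hs') _) (by fun_prop)
  -- The derivative along the segment is known only in F_0, whereas the integral is taken in F_1;
  -- the two sides are therefore compared after the injection into F_0.
  apply hF.injective 0
  let ι' : F.X 1 →L[ℝ] F.X 0 := ⟨F.ι 0, hF.continuous_ι 0⟩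
  change ι' _ = ι' _
  rw [← ι'.intervalIntegral_comp_comm hc.intervalIntegrable]
  have h0 := hs 0 (by simp)
  have h1 := hs 1 (by simp)
  rw [zero_smul, add_zero] at h0
  rw [one_smul] at h1
  have e : ι' (f 1 (E.ι 1 (x + h)) - f 1 (E.ι 1 x)) =
      f 0 (E.ι 0 (E.ι 1 x + (1 : ℝ) • E.ι 1 h)) - f 0 (E.ι 0 (E.ι 1 x + (0 : ℝ) • E.ι 1 h)) := by
    change F.ι 0 _ = _
    rw [map_sub, hf.1.2 0 _ (mem_levelSet_succ.1 h1), hf.1.2 0 _ (mem_levelSet_succ.1 h0)]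
    simp
  rw [e]
  refine intervalIntegral.integral_eq_sub_of_hasDerivAt
    (f := fun s : ℝ => f 0 (E.ι 0 (E.ι 1 x + s • E.ι 1 h))) (fun s hs' => ?_)
    (ι'.continuous.comp_continuousOn hc).intervalIntegrable
  rw [uIcc_of_le zero_le_one] at hs'
  have hsU := hs s hs'
  have hsU' : E.ι 0 (E.ι 1 x + s • E.ι 1 h) ∈ U := by
    rw [← map_smul, ← map_add]; exact hsU
  have h2 := hf.hasDerivAt_line hE hU hsU'
  have h3 := congrArg Prod.snd (hf.2.2.2 0 (x + s • h, E.ι 1 h) (mem_levelSet_tangent.2 hsU))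
  have h4 : ι' (f' 1 (x + s • h, E.ι 1 h)).2 = (f' 0 (E.ι 1 (x + s • h), E.ι 0 (E.ι 1 h))).2 := h3
  rw [h4, map_add, map_smul]
  exact h2

/-- On level one, f(x + h) - f(x) is the integral of Df(x + sh)h over [0, 1]. Compactness of E_2 →
E_1 makes the integrand differ from Df(x)h by at most η‖h‖_2 for small h, which is the required
remainder estimate. -/
theorem IsTangentMap.shift (hE : E.IsScBanach) (hF : F.IsScBanach) (hU : IsOpen U)
    (hf : IsTangentMap E F U f f') :
    IsTangentMap E.shift F.shift (levelSet E U 1) (fun m => f (m + 1)) (fun m => f' (m + 1)) := by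
  refine ⟨hf.1.shift, fun x hx => ?_, hf.2.2.shift⟩
  have hx2 : x ∈ levelSet E U 2 := hx
  obtain ⟨A, hA⟩ := hf.snd_linear hE hF hU 1 hx2
  refine ⟨A, ?_, fun h => Prod.ext (hf.fst_apply hF 1 hx2) (hA h)⟩
  unfold HasScDerivAt
  rw [nhdsWithin_translate_eq hE.shift (isOpen_levelSet hE hU 1) hx, isLittleO_iff]
  intro η hη
  have hop : ∀ᶠ z in 𝓝 x, z ∈ levelSet E U 2 := (isOpen_levelSet hE hU 2).mem_nhds hx2
  have htube := eventually_norm_sub_le_of_isCompactOperator (hE.compact 1)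
    (D := fun z k => (f' 1 (z, k)).2) (z₀ := x) (fun k => hf.continuousAt hE hU 1 hx2 k)
    (hop.mono fun z hz c k => by
      obtain ⟨B, hB⟩ := hf.snd_linear hE hF hU 1 hz
      simp only [hB, map_smul]) hη
  obtain ⟨δ, hδ, hball⟩ := Metric.eventually_nhds_iff_ball.1 (htube.and hop)
  filter_upwards [Metric.ball_mem_nhds (0 : E.X 2) hδ] with h hh
  have hmem : ∀ s ∈ Icc (0 : ℝ) 1, x + s • h ∈ Metric.ball x δ := fun s hs => by
    have h2 : x + h ∈ Metric.ball x δ := by simpa [mem_ball_iff_norm] using hh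
    simpa using (convex_ball x δ).add_smul_sub_mem (Metric.mem_ball_self hδ) h2 hs
  have hint := hf.integral_eq hE hF hU (x := x) (h := h) fun s hs => (hball _ (hmem s hs)).2
  have := hF.complete 1
  have hcst : ∫ _ in (0 : ℝ)..1, A (E.ι 1 h) = A (E.ι 1 h) := by
    rw [intervalIntegral.integral_const, sub_zero, one_smul]
  change ‖f 1 (E.ι 1 (x + h)) - f 1 (E.ι 1 x) - A (E.ι 1 h)‖ ≤ η * ‖h‖
  have hc : ContinuousOn (fun s : ℝ => (f' 1 (x + s • h, E.ι 1 h)).2) (uIcc 0 1) := by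
    rw [uIcc_of_le zero_le_one]
    intro s hs'
    refine ContinuousAt.continuousWithinAt ?_
    exact ContinuousAt.comp' (f := fun s : ℝ => (x + s • h, E.ι 1 h)) (x := s)
      (hf.continuousAt hE hU 1 (hball _ (hmem s hs')).2 _) (by fun_prop)
  rw [← hint, ← hcst, ← intervalIntegral.integral_sub hc.intervalIntegrable (by simp)]
  have := intervalIntegral.norm_integral_le_of_norm_le_const (a := (0 : ℝ)) (b := 1)
    (f := fun s : ℝ => (f' 1 (x + s • h, E.ι 1 h)).2 - A (E.ι 1 h)) (C := η * ‖h‖)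
    (fun s hs => by
      rw [uIoc_of_le zero_le_one] at hs
      have := (hball _ (hmem s ⟨hs.1.le, hs.2⟩)).1 h
      simpa only [hA] using this)
  simpa using this

end ChainRule

/-! ### Maps of class sc^k -/

section IsSc

variable {E F G H : ScScale} {U : Set (E.X 0)} {V : Set (F.X 0)} {f f₂ : ScFun E F}
  {g : ScFun F G} {k : ℕ}

theorem IsSc.congr (hf : IsSc k E F U f) (h : ∀ m, EqOn (f₂ m) (f m) (levelSet E U m)) :
    IsSc k E F U f₂ := by
  cases k with
  | zero => exact IsSc0.congr hf h
  | succ k =>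
    obtain ⟨g, hg, hg'⟩ := hf
    exact ⟨g, hg.congr h, hg'⟩

theorem IsSc.isSc0 (hf : IsSc k E F U f) : IsSc0 E F U f := by
  cases k with
  | zero => exact hf
  | succ k => exact hf.choose_spec.1.1

theorem IsSc.mono : ∀ {k : ℕ} {E F : ScScale} {U U' : Set (E.X 0)} {f : ScFun E F},
    IsSc k E F U f → U' ⊆ U → IsSc k E F U' f
  | 0, _, _, _, _, _, hf, h => IsSc0.mono hf h
  | _ + 1, _, _, _, _, _, ⟨g, hg, hg'⟩, h =>
    ⟨g, hg.mono h, IsSc.mono hg' (fun _ hy => h hy)⟩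

theorem IsSc.comp : ∀ {k : ℕ} {E F G : ScScale} {U : Set (E.X 0)} {V : Set (F.X 0)}
    {f : ScFun E F} {g : ScFun F G}, E.IsScBanach → F.IsScBanach → IsOpen U → IsOpen V →
    IsSc k F G V g → IsSc k E F U f → MapsTo (f 0) U V → IsSc k E G U (fun m x => g m (f m x))
  | 0, _, _, _, _, _, _, _, _, _, _, _, hg, hf, hm => IsSc0.comp hg hf hm
  | _ + 1, _, _, _, _, _, _, _, hE, hF, hU, hV, ⟨g', hg, hg'⟩, ⟨f', hf, hf'⟩, hm =>
    ⟨fun m y => g' m (f' m y), hg.comp hE hF hU hV hf hm,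
      IsSc.comp hE.tangent hF.tangent (isOpen_tangentSet hE hU) (isOpen_tangentSet hF hV) hg' hf'
        (hf.mapsTo hm)⟩

theorem IsSc.shift : ∀ {k : ℕ} {E F : ScScale} {U : Set (E.X 0)} {f : ScFun E F},
    E.IsScBanach → F.IsScBanach → IsOpen U → IsSc k E F U f →
    IsSc k E.shift F.shift (levelSet E U 1) (fun m => f (m + 1))
  | 0, _, _, _, _, _, _, _, hf => IsSc0.shift hf
  | _ + 1, _, _, _, _, hE, hF, hU, ⟨f', hf, hf'⟩ =>
    ⟨fun m => f' (m + 1), hf.shift hE hF hU,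
      IsSc.shift hE.tangent hF.tangent (isOpen_tangentSet hE hU) hf'⟩

theorem isSc_linear : ∀ {k : ℕ} {E F : ScScale} (L : ∀ m, E.X m →L[ℝ] F.X m) (U : Set (E.X 0)),
    (∀ m x, F.ι m (L (m + 1) x) = L m (E.ι m x)) → IsSc k E F U (fun m x => L m x)
  | 0, _, _, L, _, h => ⟨fun m => (L m).continuous.continuousOn, fun m x _ => h m x⟩
  | k + 1, E, F, L, U, h => by
    let L' : ∀ m, E.tangent.X m →L[ℝ] F.tangent.X m := fun m => (L (m + 1)).prodMap (L m)
    have h' : ∀ m x, F.tangent.ι m (L' (m + 1) x) = L' m (E.tangent.ι m x) := fun m x =>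
      Prod.ext (h (m + 1) x.1) (h m x.2)
    refine ⟨fun m y => L' m y, ⟨?_, fun x hx => ⟨L 0, ?_, fun h => rfl⟩, ?_⟩, isSc_linear L' _ h'⟩
    · exact isSc_linear (k := 0) L U h
    · refine (isLittleO_zero _ _).congr_left fun h => ?_
      simp
    · exact isSc_linear (k := 0) L' _ h'

/-- The continuous linear version of the map between levels. -/
noncomputable def ScScale.IsScBanach.clmι (hE : E.IsScBanach) (m : ℕ) : E.X (m + 1) →L[ℝ] E.X m :=
  ⟨E.ι m, hE.continuous_ι m⟩

theorem isSc_ι (hE : E.IsScBanach) (U : Set (E.shift.X 0)) :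
    IsSc k E.shift E U (fun m x => E.ι m x) :=
  isSc_linear (E := E.shift) (F := E) (fun m => hE.clmι m) U fun _ _ => rfl

theorem isSc_fst (U : Set ((E.prod F).X 0)) : IsSc k (E.prod F) E U (fun _ x => x.1) :=
  isSc_linear (E := E.prod F) (fun m => ContinuousLinearMap.fst ℝ (E.X m) (F.X m)) U fun _ _ => rfl

theorem isSc_snd (U : Set ((E.prod F).X 0)) : IsSc k (E.prod F) F U (fun _ x => x.2) :=
  isSc_linear (E := E.prod F) (fun m => ContinuousLinearMap.snd ℝ (E.X m) (F.X m)) U fun _ _ => rfl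

theorem IsSc.clm_comp (hE : E.IsScBanach) (hF : F.IsScBanach) (hU : IsOpen U)
    (hf : IsSc k E F U f) (L : ∀ m, F.X m →L[ℝ] G.X m)
    (hL : ∀ m x, G.ι m (L (m + 1) x) = L m (F.ι m x)) : IsSc k E G U (fun m x => L m (f m x)) :=
  (isSc_linear L univ hL).comp hE hF hU isOpen_univ hf (mapsTo_univ _ _)

theorem IsSc.comp_clm (hE : E.IsScBanach) (hF : F.IsScBanach) (hV : IsOpen V)
    (hg : IsSc k F G V g) (L : ∀ m, E.X m →L[ℝ] F.X m)
    (hL : ∀ m x, F.ι m (L (m + 1) x) = L m (E.ι m x)) :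
    IsSc k E G (L 0 ⁻¹' V) (fun m x => g m (L m x)) :=
  hg.comp hE hF (hV.preimage (L 0).continuous) hV (isSc_linear L _ hL) (mapsTo_preimage _ _)

theorem IsSc.prodMk : ∀ {k : ℕ} {E F G : ScScale} {U : Set (E.X 0)} {f : ScFun E F}
    {g : ScFun E G}, E.IsScBanach → F.IsScBanach → G.IsScBanach → IsOpen U →
    IsSc k E F U f → IsSc k E G U g → IsSc k E (F.prod G) U (fun m x => (f m x, g m x))
  | 0, _, _, _, _, _, _, _, _, _, _, hf, hg => IsSc0.prodMk hf hg
  | k + 1, E, F, G, U, f, g, hE, hF, hG, hU, ⟨f', hf, hf'⟩, ⟨g', hg, hg'⟩ => by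
    -- The tangent of a product lists both base points before both directions, so the pair of
    -- tangent maps has to be reordered by a linear map.
    let T : ScFun E.tangent (F.prod G).tangent := fun m y =>
      (((f' m y).1, (g' m y).1), ((f' m y).2, (g' m y).2))
    have h1 := hf'.prodMk hE.tangent hF.tangent hG.tangent (isOpen_tangentSet hE hU) hg'
    have h2 : ∀ {j}, IsSc j E.tangent (F.tangent.prod G.tangent) (tangentSet E U)
        (fun m x => (f' m x, g' m x)) → IsSc j E.tangent (F.prod G).tangent (tangentSet E U) T :=
      fun h => h.clm_comp hE.tangent (hF.tangent.prod hG.tangent) (isOpen_tangentSet hE hU)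
        (G := (F.prod G).tangent)
        (fun m => ((((ContinuousLinearMap.fst ℝ (F.X (m + 1)) (F.X m)).comp
          (ContinuousLinearMap.fst ℝ (F.tangent.X m) (G.tangent.X m))).prod
          ((ContinuousLinearMap.fst ℝ (G.X (m + 1)) (G.X m)).comp
          (ContinuousLinearMap.snd ℝ (F.tangent.X m) (G.tangent.X m)))).prod
          (((ContinuousLinearMap.snd ℝ (F.X (m + 1)) (F.X m)).comp
          (ContinuousLinearMap.fst ℝ (F.tangent.X m) (G.tangent.X m))).prod
          ((ContinuousLinearMap.snd ℝ (G.X (m + 1)) (G.X m)).comp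
          (ContinuousLinearMap.snd ℝ (F.tangent.X m) (G.tangent.X m))))))
        (fun _ _ => rfl)
    refine ⟨T, ⟨hf.1.prodMk hg.1, fun x hx => ?_, (h2 h1).isSc0⟩, h2 h1⟩
    obtain ⟨A, hA, hA'⟩ := hf.2.1 x hx
    obtain ⟨B, hB, hB'⟩ := hg.2.1 x hx
    refine ⟨A.prod B, ?_, fun h => ?_⟩
    · exact IsLittleO.prod_left hA hB
    · change (((f' 0 (x, h)).1, (g' 0 (x, h)).1), ((f' 0 (x, h)).2, (g' 0 (x, h)).2)) = _
      rw [hA', hB']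
      rfl

theorem IsSc.fst {f : ScFun E (F.prod G)} (hE : E.IsScBanach) (hF : F.IsScBanach)
    (hG : G.IsScBanach) (hU : IsOpen U) (hf : IsSc k E (F.prod G) U f) :
    IsSc k E F U (fun m x => (f m x).1) :=
  (isSc_fst univ).comp hE (hF.prod hG) hU isOpen_univ hf (mapsTo_univ _ _)

theorem IsSc.snd {f : ScFun E (F.prod G)} (hE : E.IsScBanach) (hF : F.IsScBanach)
    (hG : G.IsScBanach) (hU : IsOpen U) (hf : IsSc k E (F.prod G) U f) :
    IsSc k E G U (fun m x => (f m x).2) :=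
  (isSc_snd univ).comp hE (hF.prod hG) hU isOpen_univ hf (mapsTo_univ _ _)

theorem IsSc.add {g : ScFun E F} (hE : E.IsScBanach) (hF : F.IsScBanach) (hU : IsOpen U)
    (hf : IsSc k E F U f) (hg : IsSc k E F U g) : IsSc k E F U (fun m x => f m x + g m x) :=
  (hf.prodMk hE hF hF hU hg).clm_comp hE (hF.prod hF) hU
    (fun m => ContinuousLinearMap.fst ℝ (F.X m) (F.X m) + ContinuousLinearMap.snd ℝ (F.X m) (F.X m))
    (fun m x => map_add (F.ι m) x.1 x.2)

theorem IsSc.sub {g : ScFun E F} (hE : E.IsScBanach) (hF : F.IsScBanach) (hU : IsOpen U)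
    (hf : IsSc k E F U f) (hg : IsSc k E F U g) : IsSc k E F U (fun m x => f m x - g m x) :=
  (hf.prodMk hE hF hF hU hg).clm_comp hE (hF.prod hF) hU
    (fun m => ContinuousLinearMap.fst ℝ (F.X m) (F.X m) - ContinuousLinearMap.snd ℝ (F.X m) (F.X m))
    (fun m x => map_sub (F.ι m) x.1 x.2)

theorem isSc_zero (U : Set (E.X 0)) : IsSc k E F U (fun _ _ => 0) :=
  isSc_linear (fun _ => 0) U fun m _ => map_zero (F.ι m)

theorem IsSc.sum {ι : Type*} (s : Finset ι) {f : ι → ScFun E F} (hE : E.IsScBanach)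
    (hF : F.IsScBanach) (hU : IsOpen U) (hf : ∀ i ∈ s, IsSc k E F U (f i)) :
    IsSc k E F U (fun m x => ∑ i ∈ s, f i m x) := by
  classical
  induction s using Finset.induction_on with
  | empty => simpa using isSc_zero U
  | insert a s ha ih =>
    simp only [Finset.sum_insert ha]
    exact (hf a (by simp)).add hE hF hU (ih fun i hi => hf i (by simp [hi]))

theorem IsSc.const_smul (c : ℝ) (hE : E.IsScBanach) (hF : F.IsScBanach) (hU : IsOpen U)
    (hf : IsSc k E F U f) : IsSc k E F U (fun m x => c • f m x) :=
  hf.clm_comp hE hF hU (fun m => c • ContinuousLinearMap.id ℝ (F.X m))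
    fun m x => map_smul (F.ι m) c x

/-- The tangent map in terms of the derivative. -/
theorem isTangentMap_of_hasScDerivAt (hE : E.IsScBanach) (hF : F.IsScBanach) (hU : IsOpen U)
    (hf : IsSc 0 E F U f) {D : ScFun E.tangent F} (hD : IsSc 0 E.tangent F (tangentSet E U) D)
    (h : ∀ x : E.X 1, E.ι 0 x ∈ U → ∃ A : E.X 0 →L[ℝ] F.X 0, HasScDerivAt E F U f x A ∧
      ∀ v : E.X 0, D 0 (x, v) = A v) :
    IsTangentMap E F U f (fun m y => (f (m + 1) y.1, D m y)) := by
  have h1 : IsSc 0 E.tangent F.shift (tangentSet E U) (fun m y => f (m + 1) y.1) :=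
    (hf.shift hE hF hU).comp hE.tangent hE.shift (isOpen_tangentSet hE hU)
      (isOpen_levelSet hE hU 1) (isSc_fst _) (fun _ hy => hy)
  refine ⟨hf, fun x hx => ?_, h1.prodMk hE.tangent hF.shift hF (isOpen_tangentSet hE hU) hD⟩
  obtain ⟨A, hA, hA'⟩ := h x hx
  exact ⟨A, hA, fun v => Prod.ext rfl (hA' v)⟩

/-- The class sc^{k+1} in terms of the derivative. -/
theorem isSc_succ_of_hasScDerivAt (hE : E.IsScBanach) (hF : F.IsScBanach) (hU : IsOpen U)
    (hf : IsSc k E F U f) {D : ScFun E.tangent F} (hD : IsSc k E.tangent F (tangentSet E U) D)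
    (h : ∀ x : E.X 1, E.ι 0 x ∈ U → ∃ A : E.X 0 →L[ℝ] F.X 0, HasScDerivAt E F U f x A ∧
      ∀ v : E.X 0, D 0 (x, v) = A v) : IsSc (k + 1) E F U f :=
  ⟨fun m y => (f (m + 1) y.1, D m y),
    isTangentMap_of_hasScDerivAt hE hF hU hf.isSc0 hD.isSc0 h,
    ((hf.shift hE hF hU).comp hE.tangent hE.shift (isOpen_tangentSet hE hU)
      (isOpen_levelSet hE hU 1) (isSc_fst _) (fun _ hy => hy)).prodMk hE.tangent hF.shift hF
      (isOpen_tangentSet hE hU) hD⟩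

end IsSc

/-! ### Classical derivatives and sc-derivatives -/

section Classical

variable {E F G H : ScScale} {U : Set (E.X 0)} {f : ScFun E F} {k : ℕ}

theorem HasScDerivAt.hasFDerivAt (hE : E.IsScBanach) (hU : IsOpen U) {x : E.X 1}
    (hx : E.ι 0 x ∈ U) {A : E.X 0 →L[ℝ] F.X 0} (hA : HasScDerivAt E F U f x A) :
    HasFDerivAt (fun y : E.X 1 => f 0 (E.ι 0 y)) (A.comp (hE.clmι 0)) x := by
  unfold HasScDerivAt at hA
  rw [nhdsWithin_translate_eq hE hU hx] at hA
  rw [hasFDerivAt_iff_isLittleO_nhds_zero]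
  exact hA

theorem HasScDerivAt.of_hasFDerivAt (hE : E.IsScBanach) {x : E.X 1} {A : E.X 0 →L[ℝ] F.X 0}
    (h : HasFDerivAt (fun y : E.X 1 => f 0 (E.ι 0 y)) (A.comp (hE.clmι 0)) x) :
    HasScDerivAt E F U f x A :=
  IsLittleO.mono ((hasFDerivAt_iff_isLittleO_nhds_zero (f := fun y : E.X 1 => f 0 (E.ι 0 y))).1 h)
    nhdsWithin_le_nhds

/-- The derivative B(u, dv) + B(du, v) is again built from the bilinear maps and linear ones, so
induction on the order applies. The base point has one level more than the direction, whence the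
inclusions in front of it. -/
theorem isSc_bilinear (hF : F.IsScBanach) (hG : G.IsScBanach) (hH : H.IsScBanach)
    (B : ∀ m, F.X m →L[ℝ] G.X m →L[ℝ] H.X m)
    (hB : ∀ m u v, H.ι m (B (m + 1) u v) = B m (F.ι m u) (G.ι m v)) :
    IsSc k (F.prod G) H univ (fun m x => B m x.1 x.2) := by
  have hFG := hF.prod hG
  induction k with
  | zero =>
    refine ⟨fun m => ?_, fun m x _ => hB m x.1 x.2⟩
    have : Continuous fun x : F.X m × G.X m => B m x.1 x.2 := by fun_prop
    exact this.continuousOn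
  | succ k ih =>
    refine isSc_succ_of_hasScDerivAt hFG hH isOpen_univ ih
      (D := fun m y => B m (F.ι m y.1.1) y.2.2 + B m y.2.1 (G.ι m y.1.2)) ?_ fun x _ => ?_
    · have h1 := ih.comp_clm (E := (F.prod G).tangent) hFG.tangent hFG isOpen_univ
        (fun m => ((hF.clmι m).comp ((ContinuousLinearMap.fst ℝ (F.X (m + 1)) (G.X (m + 1))).comp
            (ContinuousLinearMap.fst ℝ _ ((F.prod G).X m)))).prod
          ((ContinuousLinearMap.snd ℝ (F.X m) (G.X m)).comp
            (ContinuousLinearMap.snd ℝ ((F.prod G).X (m + 1)) _)))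
        (fun _ _ => rfl)
      have h2 := ih.comp_clm (E := (F.prod G).tangent) hFG.tangent hFG isOpen_univ
        (fun m => ((ContinuousLinearMap.fst ℝ (F.X m) (G.X m)).comp
            (ContinuousLinearMap.snd ℝ ((F.prod G).X (m + 1)) _)).prod
          ((hG.clmι m).comp ((ContinuousLinearMap.snd ℝ (F.X (m + 1)) (G.X (m + 1))).comp
            (ContinuousLinearMap.fst ℝ _ ((F.prod G).X m)))))
        (fun _ _ => rfl)
      exact h1.add hFG.tangent hH isOpen_univ h2
    · let b := B 0
      let A : F.X 0 × G.X 0 →L[ℝ] H.X 0 :=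
        (b (F.ι 0 x.1)).comp (ContinuousLinearMap.snd ℝ _ _) +
          (b.flip (G.ι 0 x.2)).comp (ContinuousLinearMap.fst ℝ _ _)
      refine ⟨A, HasScDerivAt.of_hasFDerivAt hFG ?_, fun v => rfl⟩
      have h := (b.isBoundedBilinearMap.hasFDerivAt (F.ι 0 x.1, G.ι 0 x.2)).comp x
        (hFG.clmι 0).hasFDerivAt
      refine h.congr_fderiv ?_
      ext v <;> simp [A]

theorem isSc_bilinear_comp {B : ∀ m, F.X m →L[ℝ] G.X m →L[ℝ] H.X m} (hE : E.IsScBanach)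
    (hF : F.IsScBanach) (hG : G.IsScBanach) (hH : H.IsScBanach) (hU : IsOpen U)
    (hB : ∀ m u v, H.ι m (B (m + 1) u v) = B m (F.ι m u) (G.ι m v)) {g : ScFun E G}
    (hf : IsSc k E F U f) (hg : IsSc k E G U g) : IsSc k E H U (fun m x => B m (f m x) (g m x)) :=
  (isSc_bilinear hF hG hH B hB).comp hE (hF.prod hG) hU isOpen_univ
    (hf.prodMk hE hF hG hU hg) (mapsTo_univ _ _)

theorem IsSc.smul {a : ScFun E (ScScale.const ℝ)} (hE : E.IsScBanach) (hF : F.IsScBanach)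
    (hU : IsOpen U) (ha : IsSc k E (ScScale.const ℝ) U a) (hf : IsSc k E F U f) :
    IsSc k E F U (fun m x => (a m x : ℝ) • f m x) :=
  isSc_bilinear_comp (B := fun _ => ContinuousLinearMap.lsmul ℝ ℝ) hE
    (ScScale.IsScBanach.const ℝ) hF hF hU (fun m u v => map_smul (F.ι m) u v) ha hf

/-! ### Smooth families of operators -/

/-- Differentiating a compatibility relation in the parameter shows that the derivative family is
again compatible with the inclusions. -/
theorem deriv_apply_eq_of_forall_apply_eq {X Y Z W : Type*} [NormedAddCommGroup X]
    [NormedSpace ℝ X] [NormedAddCommGroup Y] [NormedSpace ℝ Y] [NormedAddCommGroup Z]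
    [NormedSpace ℝ Z] [NormedAddCommGroup W] [NormedSpace ℝ W] {P : ℝ → X →L[ℝ] Y}
    {Q : ℝ → Z →L[ℝ] W} (L : Y →L[ℝ] W) {x : X} {z : Z} {t : ℝ} (hP : DifferentiableAt ℝ P t)
    (hQ : DifferentiableAt ℝ Q t) (h : ∀ t, L (P t x) = Q t z) :
    L (deriv P t x) = deriv Q t z := by
  have h1 := L.hasFDerivAt.comp_hasDerivAt t (hP.hasDerivAt.clm_apply (hasDerivAt_const t x))
  have h2 := hQ.hasDerivAt.clm_apply (hasDerivAt_const t z)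
  have h3 : (L ∘ fun s => P s x) = fun s => Q s z := funext fun s => h s
  rw [h3] at h1
  simpa using h1.unique h2

/-- Smoothness in operator norm after the loss of a level is inherited by the derivative family P'.
As D(P(t)x) consists of P(t)h and δt P'(t)x, the induction runs over all such families
simultaneously. -/
theorem isSc_smoothFamily (hH : H.IsScBanach) (hF : F.IsScBanach)
    (P : ∀ m, ℝ → H.X (m + 1) →L[ℝ] F.X m) (hP : ∀ m, ContDiff ℝ ∞ (P m))
    (hc : ∀ m t x, F.ι m (P (m + 1) t x) = P m t (H.ι (m + 1) x)) :
    IsSc k ((ScScale.const ℝ).prod H.shift) F univ (fun m x => P m x.1 x.2) := by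
  have hR := ScScale.IsScBanach.const ℝ
  have hE := hR.prod hH.shift
  induction k generalizing P with
  | zero =>
    refine ⟨fun m => ?_, fun m x _ => hc m x.1 x.2⟩
    have := (hP m).continuous
    have : Continuous fun x : ℝ × H.X (m + 1) => P m x.1 x.2 := by fun_prop
    exact this.continuousOn
  | succ k ih =>
    have hd : ∀ m, Differentiable ℝ (P m) := fun m => (hP m).differentiable (by simp)
    have ih' := ih (fun m => deriv (P m)) (fun m => (contDiff_infty_iff_deriv.1 (hP m)).2)
      fun m t x => deriv_apply_eq_of_forall_apply_eq (hF.clmι m) (hd (m + 1) t) (hd m t)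
        fun t => hc m t x
    refine isSc_succ_of_hasScDerivAt hE hF isOpen_univ (ih P hP hc)
      (D := fun m y => P m y.1.1 y.2.2 + (y.2.1 : ℝ) • deriv (P m) y.1.1 (H.ι (m + 1) y.1.2))
      ?_ fun x _ => ?_
    · have h1 := (ih P hP hc).comp_clm hE.tangent hE isOpen_univ
        (E := ((ScScale.const ℝ).prod H.shift).tangent)
        (fun m => ((ContinuousLinearMap.fst ℝ ℝ (H.X (m + 2))).comp
            (ContinuousLinearMap.fst ℝ _ (ℝ × H.X (m + 1)))).prod
          ((ContinuousLinearMap.snd ℝ ℝ (H.X (m + 1))).comp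
            (ContinuousLinearMap.snd ℝ (ℝ × H.X (m + 2)) _)))
        (fun _ _ => rfl)
      have h2 := ih'.comp_clm hE.tangent hE isOpen_univ
        (E := ((ScScale.const ℝ).prod H.shift).tangent)
        (fun m => ((ContinuousLinearMap.fst ℝ ℝ (H.X (m + 2))).comp
            (ContinuousLinearMap.fst ℝ _ (ℝ × H.X (m + 1)))).prod
          ((hH.clmι (m + 1)).comp ((ContinuousLinearMap.snd ℝ ℝ (H.X (m + 2))).comp
            (ContinuousLinearMap.fst ℝ _ (ℝ × H.X (m + 1))))))
        (fun _ _ => rfl)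
      have h3 : IsSc k ((ScScale.const ℝ).prod H.shift).tangent (ScScale.const ℝ) univ
          (fun _ y => y.2.1) :=
        isSc_linear (E := ((ScScale.const ℝ).prod H.shift).tangent) (F := ScScale.const ℝ)
          (fun m => (ContinuousLinearMap.fst ℝ ℝ (H.X (m + 1))).comp
            (ContinuousLinearMap.snd ℝ (ℝ × H.X (m + 2)) _)) univ (fun _ _ => rfl)
      exact h1.add hE.tangent hF isOpen_univ (h3.smul hE.tangent hF isOpen_univ h2)
    · let A : ℝ × H.X 1 →L[ℝ] F.X 0 := (P 0 x.1).comp (ContinuousLinearMap.snd ℝ _ _) +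
        (ContinuousLinearMap.fst ℝ ℝ (H.X 1)).smulRight (deriv (P 0) x.1 (H.ι 1 x.2))
      refine ⟨A, HasScDerivAt.of_hasFDerivAt hE ?_, fun v => rfl⟩
      have h1 : HasFDerivAt (fun y : ℝ × H.X 2 => P 0 y.1) _ x :=
        (hd 0 x.1).hasDerivAt.hasFDerivAt.comp x (ContinuousLinearMap.fst ℝ ℝ (H.X 2)).hasFDerivAt
      have h2 : HasFDerivAt (fun y : ℝ × H.X 2 => H.ι 1 y.2) _ x :=
        ((hH.clmι 1).comp (ContinuousLinearMap.snd ℝ ℝ (H.X 2))).hasFDerivAt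
      refine (h1.clm_apply h2).congr_fderiv ?_
      ext v
      · simp [A, ScScale.IsScBanach.clmι]
      · simp [A, ScScale.IsScBanach.clmι]

/-- The derivative of the map defined by a strongly continuous family of operators. -/
theorem isSc_and_isTangentMap_strongFamily (hH : H.IsScBanach) (hF : F.IsScBanach)
    (p : ∀ m, ℝ → H.X m →L[ℝ] F.X m) (hp : ∀ m, Continuous fun x : ℝ × H.X m => p m x.1 x.2)
    (hP : ∀ m, ContDiff ℝ ∞ fun t => (p m t).comp (hH.clmι m))
    (hc : ∀ m t x, F.ι m (p (m + 1) t x) = p m t (H.ι m x)) :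
    (∀ k, IsSc k ((ScScale.const ℝ).prod H) F univ (fun m x => p m x.1 x.2)) ∧
    IsTangentMap ((ScScale.const ℝ).prod H) F univ (fun m x => p m x.1 x.2)
      (fun m y => (p (m + 1) y.1.1 y.1.2,
        p m y.1.1 y.2.2 + (y.2.1 : ℝ) • deriv (fun t => (p m t).comp (hH.clmι m)) y.1.1 y.1.2)) := by
  have hR := ScScale.IsScBanach.const ℝ
  have hE := hR.prod hH
  set P : ∀ m, ℝ → H.X (m + 1) →L[ℝ] F.X m := fun m t => (p m t).comp (hH.clmι m) with hPdef
  have hd : ∀ m, Differentiable ℝ (P m) := fun m => (hP m).differentiable (by simp)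
  have hPc : ∀ m t x, F.ι m (P (m + 1) t x) = P m t (H.ι (m + 1) x) := fun m t x => hc m t _
  -- The first term of the derivative is of the same kind as the map itself and uses the induction
  -- hypothesis. In the second one x has an additional level of regularity, so `isSc_smoothFamily`
  -- covers it at every order.
  have hD : ∀ k, IsSc k ((ScScale.const ℝ).prod H) F univ (fun m x => p m x.1 x.2) →
      IsSc k ((ScScale.const ℝ).prod H).tangent F univ
        (fun m y => p m y.1.1 y.2.2 + (y.2.1 : ℝ) • deriv (P m) y.1.1 y.1.2) := fun k hf => by
    have h0 := isSc_smoothFamily (k := k) hH hF (fun m => deriv (P m))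
      (fun m => (contDiff_infty_iff_deriv.1 (hP m)).2)
      fun m t x => deriv_apply_eq_of_forall_apply_eq (hF.clmι m) (hd (m + 1) t) (hd m t)
        fun t => hPc m t x
    have h1 := hf.comp_clm hE.tangent hE isOpen_univ
      (E := ((ScScale.const ℝ).prod H).tangent)
      (fun m => ((ContinuousLinearMap.fst ℝ ℝ (H.X (m + 1))).comp
          (ContinuousLinearMap.fst ℝ _ (ℝ × H.X m))).prod
        ((ContinuousLinearMap.snd ℝ ℝ (H.X m)).comp
          (ContinuousLinearMap.snd ℝ (ℝ × H.X (m + 1)) _)))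
      (fun _ _ => rfl)
    have h2 := h0.comp_clm hE.tangent (hR.prod hH.shift) isOpen_univ
      (E := ((ScScale.const ℝ).prod H).tangent)
      (fun m => ContinuousLinearMap.fst ℝ (ℝ × H.X (m + 1)) (ℝ × H.X m))
      (fun _ _ => rfl)
    have h3 : IsSc k ((ScScale.const ℝ).prod H).tangent (ScScale.const ℝ) univ
        (fun _ y => y.2.1) :=
      isSc_linear (E := ((ScScale.const ℝ).prod H).tangent) (F := ScScale.const ℝ)
        (fun m => (ContinuousLinearMap.fst ℝ ℝ (H.X m)).comp
          (ContinuousLinearMap.snd ℝ (ℝ × H.X (m + 1)) _)) univ (fun _ _ => rfl)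
    exact h1.add hE.tangent hF isOpen_univ (h3.smul hE.tangent hF isOpen_univ h2)
  have hA : ∀ x : ((ScScale.const ℝ).prod H).X 1, ((ScScale.const ℝ).prod H).ι 0 x ∈ univ →
      ∃ A : ((ScScale.const ℝ).prod H).X 0 →L[ℝ] F.X 0,
      HasScDerivAt ((ScScale.const ℝ).prod H) F univ (fun m x => p m x.1 x.2) x A ∧
      ∀ v : ((ScScale.const ℝ).prod H).X 0,
        p 0 x.1 v.2 + (v.1 : ℝ) • deriv (P 0) x.1 x.2 = A v := fun x _ => by
    let A : ℝ × H.X 0 →L[ℝ] F.X 0 := (p 0 x.1).comp (ContinuousLinearMap.snd ℝ _ _) +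
      (ContinuousLinearMap.fst ℝ ℝ (H.X 0)).smulRight (deriv (P 0) x.1 x.2)
    refine ⟨A, HasScDerivAt.of_hasFDerivAt hE ?_, fun v => rfl⟩
    have h1 : HasFDerivAt (fun y : ℝ × H.X 1 => P 0 y.1) _ x :=
      (hd 0 x.1).hasDerivAt.hasFDerivAt.comp x (ContinuousLinearMap.fst ℝ ℝ (H.X 1)).hasFDerivAt
    have h2 : HasFDerivAt (fun y : ℝ × H.X 1 => y.2) _ x :=
      (ContinuousLinearMap.snd ℝ ℝ (H.X 1)).hasFDerivAt
    refine (h1.clm_apply h2).congr_fderiv ?_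
    ext v
    · simp [A, ScScale.IsScBanach.clmι]
    · simp [A, P, ScScale.IsScBanach.clmι]
  have hS : ∀ k, IsSc k ((ScScale.const ℝ).prod H) F univ (fun m x => p m x.1 x.2) := fun k => by
    induction k with
    | zero => exact ⟨fun m => (hp m).continuousOn, fun m x _ => hc m x.1 x.2⟩
    | succ k ih => exact isSc_succ_of_hasScDerivAt hE hF isOpen_univ ih (hD k ih) hA
  exact ⟨hS, isTangentMap_of_hasScDerivAt hE hF isOpen_univ (hS 0) (hD 0 (hS 0)) hA⟩

end Classical

/-! ### The tangent map -/

section TangentMap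

variable {E F G : ScScale} {U : Set (E.X 0)} {f : ScFun E F} {k : ℕ}

theorem isTangentMap_scTangentMap (hf : IsSc 1 E F U f) :
    IsTangentMap E F U f (scTangentMap E F U f) := by
  have h : ∃ g, IsTangentMap E F U f g := ⟨_, hf.choose_spec.1⟩
  rw [scTangentMap, dif_pos h]
  exact h.choose_spec

theorem IsTangentMap.scTangentMap_eqOn (hE : E.IsScBanach) (hF : F.IsScBanach) (hU : IsOpen U)
    {g : ScFun E.tangent F.tangent} (h : IsTangentMap E F U f g) (m : ℕ) :
    EqOn (scTangentMap E F U f m) (g m) (levelSet E.tangent (tangentSet E U) m) :=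
  (isTangentMap_scTangentMap ⟨g, h, h.2.2⟩).eqOn hE hF hU h m

theorem IsSc.scTangentMap (hE : E.IsScBanach) (hF : F.IsScBanach) (hU : IsOpen U)
    (hf : IsSc (k + 1) E F U f) :
    IsSc k E.tangent F.tangent (tangentSet E U) (scTangentMap E F U f) := by
  obtain ⟨g, hg, hg'⟩ := hf
  exact hg'.congr (hg.scTangentMap_eqOn hE hF hU)

theorem IsTangentMap.scDeriv_apply (hE : E.IsScBanach) (hU : IsOpen U)
    {g : ScFun E.tangent F.tangent} (h : IsTangentMap E F U f g) {x : E.X 1} (hx : E.ι 0 x ∈ U)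
    (v : E.X 0) : scDeriv E F U f x v = (g 0 (x, v)).2 := by
  obtain ⟨A, hA, hA'⟩ := h.hasScDerivAt hx
  rw [hA.scDeriv_eq hE hU hx, hA']

/-- The second derivative is symmetric. -/
theorem IsTangentMap.second_symm (hE : E.IsScBanach) (hU : IsOpen U)
    {f' : ScFun E.tangent F.tangent} {f'' : ScFun E.tangent.tangent F.tangent.tangent}
    (hf : IsTangentMap E F U f f')
    (hf' : IsTangentMap E.tangent F.tangent (tangentSet E U) f' f'') {p : E.X 2}
    (hp : p ∈ levelSet E U 2) (v w : E.X 1) :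
    (f'' 0 ((p, v), (w, 0))).2.2 = (f'' 0 ((p, w), (v, 0))).2.2 := by
  have hcont : Continuous fun q : E.X 1 × E.X 1 => (f'' 0 ((p, q.1), (q.2, 0))).2.2 := by
    refine continuous_iff_continuousAt.2 fun q => ?_
    have h1 := hf'.continuousAt hE.tangent (isOpen_tangentSet hE hU) 0 (x := (p, q.1))
      hp (q.2, 0)
    exact continuous_snd.continuousAt.comp' (ContinuousAt.comp'
      (f := fun q : E.X 1 × E.X 1 => (((p, q.1) : E.tangent.X 1), ((q.2, 0) : E.tangent.X 0)))
      (x := q) h1 (Continuous.continuousAt (by fun_prop)))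
  suffices h : (fun q : E.X 1 × E.X 1 => (f'' 0 ((p, q.1), (q.2, 0))).2.2) =
      fun q => (f'' 0 ((p, q.2), (q.1, 0))).2.2 from congrFun h (v, w)
  -- Both sides are continuous in (v, w) ∈ E_1 × E_1, so it suffices to treat directions from E_2.
  have hd : DenseRange (Prod.map (E.ι 1) (E.ι 1)) := (hE.denseRange_ι 1).prodMap (hE.denseRange_ι 1)
  refine hd.equalizer hcont (hcont.comp continuous_swap) (funext ?_)
  rintro ⟨v, w⟩
  change (f'' 0 ((p, E.ι 1 v), (E.ι 1 w, 0))).2.2 = (f'' 0 ((p, E.ι 1 w), (E.ι 1 v, 0))).2.2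
  -- On the plane through p spanned by v and w, the map f is classically differentiable near the
  -- origin and its derivative is differentiable at the origin, so the classical symmetry theorem
  -- applies.
  let q : ℝ × ℝ → E.X 2 := fun s => p + (s.1 • v + s.2 • w)
  have hq0 : q 0 = p := by simp [q]
  let q' : ℝ × ℝ →L[ℝ] E.X 2 := (ContinuousLinearMap.fst ℝ ℝ ℝ).smulRight v +
    (ContinuousLinearMap.snd ℝ ℝ ℝ).smulRight w
  have hq : ∀ s, HasFDerivAt q q' s := fun s => q'.hasFDerivAt.const_add p
  have hqU : ∀ᶠ s in 𝓝 (0 : ℝ × ℝ), q s ∈ levelSet E U 2 := by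
    have hqc : Continuous q := by fun_prop
    exact ((isOpen_levelSet hE hU 2).preimage hqc).mem_nhds (by rw [mem_preimage, hq0]; exact hp)
  let D : ℝ × ℝ → E.X 1 → F.X 0 := fun s u => (f' 0 (E.ι 1 (q s), E.ι 0 u)).2
  have h1 : ∀ᶠ s in 𝓝 (0 : ℝ × ℝ), HasFDerivAt (fun s => f 0 (E.ι 0 (E.ι 1 (q s))))
      ((ContinuousLinearMap.fst ℝ ℝ ℝ).smulRight (D s (E.ι 1 v)) +
        (ContinuousLinearMap.snd ℝ ℝ ℝ).smulRight (D s (E.ι 1 w))) s := by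
    filter_upwards [hqU] with s hs
    obtain ⟨A, hA, hA'⟩ := hf.hasScDerivAt (x := E.ι 1 (q s)) hs
    have h2 := (hA.hasFDerivAt hE hU hs).comp s ((hE.clmι 1).hasFDerivAt.comp s (hq s))
    refine h2.congr_fderiv ?_
    ext <;> simp [D, hA', q', ScScale.IsScBanach.clmι]
  obtain ⟨A, hA, hA'⟩ := hf'.hasScDerivAt (x := ((p, E.ι 1 v) : E.tangent.X 1)) hp
  obtain ⟨B, hB, hB'⟩ := hf'.hasScDerivAt (x := ((p, E.ι 1 w) : E.tangent.X 1)) hp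
  have h3 : ∀ (u : E.X 1) (C : E.tangent.X 0 →L[ℝ] F.tangent.X 0),
      HasScDerivAt E.tangent F.tangent (tangentSet E U) f' ((p, u) : E.tangent.X 1) C →
      HasFDerivAt (fun s => D s u) (((ContinuousLinearMap.snd ℝ (F.X 1) (F.X 0)).comp (C.comp
        (ContinuousLinearMap.inl ℝ (E.X 1) (E.X 0)))).comp ((hE.clmι 1).comp q')) 0 := by
    intro u C hC
    have h4 := hC.hasFDerivAt hE.tangent (isOpen_tangentSet hE hU) hp
    have h5 : HasFDerivAt (fun s => ((q s, u) : E.tangent.X 1))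
        (q'.prod (0 : ℝ × ℝ →L[ℝ] E.X 1)) 0 := (hq 0).prodMk (hasFDerivAt_const u 0)
    have h6 : HasFDerivAt (fun y : E.tangent.X 1 => f' 0 (E.tangent.ι 0 y))
        (C.comp (hE.tangent.clmι 0)) ((q 0, u) : E.tangent.X 1) := by rw [hq0]; exact h4
    have h7 := (ContinuousLinearMap.snd ℝ (F.X 1) (F.X 0)).hasFDerivAt.comp (0 : ℝ × ℝ)
      (h6.comp (0 : ℝ × ℝ) h5)
    refine h7.congr_fderiv ?_
    ext <;> simp [ScScale.IsScBanach.clmι, q'] <;> exact congrArg Prod.snd (map_zero C)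
  have h8 := h3 (E.ι 1 v) A hA
  have h9 := h3 (E.ι 1 w) B hB
  have h10 := second_derivative_symmetric_of_eventually h1
    ((((ContinuousLinearMap.smulRightL ℝ (ℝ × ℝ) (F.X 0)) (ContinuousLinearMap.fst ℝ ℝ ℝ)
      ).hasFDerivAt.comp (0 : ℝ × ℝ) h8).add
      (((ContinuousLinearMap.smulRightL ℝ (ℝ × ℝ) (F.X 0)) (ContinuousLinearMap.snd ℝ ℝ ℝ)
      ).hasFDerivAt.comp (0 : ℝ × ℝ) h9)) (0, 1) (1, 0)
  rw [hA', hB']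
  have hA0 : (A ((0 : E.X 1), (0 : E.X 0))).2 = 0 := congrArg Prod.snd (map_zero A)
  have hB0 : (B ((0 : E.X 1), (0 : E.X 0))).2 = 0 := congrArg Prod.snd (map_zero B)
  simp [q', ScScale.IsScBanach.clmι] at h10
  erw [hA0, hB0, zero_add, add_zero] at h10
  exact h10

/-- The tangent map is linear in its fibre variable, so its derivative in the fibre direction z is
again Df(p)z. For z coming from E_1 this is seen along a line; density gives the rest. -/
theorem IsTangentMap.second_apply (hE : E.IsScBanach) (hU : IsOpen U)
    {f' : ScFun E.tangent F.tangent} {f'' : ScFun E.tangent.tangent F.tangent.tangent}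
    (hf : IsTangentMap E F U f f')
    (hf' : IsTangentMap E.tangent F.tangent (tangentSet E U) f' f'') {p : E.X 2}
    (hp : p ∈ levelSet E U 2) (v w : E.X 1) (z : E.X 0) :
    (f'' 0 ((p, v), (w, z))).2.2 = (f'' 0 ((p, v), (w, 0))).2.2 + (f' 0 (E.ι 1 p, z)).2 := by
  obtain ⟨A, hA, hA'⟩ := hf.hasScDerivAt (x := E.ι 1 p) hp
  obtain ⟨B, hB, hB'⟩ := hf'.hasScDerivAt (x := ((p, v) : E.tangent.X 1)) hp
  have key : ∀ z, (B ((0 : E.X 1), z)).2 = A z := by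
    have hc : Continuous fun z => (B ((0 : E.X 1), z)).2 :=
      continuous_snd.comp (B.continuous.comp (by fun_prop))
    refine fun z => congrFun ((hE.denseRange_ι 0).equalizer hc A.continuous (funext fun z => ?_)) z
    have hz : ((p, v) : E.tangent.X 1) + (0 : ℝ) • ((0, z) : E.tangent.X 1) = (p, v) := by simp
    have h1 := HasScDerivAt.hasDerivAt_line (s := 0) (v := ((0, z) : E.tangent.X 1)) hE.tangent
      (isOpen_tangentSet hE hU) (by rw [hz]; exact hp) (by rw [hz]; exact hB)
    have h2 := (ContinuousLinearMap.snd ℝ (F.X 1) (F.X 0)).hasFDerivAt.comp_hasDerivAt (0 : ℝ) h1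
    have h3 : HasDerivAt (fun s : ℝ => A (E.ι 0 v) + s • A (E.ι 0 z)) (A (E.ι 0 z)) 0 := by
      simpa using ((hasDerivAt_id (0 : ℝ)).smul_const (A (E.ι 0 z))).const_add (A (E.ι 0 v))
    have e0 : E.tangent.ι 0 ((0, z) : E.tangent.X 1) = (0, E.ι 0 z) := 
      Prod.ext (map_zero (E.ι 1)) rfl
    rw [e0] at h2
    refine h2.unique (h3.congr_of_eventuallyEq (Eventually.of_forall fun s => ?_))
    have e : E.tangent.ι 0 (((p, v) : E.tangent.X 1) + s • ((0, z) : E.tangent.X 1)) =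
        (E.ι 1 p, E.ι 0 v + s • E.ι 0 z) := by
      change (E.ι 1 (p + s • 0), E.ι 0 (v + s • z)) = _
      rw [smul_zero, add_zero, map_add, map_smul]
    change (f' 0 (E.tangent.ι 0 (((p, v) : E.tangent.X 1) + s • ((0, z) : E.tangent.X 1)))).2 = _
    rw [e, hA', map_add, map_smul]
  have e : ((w, z) : E.tangent.X 0) = (w, 0) + (0, z) :=
    Prod.ext (add_zero w).symm (zero_add z).symm
  rw [hB', hB', hA', ← key z, e, map_add]
  rfl

theorem IsTangentMap.prodMk {g : ScFun E G} {f' : ScFun E.tangent F.tangent}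
    {g' : ScFun E.tangent G.tangent} (hf : IsTangentMap E F U f f') (hg : IsTangentMap E G U g g') :
    IsTangentMap E (F.prod G) U (fun m x => (f m x, g m x))
      (fun m y => (((f' m y).1, (g' m y).1), ((f' m y).2, (g' m y).2))) := by
  refine ⟨hf.1.prodMk hg.1, fun x hx => ?_, fun m => ?_, fun m y hy => ?_⟩
  · obtain ⟨A, hA, hA'⟩ := hf.2.1 x hx
    obtain ⟨B, hB, hB'⟩ := hg.2.1 x hx
    refine ⟨A.prod B, IsLittleO.prod_left hA hB, fun h => ?_⟩
    change (((f' 0 (x, h)).1, (g' 0 (x, h)).1), ((f' 0 (x, h)).2, (g' 0 (x, h)).2)) = _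
    rw [hA', hB']
    rfl
  · have h1 := hf.2.2.1 m
    have h2 := hg.2.2.1 m
    exact ((continuous_fst.comp_continuousOn h1).prodMk (continuous_fst.comp_continuousOn h2)).prodMk
      ((continuous_snd.comp_continuousOn h1).prodMk (continuous_snd.comp_continuousOn h2))
  · have h1 := hf.2.2.2 m y hy
    have h2 := hg.2.2.2 m y hy
    have a1 : F.ι (m + 1) (f' (m + 1) y).1 = (f' m (E.tangent.ι m y)).1 := congrArg Prod.fst h1
    have a2 : F.ι m (f' (m + 1) y).2 = (f' m (E.tangent.ι m y)).2 := congrArg Prod.snd h1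
    have b1 : G.ι (m + 1) (g' (m + 1) y).1 = (g' m (E.tangent.ι m y)).1 := congrArg Prod.fst h2
    have b2 : G.ι m (g' (m + 1) y).2 = (g' m (E.tangent.ι m y)).2 := congrArg Prod.snd h2
    exact Prod.ext (Prod.ext a1 b1) (Prod.ext a2 b2)

theorem IsTangentMap.clm_comp {f' : ScFun E.tangent F.tangent} (hf : IsTangentMap E F U f f')
    (L : ∀ m, F.X m →L[ℝ] G.X m) (hL : ∀ m x, G.ι m (L (m + 1) x) = L m (F.ι m x)) :
    IsTangentMap E G U (fun m x => L m (f m x))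
      (fun m y => (L (m + 1) (f' m y).1, L m (f' m y).2)) := by
  refine ⟨(isSc_linear (k := 0) L univ hL).isSc0.comp hf.1 (mapsTo_univ _ _), fun x hx => ?_,
    fun m => ?_, fun m y hy => ?_⟩
  · obtain ⟨A, hA, hA'⟩ := hf.2.1 x hx
    refine ⟨(L 0).comp A, ?_, fun h => ?_⟩
    · refine (((L 0).isBigO_comp _ _).trans_isLittleO hA).congr_left fun h => ?_
      simp only [map_sub, ContinuousLinearMap.comp_apply]
    · change (L 1 (f' 0 (x, h)).1, L 0 (f' 0 (x, h)).2) = _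
      rw [hA']
      rfl
  · have h1 := hf.2.2.1 m
    exact ((L (m + 1)).continuous.comp_continuousOn (continuous_fst.comp_continuousOn h1)).prodMk
      ((L m).continuous.comp_continuousOn (continuous_snd.comp_continuousOn h1))
  · have h1 := hf.2.2.2 m y hy
    exact Prod.ext ((hL (m + 1) _).trans (congrArg (fun q => L (m + 1) q.1) h1))
      ((hL m _).trans (congrArg (fun q => L m q.2) h1))

end TangentMap

/-! ### Vector fields on sc-smooth retracts -/

namespace ScRetract

variable {M : ScRetract} {W : Set (M.E.X 1)} {σ τ : ScFun M.E.shift M.E} {k : ℕ}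

namespace IsMPolyfold

theorem isTangentMap_Tr (hM : M.IsMPolyfold) : IsTangentMap M.E M.E univ M.r M.Tr :=
  isTangentMap_scTangentMap (hM.smooth 1)

theorem isSc_Tr (hM : M.IsMPolyfold) : IsSc k M.E.tangent M.E.tangent univ M.Tr :=
  (hM.smooth (k + 1)).scTangentMap hM.scBanach hM.scBanach isOpen_univ

theorem r_eq_self (hM : M.IsMPolyfold) {m : ℕ} {x : M.E.X m} (hx : x ∈ M.pts m) : M.r m x = x := by
  obtain ⟨y, rfl⟩ := hx
  exact hM.retraction m y

theorem ι_r (hM : M.IsMPolyfold) (m : ℕ) (x : M.E.X (m + 1)) : M.E.ι m (M.r (m + 1) x) = M.r m (M.E.ι m x) :=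
  (hM.smooth 0).2 m x (mem_univ _)

theorem ι_mem_pts (hM : M.IsMPolyfold) {m : ℕ} {x : M.E.X (m + 1)} (hx : x ∈ M.pts (m + 1)) : M.E.ι m x ∈ M.pts m := by
  rw [← hM.r_eq_self hx, hM.ι_r]
  exact mem_range_self _

theorem shift_incl_mem_pts (hM : M.IsMPolyfold) {m : ℕ} {x : M.E.X (m + 1)} (hx : x ∈ M.pts (m + 1)) :
    M.E.shift.incl m x ∈ M.pts 1 := by
  induction m with
  | zero => exact hx
  | succ m ih => exact ih (hM.ι_mem_pts hx)

theorem shift_incl_r (hM : M.IsMPolyfold) (m : ℕ) (x : M.E.X (m + 1)) :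
    M.E.shift.incl m (M.r (m + 1) x) = M.r 1 (M.E.shift.incl m x) := by
  induction m with
  | zero => rfl
  | succ m ih =>
    change M.E.shift.incl m (M.E.ι (m + 1) (M.r (m + 1 + 1) x)) = _
    rw [hM.ι_r]
    exact ih _

theorem Tr_fst (hM : M.IsMPolyfold) (m : ℕ) (y : M.E.tangent.X m) : (M.Tr m y).1 = M.r (m + 1) y.1 :=
  hM.isTangentMap_Tr.fst_apply hM.scBanach m (mem_univ _)

theorem scDeriv_r (hM : M.IsMPolyfold) (p : M.E.X 1) (v : M.E.X 0) :
    scDeriv M.E M.E univ M.r p v = (M.Tr 0 (p, v)).2 :=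
  hM.isTangentMap_Tr.scDeriv_apply hM.scBanach isOpen_univ (mem_univ _) v

theorem Tr_zero (hM : M.IsMPolyfold) (p : M.E.X 1) (v : M.E.X 0) :
    M.Tr 0 (p, v) = (M.r 1 p, scDeriv M.E M.E univ M.r p v) :=
  Prod.ext (hM.Tr_fst 0 (p, v)) (hM.scDeriv_r p v).symm

/-- Chain rule for r ∘ r = r, together with uniqueness of tangent maps. -/
theorem Tr_Tr (hM : M.IsMPolyfold) (m : ℕ) (y : M.E.tangent.X m) : M.Tr m (M.Tr m y) = M.Tr m y := by
  have h := hM.isTangentMap_Tr.comp hM.scBanach hM.scBanach isOpen_univ isOpen_univ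
    hM.isTangentMap_Tr (mapsTo_univ _ _)
  have h' : IsTangentMap M.E M.E univ M.r (fun m y => M.Tr m (M.Tr m y)) :=
    h.congr fun m x _ => (hM.retraction m x).symm
  exact h'.eqOn hM.scBanach hM.scBanach isOpen_univ hM.isTangentMap_Tr m (mem_univ y)

/-- By `Tr_Tr`, Dr(p) is a projection when r(p) = p, so its range is its fixed space. -/
theorem mem_tangentSpace_iff (hM : M.IsMPolyfold) {p : M.E.X 1} (hp : p ∈ M.pts 1) {v : M.E.X 0} :
    v ∈ M.tangentSpace p ↔ scDeriv M.E M.E univ M.r p v = v := by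
  refine ⟨?_, fun h => ⟨v, h⟩⟩
  rintro ⟨w, hw⟩
  have hw : scDeriv M.E M.E univ M.r p w = v := hw
  have h := congrArg Prod.snd (hM.Tr_Tr 0 (p, w))
  rw [hM.Tr_zero p w, hM.r_eq_self hp, hM.Tr_zero, hw] at h
  exact h

theorem Tr_eq_self (hM : M.IsMPolyfold) {m : ℕ} {p : M.E.X (m + 1)} (hp : p ∈ M.pts (m + 1)) {v : M.E.X m}
    (hv : M.E.incl m v ∈ M.tangentSpace (M.E.shift.incl m p)) : M.Tr m (p, v) = (p, v) := by
  apply hM.scBanach.tangent.injective_incl m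
  rw [hM.isSc_Tr (k := 0).isSc0.incl_apply m (mem_univ _), ScScale.prod_incl, hM.Tr_zero,
    (hM.mem_tangentSpace_iff (hM.shift_incl_mem_pts hp)).1 hv,
    hM.r_eq_self (hM.shift_incl_mem_pts hp)]

theorem isOpen_pre (hM : M.IsMPolyfold) (hW : IsOpen W) : IsOpen (M.pre W) := by
  have h : Continuous (M.r 1) := continuousOn_univ.1 ((hM.smooth 0).1 1)
  exact hW.preimage h

theorem mem_levelSet_pre (hM : M.IsMPolyfold) {m : ℕ} {x : M.E.X (m + 1)} :
    x ∈ levelSet M.E.shift (M.pre W) m ↔ M.E.shift.incl m (M.r (m + 1) x) ∈ W := by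
  rw [hM.shift_incl_r]
  rfl

theorem r_mem_levelSet_pre (hM : M.IsMPolyfold) {m : ℕ} {x : M.E.X (m + 1)} (hx : x ∈ levelSet M.E.shift (M.pre W) m) :
    M.r (m + 1) x ∈ levelSet M.E.shift (M.pre W) m := by
  rw [hM.mem_levelSet_pre, hM.retraction]
  exact hM.mem_levelSet_pre.1 hx

theorem pre₂_eq (hM : M.IsMPolyfold) : M.pre₂ W = levelSet M.E.shift (M.pre W) 1 := by
  ext x
  exact (hM.mem_levelSet_pre (m := 1)).symm

theorem mem_pre_of_mem (hM : M.IsMPolyfold) {p : M.E.X 2} (hp : p ∈ M.pts 2) (hpW : M.E.ι 1 p ∈ W) :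
    p ∈ levelSet M.E.shift (M.pre W) 1 := by
  rw [hM.mem_levelSet_pre, hM.r_eq_self hp]
  exact hpW

theorem isTangentMap_r_shift (hM : M.IsMPolyfold) :
    IsTangentMap M.E.shift M.E.shift (M.pre W) (fun m => M.r (m + 1)) (fun m => M.Tr (m + 1)) :=
  (hM.isTangentMap_Tr.shift hM.scBanach hM.scBanach isOpen_univ).mono (subset_univ _)

end IsMPolyfold

namespace IsVectorField

theorem isSc_snd (hσ : M.IsVectorField W σ) (hM : M.IsMPolyfold)
    (hW : IsOpen W) : IsSc k M.E.shift M.E (M.pre W) (fun m x => σ m (M.r (m + 1) x)) :=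
  (hσ.1 k).snd hM.scBanach.shift hM.scBanach.shift hM.scBanach (hM.isOpen_pre hW)

theorem incl_apply (hσ : M.IsVectorField W σ) (hM : M.IsMPolyfold) {m : ℕ} {p : M.E.X (m + 1)} (hp : p ∈ M.pts (m + 1))
    (hpW : M.E.shift.incl m p ∈ W) : M.E.incl m (σ m p) = σ 0 (M.E.shift.incl m p) := by
  have h := (hσ.1 0).isSc0.incl_apply (x := p) m
    (hM.mem_levelSet_pre.2 (by rwa [hM.r_eq_self hp]))
  rw [ScScale.prod_incl] at h
  have h2 := congrArg Prod.snd h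
  simp only [hM.r_eq_self hp] at h2
  rw [h2, hM.r_eq_self (hM.shift_incl_mem_pts hp)]

theorem Tr_apply (hσ : M.IsVectorField W σ) (hM : M.IsMPolyfold) {m : ℕ} {p : M.E.X (m + 1)} (hp : p ∈ M.pts (m + 1))
    (hpW : M.E.shift.incl m p ∈ W) : M.Tr m (p, σ m p) = (p, σ m p) := by
  refine hM.Tr_eq_self hp ?_
  rw [hσ.incl_apply hM hp hpW]
  exact hσ.2 _ (hM.shift_incl_mem_pts hp) hpW

theorem isTangentMap_fieldDeriv (hσ : M.IsVectorField W σ) (hM : M.IsMPolyfold)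
    (hW : IsOpen W) :
    IsTangentMap M.E.shift M.E (M.pre W) (fun m x => σ m (M.r (m + 1) x))
      (scTangentMap M.E.shift M.E (M.pre W) (fun m x => σ m (M.r (m + 1) x))) :=
  isTangentMap_scTangentMap (hσ.isSc_snd hM hW)

/-- The tangent map of `p ↦ DΦ(p) σ(p)`. -/
theorem isTangentMap_comp (hσ : M.IsVectorField W σ) (hM : M.IsMPolyfold)
    (hW : IsOpen W) {F : ScScale} {T : ScFun M.E.tangent F.tangent}
    {TT : ScFun M.E.tangent.tangent F.tangent.tangent}
    (hT : IsTangentMap M.E.tangent F.tangent univ T TT) :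
    IsTangentMap M.E.shift F (M.pre W) (fun m x => (T m (M.r (m + 1) x, σ m (M.r (m + 1) x))).2)
      (fun m y =>
        ((TT m (((M.Tr (m + 1) y).1,
            (scTangentMap M.E.shift M.E (M.pre W) (fun m x => σ m (M.r (m + 1) x)) m y).1),
          ((M.Tr (m + 1) y).2,
            (scTangentMap M.E.shift M.E (M.pre W) (fun m x => σ m (M.r (m + 1) x)) m y).2))).1.2,
        (TT m (((M.Tr (m + 1) y).1,
            (scTangentMap M.E.shift M.E (M.pre W) (fun m x => σ m (M.r (m + 1) x)) m y).1),
          ((M.Tr (m + 1) y).2,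
            (scTangentMap M.E.shift M.E (M.pre W) (fun m x => σ m (M.r (m + 1) x)) m y).2))).2.2)) :=
  (hT.comp hM.scBanach.shift hM.scBanach.tangent (hM.isOpen_pre hW) isOpen_univ
    ((hM.isTangentMap_r_shift).prodMk (hσ.isTangentMap_fieldDeriv hM hW)) (mapsTo_univ _ _)).clm_comp
    (fun m => ContinuousLinearMap.snd ℝ (F.X (m + 1)) (F.X m)) (fun _ _ => rfl)

/-- This is the product rule D(DΦ σ)h = D²Φ(σ, h) + DΦ(Dσ h). Since p lies on the retract and h is
tangent there, `Tr` fixes (p, h) and the retraction disappears from the formula. -/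
theorem comp_second (hσ : M.IsVectorField W σ) (hM : M.IsMPolyfold)
    (hW : IsOpen W) {F : ScScale} {Φ : ScFun M.E F} {T : ScFun M.E.tangent F.tangent}
    {TT : ScFun M.E.tangent.tangent F.tangent.tangent} (hΦ : IsTangentMap M.E F univ Φ T)
    (hT : IsTangentMap M.E.tangent F.tangent univ T TT) {p : M.E.X 2} (hp : p ∈ M.pts 2)
    (hpW : M.E.ι 1 p ∈ W) {h : M.E.X 1} (hh : M.E.ι 0 h ∈ M.tangentSpace (M.E.ι 1 p)) :
    ∃ A : M.E.X 1 →L[ℝ] F.X 0, HasScDerivAt M.E.shift F (M.pre W)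
      (fun m x => (T m (M.r (m + 1) x, σ m (M.r (m + 1) x))).2) p A ∧
      A h = (TT 0 ((p, σ 1 p), (h, 0))).2.2 + (T 0 (M.E.ι 1 p, M.fieldDeriv W σ 0 p h)).2 := by
  obtain ⟨A, hA, hA'⟩ := (hσ.isTangentMap_comp hM hW hT).hasScDerivAt
    (x := p) (hM.mem_pre_of_mem hp hpW)
  refine ⟨A, hA, ?_⟩
  have h1 : M.Tr 1 (p, h) = (p, h) := hM.Tr_eq_self hp hh
  have h2 : (scTangentMap M.E.shift M.E (M.pre W) (fun m x => σ m (M.r (m + 1) x)) 0 (p, h)).1 =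
      σ 1 p := by
    have := (hσ.isTangentMap_fieldDeriv hM hW).fst_apply hM.scBanach 0 (y := (p, h))
      (hM.mem_pre_of_mem hp hpW)
    rw [this, hM.r_eq_self hp]
  have h3 := hA' h
  simp only at h3
  rw [← h3]
  erw [h1, h2]
  exact IsTangentMap.second_apply hM.scBanach isOpen_univ hΦ hT (mem_univ p) _ _ _

theorem ι_apply_mem (hσ : M.IsVectorField W σ) (hM : M.IsMPolyfold) {p : M.E.X 2} (hp : p ∈ M.pts 2) (hpW : M.E.ι 1 p ∈ W) :
    M.E.ι 0 (σ 1 p) ∈ M.tangentSpace (M.E.ι 1 p) := by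
  have := hσ.incl_apply hM (m := 1) hp hpW
  change M.E.ι 0 (σ 1 p) = σ 0 (M.E.ι 1 p) at this
  rw [this]
  exact hσ.2 _ (hM.ι_mem_pts hp) hpW

/-- The Lie bracket in terms of the functions `p ↦ DΦ(p) σ(p)` and `p ↦ DΦ(p) τ(p)`. -/
theorem apply_bracket (hσ : M.IsVectorField W σ) (hM : M.IsMPolyfold)
    (hW : IsOpen W) (hτ : M.IsVectorField W τ) {F : ScScale} {Φ : ScFun M.E F}
    {T : ScFun M.E.tangent F.tangent}
    {TT : ScFun M.E.tangent.tangent F.tangent.tangent} (hΦ : IsTangentMap M.E F univ Φ T)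
    (hT : IsTangentMap M.E.tangent F.tangent univ T TT) {p : M.E.X 2} (hp : p ∈ M.pts 2)
    (hpW : M.E.ι 1 p ∈ W) :
    (T 0 (M.E.ι 1 p, M.bracket W σ τ 0 p)).2 =
      scDeriv M.E.shift F (M.pre W) (fun m x => (T m (M.r (m + 1) x, τ m (M.r (m + 1) x))).2) p
        (σ 1 p) -
      scDeriv M.E.shift F (M.pre W) (fun m x => (T m (M.r (m + 1) x, σ m (M.r (m + 1) x))).2) p
        (τ 1 p) := by
  obtain ⟨A, hA, hA'⟩ := hτ.comp_second hM hW hΦ hT hp hpW (hσ.ι_apply_mem hM hp hpW)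
  obtain ⟨B, hB, hB'⟩ := hσ.comp_second hM hW hΦ hT hp hpW (hτ.ι_apply_mem hM hp hpW)
  have hpU := hM.mem_pre_of_mem hp hpW
  -- By symmetry the terms D²Φ(τ, σ) and D²Φ(σ, τ) cancel in the difference; only DΦ of the bracket
  -- remains.
  rw [hA.scDeriv_eq hM.scBanach.shift (hM.isOpen_pre hW) hpU,
    hB.scDeriv_eq hM.scBanach.shift (hM.isOpen_pre hW) hpU, hA', hB',
    hΦ.second_symm hM.scBanach isOpen_univ hT (mem_univ p) (τ 1 p) (σ 1 p)]
  obtain ⟨C, _, hC⟩ := hΦ.hasScDerivAt (x := M.E.ι 1 p) (mem_univ _)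
  rw [hC, hC, hC, add_sub_add_left_eq_sub, ← map_sub]
  rfl

/-- The bracket formula is applied with Φ = r. Tangent fields satisfy Dr σ = σ and Dr τ = τ, so it
reads Dr(p)[σ, τ] = [σ, τ], which characterises tangency. -/
theorem bracket_mem (hσ : M.IsVectorField W σ) (hM : M.IsMPolyfold)
    (hW : IsOpen W) (hτ : M.IsVectorField W τ) {p : M.E.X 2} (hp : p ∈ M.pts 2)
    (hpW : M.E.ι 1 p ∈ W) : M.bracket W σ τ 0 p ∈ M.tangentSpace (M.E.ι 1 p) := by
  have hT := hM.isTangentMap_Tr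
  have hTT := isTangentMap_scTangentMap (hM.isSc_Tr (k := 1))
  have h := hσ.apply_bracket hM hW hτ hT hTT hp hpW
  have hpU := hM.mem_pre_of_mem hp hpW
  have key : ∀ {ρ : ScFun M.E.shift M.E}, M.IsVectorField W ρ → ∀ v : M.E.X 1,
      scDeriv M.E.shift M.E (M.pre W) (fun m x => (M.Tr m (M.r (m + 1) x, ρ m (M.r (m + 1) x))).2)
        p v = M.fieldDeriv W ρ 0 p v := fun {ρ} hρ v => by
    have h1 := (hρ.isTangentMap_fieldDeriv hM hW).congr
      (f' := fun m x => (M.Tr m (M.r (m + 1) x, ρ m (M.r (m + 1) x))).2) fun m x hx => by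
        simp only
        rw [hρ.Tr_apply hM (mem_range_self _) (hM.mem_levelSet_pre.1 hx)]
    exact h1.scDeriv_apply hM.scBanach.shift (hM.isOpen_pre hW) hpU v
  rw [key hτ, key hσ, ← hM.scDeriv_r] at h
  exact (hM.mem_tangentSpace_iff (hM.ι_mem_pts hp)).2 h

/-- The map is the fibre part of Tτ composed with p ↦ (p, σ(p)). The latter has to take values on
level one in both components, which costs the second shift of the scale. -/
theorem isSc_fieldDeriv (hσ : M.IsVectorField W σ) (hM : M.IsMPolyfold)
    (hW : IsOpen W) (hτ : M.IsVectorField W τ) :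
    IsSc k M.E.shift.shift M.E (M.pre₂ W)
      (fun m x => M.fieldDeriv W τ m (M.r (m + 2) x) (σ (m + 1) (M.r (m + 2) x))) := by
  have hE := hM.scBanach
  have h1 : IsSc k M.E.shift.tangent M.E (tangentSet M.E.shift (M.pre W))
      (fun m y => (scTangentMap M.E.shift M.E (M.pre W) (fun m x => τ m (M.r (m + 1) x)) m y).2) :=
    ((hτ.isSc_snd hM hW (k := k + 1)).scTangentMap hE.shift hE (hM.isOpen_pre hW)).snd
      hE.shift.tangent hE.shift hE (isOpen_tangentSet hE.shift (hM.isOpen_pre hW))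
  have h2 := (hσ.1 k).shift hE.shift hE.tangent (hM.isOpen_pre hW)
  rw [hM.pre₂_eq]
  exact IsSc.comp (F := M.E.shift.tangent) hE.shift.shift hE.shift.tangent (isOpen_levelSet hE.shift (hM.isOpen_pre hW) 1)
    (isOpen_tangentSet hE.shift (hM.isOpen_pre hW)) h1 h2
    (fun x hx => hM.r_mem_levelSet_pre (m := 1) hx)

theorem bracket (hσ : M.IsVectorField W σ) (hM : M.IsMPolyfold)
    (hW : IsOpen W) (hτ : M.IsVectorField W τ) : M.IsVectorField₂ W (M.bracket W σ τ) := by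
  have hE := hM.scBanach
  have ho : IsOpen (M.pre₂ W) := by
    rw [hM.pre₂_eq]
    exact isOpen_levelSet hE.shift (hM.isOpen_pre hW) 1
  refine ⟨fun k => ?_, fun p hp hpW => hσ.bracket_mem hM hW hτ hp hpW⟩
  have h1 : IsSc k M.E.shift.shift M.E.shift (M.pre₂ W)
      (fun m x => M.E.ι (m + 1) (M.r (m + 2) x)) :=
    (isSc_ι hE.shift univ).comp hE.shift.shift hE.shift.shift ho isOpen_univ
      ((((hM.smooth k).shift hE hE isOpen_univ).shift hE.shift hE.shift isOpen_univ).mono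
        (subset_univ _)) (mapsTo_univ _ _)
  exact h1.prodMk hE.shift.shift hE.shift hE ho ((hσ.isSc_fieldDeriv hM hW hτ).sub
    hE.shift.shift hE ho (hτ.isSc_fieldDeriv hM hW hσ))

end IsVectorField

theorem IsVectorField₂.add (hM : M.IsMPolyfold) (hW : IsOpen W)
    {η θ : ScFun M.E.shift.shift M.E} (hη : M.IsVectorField₂ W η) (hθ : M.IsVectorField₂ W θ) :
    M.IsVectorField₂ W (fun m p => η m p + θ m p) := by
  have hE := hM.scBanach
  have ho : IsOpen (M.pre₂ W) := by
    rw [hM.pre₂_eq]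
    exact isOpen_levelSet hE.shift (hM.isOpen_pre hW) 1
  exact ⟨fun k => ((hη.1 k).fst hE.shift.shift hE.shift hE ho).prodMk hE.shift.shift hE.shift hE ho
    (((hη.1 k).snd hE.shift.shift hE.shift hE ho).add hE.shift.shift hE ho
      ((hθ.1 k).snd hE.shift.shift hE.shift hE ho)),
    fun p hp hpW => add_mem (hη.2 p hp hpW) (hθ.2 p hp hpW)⟩

theorem IsVectorField₂.sub (hM : M.IsMPolyfold) (hW : IsOpen W)
    {η θ : ScFun M.E.shift.shift M.E} (hη : M.IsVectorField₂ W η) (hθ : M.IsVectorField₂ W θ) :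
    M.IsVectorField₂ W (fun m p => η m p - θ m p) := by
  have hE := hM.scBanach
  have ho : IsOpen (M.pre₂ W) := by
    rw [hM.pre₂_eq]
    exact isOpen_levelSet hE.shift (hM.isOpen_pre hW) 1
  exact ⟨fun k => ((hη.1 k).fst hE.shift.shift hE.shift hE ho).prodMk hE.shift.shift hE.shift hE ho
    (((hη.1 k).snd hE.shift.shift hE.shift hE ho).sub hE.shift.shift hE ho
      ((hθ.1 k).snd hE.shift.shift hE.shift hE ho)),
    fun p hp hpW => sub_mem (hη.2 p hp hpW) (hθ.2 p hp hpW)⟩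

theorem IsVectorField.applyJ {J : ScFun M.E.tangent M.E.tangent} (hσ : M.IsVectorField W σ)
    (hM : M.IsMPolyfold) (hW : IsOpen W) (hJ : M.IsTensor11 J) (hJ1 : ∀ m y, (J m y).1 = y.1) :
    M.IsVectorField W (M.applyJ J σ) := by
  have hE := hM.scBanach
  refine ⟨fun k => ?_, fun p hp hpW => hJ.mem p hp _ (hσ.2 p hp hpW)⟩
  have h := (hJ.smooth k).comp hE.shift hE.tangent (hM.isOpen_pre hW) isOpen_univ (hσ.1 k)
    (mapsTo_univ _ _)
  refine h.congr fun m x hx => ?_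
  have h1 := hσ.Tr_apply hM (p := M.r (m + 1) x) (mem_range_self _) (hM.mem_levelSet_pre.1 hx)
  simp only
  rw [h1]
  exact Prod.ext (hJ1 m (M.r (m + 1) x, σ m (M.r (m + 1) x))).symm rfl

end ScRetract

/-! ### Tensors which are constant in a map to a finite-dimensional space -/

namespace ScRetract

variable {M : ScRetract} {W : Set (M.E.X 1)} {V : Type} [NormedAddCommGroup V] [NormedSpace ℝ V]

/-- `Φ : E → V` is sc-smooth and injective on the tangent spaces of the retract. -/
structure IsImmersion (M : ScRetract) (Φ : ScFun M.E (ScScale.const V)) : Prop where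
  smooth : IsScSmooth M.E (ScScale.const V) univ Φ
  injective : ∀ p ∈ M.pts 1, ∀ v ∈ M.tangentSpace p,
    scDeriv M.E (ScScale.const V) univ Φ p v = 0 → v = 0

/-- The function `p ↦ DΦ(p) σ(p)`. -/
noncomputable def flatten (Φ : ScFun M.E (ScScale.const V)) (σ : ScFun M.E.shift M.E) :
    ScFun M.E.shift (ScScale.const V) := fun m x =>
  (scTangentMap M.E (ScScale.const V) univ Φ m (M.r (m + 1) x, σ m (M.r (m + 1) x))).2

namespace IsImmersion

variable {Φ : ScFun M.E (ScScale.const V)} {σ τ a b c d : ScFun M.E.shift M.E}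

theorem tangent_snd (hΦ : M.IsImmersion Φ) (hM : M.IsMPolyfold) (p : M.E.X 1) (v : M.E.X 0) :
    (scTangentMap M.E (ScScale.const V) univ Φ 0 (p, v)).2 =
      scDeriv M.E (ScScale.const V) univ Φ p v :=
  ((isTangentMap_scTangentMap (hΦ.smooth 1)).scDeriv_apply hM.scBanach isOpen_univ (mem_univ _)
    v).symm

theorem flatten_zero (hΦ : M.IsImmersion Φ) (hM : M.IsMPolyfold) (x : M.E.X 1) :
    flatten Φ σ 0 x = scDeriv M.E (ScScale.const V) univ Φ (M.r 1 x) (σ 0 (M.r 1 x)) :=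
  hΦ.tangent_snd hM _ _

variable [FiniteDimensional ℝ V]

theorem isTangentMap_tangent (hΦ : M.IsImmersion Φ) (hM : M.IsMPolyfold) :
    IsTangentMap M.E.tangent (ScScale.const V).tangent univ
      (scTangentMap M.E (ScScale.const V) univ Φ)
      (scTangentMap M.E.tangent (ScScale.const V).tangent univ
        (scTangentMap M.E (ScScale.const V) univ Φ)) :=
  isTangentMap_scTangentMap
    ((hΦ.smooth 2).scTangentMap hM.scBanach (ScScale.IsScBanach.const V) isOpen_univ)

theorem hasScDerivAt_flatten (hΦ : M.IsImmersion Φ) (hM : M.IsMPolyfold) (hW : IsOpen W)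
    (hσ : M.IsVectorField W σ) {p : M.E.X 2} (hp : p ∈ M.pts 2) (hpW : M.E.ι 1 p ∈ W) :
    HasScDerivAt M.E.shift (ScScale.const V) (M.pre W) (flatten Φ σ) p
      (scDeriv M.E.shift (ScScale.const V) (M.pre W) (flatten Φ σ) p) := by
  have hpU := hM.mem_pre_of_mem hp hpW
  obtain ⟨A, hA, _⟩ :=
    (hσ.isTangentMap_comp hM hW (hΦ.isTangentMap_tangent hM)).hasScDerivAt hpU
  rw [HasScDerivAt.scDeriv_eq (f := flatten Φ σ) hM.scBanach.shift (hM.isOpen_pre hW) hpU hA]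
  exact hA

theorem scDeriv_bracket (hΦ : M.IsImmersion Φ) (hM : M.IsMPolyfold) (hW : IsOpen W)
    (hσ : M.IsVectorField W σ) (hτ : M.IsVectorField W τ) {p : M.E.X 2} (hp : p ∈ M.pts 2)
    (hpW : M.E.ι 1 p ∈ W) :
    scDeriv M.E (ScScale.const V) univ Φ (M.E.ι 1 p) (M.bracket W σ τ 0 p) =
      scDeriv M.E.shift (ScScale.const V) (M.pre W) (flatten Φ τ) p (σ 1 p) -
      scDeriv M.E.shift (ScScale.const V) (M.pre W) (flatten Φ σ) p (τ 1 p) :=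
  (hΦ.tangent_snd hM _ _).symm.trans (hσ.apply_bracket hM hW hτ
    (isTangentMap_scTangentMap (hΦ.smooth 1)) (hΦ.isTangentMap_tangent hM) hp hpW)

/-- A constant operator L commutes with differentiation. This is the only place where it matters
that the tensor does not depend on the point in the coordinates given by Φ. -/
theorem scDeriv_flatten_of_eq (hΦ : M.IsImmersion Φ) (hM : M.IsMPolyfold) (hW : IsOpen W)
    (hσ : M.IsVectorField W σ) {L : V →L[ℝ] V}
    (h : ∀ q ∈ M.pts 1, q ∈ W → scDeriv M.E (ScScale.const V) univ Φ q (τ 0 q) =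
      L (scDeriv M.E (ScScale.const V) univ Φ q (σ 0 q)))
    {p : M.E.X 2} (hp : p ∈ M.pts 2) (hpW : M.E.ι 1 p ∈ W) (v : M.E.X 1) :
    scDeriv M.E.shift (ScScale.const V) (M.pre W) (flatten Φ τ) p v =
      L (scDeriv M.E.shift (ScScale.const V) (M.pre W) (flatten Φ σ) p v) := by
  have hpU := hM.mem_pre_of_mem hp hpW
  have h1 := hΦ.hasScDerivAt_flatten hM hW hσ hp hpW
  set A := scDeriv M.E.shift (ScScale.const V) (M.pre W) (flatten Φ σ) p
  have h2 : HasScDerivAt M.E.shift (ScScale.const V) (M.pre W)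
      (fun m x => L (flatten Φ σ m x)) p (L.comp A) := by
    refine ((L.isBigO_comp _ _).trans_isLittleO h1).congr_left fun h => ?_
    simp only [map_sub, ContinuousLinearMap.comp_apply]
  have h3 : HasScDerivAt M.E.shift (ScScale.const V) (M.pre W) (flatten Φ τ) p (L.comp A) := by
    refine h2.congr hpU fun x hx => ?_
    rw [hΦ.flatten_zero hM, hΦ.flatten_zero hM, h _ (mem_range_self _) hx]
  rw [h3.scDeriv_eq hM.scBanach.shift (hM.isOpen_pre hW) hpU]
  rfl

variable {J : ScFun M.E.tangent M.E.tangent} {J₀ : V →L[ℝ] V}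

/-- Under DΦ the brackets become derivatives of flattened fields and each J becomes J₀, which can be
pulled out of every derivative. The eight resulting terms cancel by J₀² = -1, and injectivity of DΦ
on tangent vectors concludes. -/
theorem nijenhuisVanishes (hΦ : M.IsImmersion Φ) (hM : M.IsMPolyfold) (hJ : M.IsTensor11 J)
    (hJ1 : ∀ m y, (J m y).1 = y.1) (hJ0 : ∀ v, J₀ (J₀ v) = -v)
    (hJΦ : ∀ p ∈ M.pts 1, ∀ v ∈ M.tangentSpace p,
      scDeriv M.E (ScScale.const V) univ Φ p (M.fib J p v) =
        J₀ (scDeriv M.E (ScScale.const V) univ Φ p v)) : M.NijenhuisVanishes J := by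
  intro W hW σ τ hσ hτ p hp hpW
  have hp1 := hM.ι_mem_pts hp
  have hσJ := hσ.applyJ hM hW hJ hJ1
  have hτJ := hτ.applyJ hM hW hJ hJ1
  have m1 := hσ.bracket_mem hM hW hτ hp hpW
  have m2 := hσ.bracket_mem hM hW hτJ hp hpW
  have m3 := hσJ.bracket_mem hM hW hτ hp hpW
  have m4 := hσJ.bracket_mem hM hW hτJ hp hpW
  have key : ∀ {ρ : ScFun M.E.shift M.E}, M.IsVectorField W ρ → ∀ v : M.E.X 1,
      scDeriv M.E.shift (ScScale.const V) (M.pre W) (flatten Φ (M.applyJ J ρ)) p v =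
        J₀ (scDeriv M.E.shift (ScScale.const V) (M.pre W) (flatten Φ ρ) p v) :=
    fun {ρ} hρ v => hΦ.scDeriv_flatten_of_eq hM hW hρ
      (fun q hq hqW => hJΦ q hq _ (hρ.2 q hq hqW)) hp hpW v
  refine hΦ.injective _ hp1 _ (sub_mem (add_mem (add_mem m1 (hJ.mem _ hp1 _ m2))
    (hJ.mem _ hp1 _ m3)) m4) ?_
  rw [nijenhuis, map_sub, map_add, map_add, hJΦ _ hp1 _ m2, hJΦ _ hp1 _ m3,
    hΦ.scDeriv_bracket hM hW hσ hτ hp hpW, hΦ.scDeriv_bracket hM hW hσ hτJ hp hpW,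
    hΦ.scDeriv_bracket hM hW hσJ hτ hp hpW, hΦ.scDeriv_bracket hM hW hσJ hτJ hp hpW]
  simp only [key hσ, key hτ, map_sub, hJ0]
  abel

/-- For a field a + ib of type (1,0) the flattened parts satisfy a = J₀b, and so do their
derivatives. Substituting this in the flattened brackets makes their real and imaginary parts obey
the same relations. -/
theorem isIntegrable (hΦ : M.IsImmersion Φ) (hM : M.IsMPolyfold) (hJ : M.IsTensor11 J)
    (hJ0 : ∀ v, J₀ (J₀ v) = -v)
    (hJΦ : ∀ p ∈ M.pts 1, ∀ v ∈ M.tangentSpace p,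
      scDeriv M.E (ScScale.const V) univ Φ p (M.fib J p v) =
        J₀ (scDeriv M.E (ScScale.const V) univ Φ p v)) : M.IsIntegrable J := by
  rintro W hW a b c d ⟨ha, hb, hab⟩ ⟨hc, hd, hcd⟩
  have hac := ha.bracket hM hW hc
  have hbd := hb.bracket hM hW hd
  have had := ha.bracket hM hW hd
  have hbc := hb.bracket hM hW hc
  refine ⟨hac.sub hM hW hbd, had.add hM hW hbc, fun p hp hpW => ?_⟩
  have hp1 := hM.ι_mem_pts hp
  have m1 : M.bracket W a c 0 p - M.bracket W b d 0 p ∈ M.tangentSpace (M.E.ι 1 p) :=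
    sub_mem (hac.2 p hp hpW) (hbd.2 p hp hpW)
  have m2 : M.bracket W a d 0 p + M.bracket W b c 0 p ∈ M.tangentSpace (M.E.ι 1 p) :=
    add_mem (had.2 p hp hpW) (hbc.2 p hp hpW)
  have key : ∀ {e f : ScFun M.E.shift M.E}, M.IsVectorField W e → M.IsVectorField W f →
      (∀ p ∈ M.pts 1, p ∈ W → M.fib J p (e 0 p) = -f 0 p ∧ M.fib J p (f 0 p) = e 0 p) →
      ∀ v : M.E.X 1, scDeriv M.E.shift (ScScale.const V) (M.pre W) (flatten Φ e) p v =
        J₀ (scDeriv M.E.shift (ScScale.const V) (M.pre W) (flatten Φ f) p v) :=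
    fun {e f} he hf hef v => hΦ.scDeriv_flatten_of_eq hM hW hf
      (fun q hq hqW => by rw [← hJΦ q hq _ (hf.2 q hq hqW), (hef q hq hqW).2]) hp hpW v
  constructor
  · refine eq_neg_of_add_eq_zero_left ?_
    refine hΦ.injective _ hp1 _ (add_mem (hJ.mem _ hp1 _ m1) m2) ?_
    rw [map_add, map_add, hJΦ _ hp1 _ m1, map_sub,
      hΦ.scDeriv_bracket hM hW ha hc hp hpW, hΦ.scDeriv_bracket hM hW hb hd hp hpW,
      hΦ.scDeriv_bracket hM hW ha hd hp hpW, hΦ.scDeriv_bracket hM hW hb hc hp hpW]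
    simp only [key ha hb hab, key hc hd hcd, map_sub, hJ0]
    abel
  · refine sub_eq_zero.1 ?_
    refine hΦ.injective _ hp1 _ (sub_mem (hJ.mem _ hp1 _ m2) m1) ?_
    rw [map_sub, map_sub, hJΦ _ hp1 _ m2, map_add,
      hΦ.scDeriv_bracket hM hW ha hc hp hpW, hΦ.scDeriv_bracket hM hW hb hd hp hpW,
      hΦ.scDeriv_bracket hM hW ha hd hp hpW, hΦ.scDeriv_bracket hM hW hb hc hp hpW]
    simp only [key ha hb hab, key hc hd hcd, map_sub, map_add, hJ0]
    abel

/-- As b is constant, differentiating ω(σ, τ) gives two terms by the product rule. The six terms so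
obtained cancel against the six coming from the brackets, up to the antisymmetry of b. -/
theorem isClosedForm (hΦ : M.IsImmersion Φ) (hM : M.IsMPolyfold)
    {Ω : M.E.X 1 → M.E.X 0 → M.E.X 0 → ℝ} (b : V →L[ℝ] V →L[ℝ] ℝ) (hb : ∀ u v, b u v = -b v u)
    (hΩ : ∀ p ∈ M.pts 1, ∀ v ∈ M.tangentSpace p, ∀ w ∈ M.tangentSpace p, Ω p v w =
      b (scDeriv M.E (ScScale.const V) univ Φ p v) (scDeriv M.E (ScScale.const V) univ Φ p w)) :
    M.IsClosedForm Ω := by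
  intro W hW σ₀ σ₁ σ₂ h0 h1 h2 p hp hpW
  have hp1 := hM.ι_mem_pts hp
  have hpU := hM.mem_pre_of_mem hp hpW
  have key : ∀ {σ τ : ScFun M.E.shift M.E}, M.IsVectorField W σ → M.IsVectorField W τ →
      ∀ v : M.E.X 1, M.funDeriv W (fun q => Ω q (σ 0 q) (τ 0 q)) p v =
        b (scDeriv M.E.shift (ScScale.const V) (M.pre W) (flatten Φ σ) p v)
          (scDeriv M.E (ScScale.const V) univ Φ (M.E.ι 1 p) (τ 0 (M.E.ι 1 p))) +
        b (scDeriv M.E (ScScale.const V) univ Φ (M.E.ι 1 p) (σ 0 (M.E.ι 1 p)))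
          (scDeriv M.E.shift (ScScale.const V) (M.pre W) (flatten Φ τ) p v) := by
    intro σ τ hσ hτ v
    have dσ := (hΦ.hasScDerivAt_flatten hM hW hσ hp hpW).hasFDerivAt hM.scBanach.shift
      (hM.isOpen_pre hW) hpU
    have dτ := (hΦ.hasScDerivAt_flatten hM hW hτ hp hpW).hasFDerivAt hM.scBanach.shift
      (hM.isOpen_pre hW) hpU
    set A := scDeriv M.E.shift (ScScale.const V) (M.pre W) (flatten Φ σ) p
    set B := scDeriv M.E.shift (ScScale.const V) (M.pre W) (flatten Φ τ) p
    have hval : ∀ ρ : ScFun M.E.shift M.E, flatten Φ ρ 0 (M.E.ι 1 p) =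
        scDeriv M.E (ScScale.const V) univ Φ (M.E.ι 1 p) (ρ 0 (M.E.ι 1 p)) := fun ρ => by
      rw [hΦ.flatten_zero hM, hM.r_eq_self hp1]
    have d1 := (b.isBoundedBilinearMap.hasFDerivAt (flatten Φ σ 0 (M.E.ι 1 p),
      flatten Φ τ 0 (M.E.ι 1 p))).comp p (dσ.prodMk dτ)
    have d2 : HasScDerivAt M.E.shift (ScScale.const ℝ) (M.pre W)
        (fun m x => b (flatten Φ σ m x) (flatten Φ τ m x)) p
        ((b (flatten Φ σ 0 (M.E.ι 1 p))).comp B + (b.flip (flatten Φ τ 0 (M.E.ι 1 p))).comp A) := by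
      refine HasScDerivAt.of_hasFDerivAt hM.scBanach.shift (d1.congr_fderiv ?_)
      ext u
      rfl
    have d3 : HasScDerivAt M.E.shift (ScScale.const ℝ) (M.pre W)
        (fun m x => (fun q => Ω q (σ 0 q) (τ 0 q)) (M.E.shift.incl m (M.r (m + 1) x))) p
        ((b (flatten Φ σ 0 (M.E.ι 1 p))).comp B + (b.flip (flatten Φ τ 0 (M.E.ι 1 p))).comp A) := by
      refine d2.congr hpU fun x hx => ?_
      rw [hΦ.flatten_zero hM, hΦ.flatten_zero hM]
      exact hΩ _ (mem_range_self _) _ (hσ.2 _ (mem_range_self _) hx) _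
        (hτ.2 _ (mem_range_self _) hx)
    rw [funDeriv, d3.scDeriv_eq hM.scBanach.shift (hM.isOpen_pre hW) hpU, hval, hval]
    exact add_comm _ _
  have hmem : ∀ {σ : ScFun M.E.shift M.E}, M.IsVectorField W σ →
      σ 0 (M.E.ι 1 p) ∈ M.tangentSpace (M.E.ι 1 p) := fun hσ => hσ.2 _ hp1 hpW
  rw [extDeriv₂, key h1 h2, key h0 h2, key h0 h1,
    hΩ _ hp1 _ (h0.bracket_mem hM hW h1 hp hpW) _ (hmem h2),
    hΩ _ hp1 _ (h0.bracket_mem hM hW h2 hp hpW) _ (hmem h1),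
    hΩ _ hp1 _ (h1.bracket_mem hM hW h2 hp hpW) _ (hmem h0),
    hΦ.scDeriv_bracket hM hW h0 h1 hp hpW, hΦ.scDeriv_bracket hM hW h0 h2 hp hpW,
    hΦ.scDeriv_bracket hM hW h1 h2 hp hpW]
  simp only [map_sub, sub_apply]
  rw [hb (scDeriv M.E (ScScale.const V) univ Φ (M.E.ι 1 p) (σ₁ 0 (M.E.ι 1 p))),
    hb (scDeriv M.E (ScScale.const V) univ Φ (M.E.ι 1 p) (σ₀ 0 (M.E.ι 1 p))),
    hb (scDeriv M.E (ScScale.const V) univ Φ (M.E.ι 1 p) (σ₀ 0 (M.E.ι 1 p)))]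
  ring

end IsImmersion

end ScRetract

/-! ### Smooth functions with compact support -/

namespace CcFun

variable (φ ψ χ : CcFun)

theorem ext_toFun {φ ψ : CcFun} (h : φ.toFun = ψ.toFun) : φ = ψ := by
  cases φ; cases ψ; cases h; rfl

theorem continuous : Continuous φ.toFun := φ.smooth.continuous

theorem hasDerivAt (s : ℝ) : HasDerivAt φ.toFun (φ.deriv.toFun s) s :=
  (φ.smooth.differentiable (by simp) s).hasDerivAt

theorem iter_deriv (i : ℕ) : φ.deriv.iter i = φ.iter (i + 1) := by
  induction i with
  | zero => rfl
  | succ i ih =>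
    change (φ.deriv.iter i).deriv = (φ.iter (i + 1)).deriv
    rw [ih]

theorem exists_bound : ∃ B, ∀ s, |φ.toFun s| ≤ B := by
  obtain ⟨B, hB⟩ := φ.continuous.bounded_above_of_compact_support φ.compact
  exact ⟨B, hB⟩

theorem integrable : Integrable φ.toFun := φ.continuous.integrable_of_hasCompactSupport φ.compact

/-- The product. -/
noncomputable def mul : CcFun where
  toFun := fun s => φ.toFun s * ψ.toFun s
  smooth := φ.smooth.mul ψ.smooth
  compact := φ.compact.mul_right

theorem deriv_mul (s : ℝ) : (φ.mul ψ).deriv.toFun s =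
    φ.deriv.toFun s * ψ.toFun s + φ.toFun s * ψ.deriv.toFun s :=
  ((φ.mul ψ).hasDerivAt s).unique ((φ.hasDerivAt s).mul (ψ.hasDerivAt s))

/-- The difference. -/
noncomputable def sub : CcFun where
  toFun := fun s => φ.toFun s - ψ.toFun s
  smooth := φ.smooth.sub ψ.smooth
  compact := φ.compact.sub ψ.compact

/-- The multiple by a constant. -/
noncomputable def smul (c : ℝ) : CcFun where
  toFun := fun s => c * φ.toFun s
  smooth := contDiff_const.mul φ.smooth
  compact := φ.compact.mul_left

theorem iter_sub (i : ℕ) : (φ.sub ψ).iter i = (φ.iter i).sub (ψ.iter i) := by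
  induction i with
  | zero => rfl
  | succ i ih =>
    change ((φ.sub ψ).iter i).deriv = _
    rw [ih]
    exact ext_toFun (funext fun s => (((φ.iter i).sub (ψ.iter i)).hasDerivAt s).unique
      (((φ.iter i).hasDerivAt s).sub ((ψ.iter i).hasDerivAt s)))

theorem iter_smul (c : ℝ) (i : ℕ) : (φ.smul c).iter i = (φ.iter i).smul c := by
  induction i with
  | zero => rfl
  | succ i ih =>
    change ((φ.smul c).iter i).deriv = _
    rw [ih]
    exact ext_toFun (funext fun s => (((φ.iter i).smul c).hasDerivAt s).unique
      (((φ.iter i).hasDerivAt s).const_mul c))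

theorem iter_shift (T : ℝ) (i : ℕ) : (φ.shift T).iter i = (φ.iter i).shift T := by
  induction i with
  | zero => rfl
  | succ i ih =>
    change ((φ.shift T).iter i).deriv = _
    rw [ih]
    refine ext_toFun (funext fun s => (((φ.iter i).shift T).hasDerivAt s).unique ?_)
    have h := ((φ.iter i).hasDerivAt (s + T)).comp s ((hasDerivAt_id s).add_const T)
    rw [mul_one] at h
    exact h

/-- The function `φ(c ·)`. -/
noncomputable def dilate (c : ℝ) (hc : c ≠ 0) : CcFun where
  toFun := fun s => φ.toFun (c * s)
  smooth := φ.smooth.comp (contDiff_const.mul contDiff_id)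
  compact := φ.compact.comp_homeomorph (Homeomorph.mulLeft₀ c hc)

theorem iter_dilate (c : ℝ) (hc : c ≠ 0) (i : ℕ) (s : ℝ) :
    ((φ.dilate c hc).iter i).toFun s = c ^ i * (φ.iter i).toFun (c * s) := by
  induction i generalizing s with
  | zero =>
    change φ.toFun (c * s) = c ^ 0 * φ.toFun (c * s)
    rw [pow_zero, one_mul]
  | succ i ih =>
    refine (((φ.dilate c hc).iter i).hasDerivAt s).unique ?_
    rw [show ((φ.dilate c hc).iter i).toFun = fun s => c ^ i * (φ.iter i).toFun (c * s) from
      funext ih]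
    have h := (((φ.iter i).hasDerivAt (c * s)).comp s ((hasDerivAt_id s).const_mul c)).const_mul
      (c ^ i)
    refine h.congr_deriv ?_
    change c ^ i * ((φ.iter i).deriv.toFun (c * s) * (c * 1)) =
      c ^ (i + 1) * (φ.iter i).deriv.toFun (c * s)
    ring

theorem support_iter_subset (i : ℕ) : tsupport (φ.iter i).toFun ⊆ tsupport φ.toFun := by
  induction i with
  | zero => exact subset_rfl
  | succ i ih => exact (tsupport_deriv_subset (𝕜 := ℝ)).trans ih

end CcFun

/-! ### Weak derivatives of functions -/

/-- `v` is the weak derivative of `u`. -/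
def HasWeakDeriv (u v : ℝ → ℝ) : Prop :=
  ∀ φ : CcFun, ∫ s, u s * φ.deriv.toFun s = -∫ s, v s * φ.toFun s

theorem MeasureTheory.LocallyIntegrable.integrable_mul_cc {u : ℝ → ℝ} (hu : LocallyIntegrable u) (φ : CcFun) :
    Integrable fun s => u s * φ.toFun s := by
  have := hu.integrable_smul_right_of_hasCompactSupport φ.continuous φ.compact
  exact this

theorem HasWeakDeriv.add {u v u' v' : ℝ → ℝ} (h : HasWeakDeriv u v) (h' : HasWeakDeriv u' v')
    (hu : LocallyIntegrable u) (hv : LocallyIntegrable v) (hu' : LocallyIntegrable u')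
    (hv' : LocallyIntegrable v') :
    HasWeakDeriv (fun s => u s + u' s) (fun s => v s + v' s) := fun φ => by
  simp only [add_mul]
  rw [integral_add (hu.integrable_mul_cc _) (hu'.integrable_mul_cc _),
    integral_add (hv.integrable_mul_cc _) (hv'.integrable_mul_cc _), h, h', neg_add]

/-- The weak derivative of u is tested against χφ, and the product rule for χφ is rearranged. -/
theorem HasWeakDeriv.cc_mul {u v : ℝ → ℝ} (h : HasWeakDeriv u v) (hu : LocallyIntegrable u)
    (hv : LocallyIntegrable v) (χ : CcFun) :
    HasWeakDeriv (fun s => χ.toFun s * u s) (fun s => χ.deriv.toFun s * u s + χ.toFun s * v s) :=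
  fun φ => by
  have h1 := h (χ.mul φ)
  simp only [CcFun.deriv_mul] at h1
  have e1 : (fun s => u s * (χ.deriv.toFun s * φ.toFun s + χ.toFun s * φ.deriv.toFun s)) =
      fun s => u s * (χ.deriv.mul φ).toFun s + u s * (χ.mul φ.deriv).toFun s :=
    funext fun s => mul_add _ _ _
  rw [e1, integral_add (hu.integrable_mul_cc _) (hu.integrable_mul_cc _)] at h1
  have e2 : (fun s => (χ.deriv.toFun s * u s + χ.toFun s * v s) * φ.toFun s) =
      fun s => u s * (χ.deriv.mul φ).toFun s + v s * (χ.mul φ).toFun s :=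
    funext fun s => by simp only [CcFun.mul]; ring
  have e3 : (fun s => χ.toFun s * u s * φ.deriv.toFun s) =
      fun s => u s * (χ.mul φ.deriv).toFun s := funext fun s => by simp only [CcFun.mul]; ring
  rw [e2, e3, integral_add (hu.integrable_mul_cc _) (hv.integrable_mul_cc _)]
  linarith

/-- The derivative of order `i` of the product of `χ` and `f 0`, where `f i` is the derivative of
`f 0` of order `i`. -/
noncomputable def leibniz (χ : CcFun) (f : ℕ → ℝ → ℝ) : ℕ → ℝ → ℝ
  | 0 => fun s => χ.toFun s * f 0 s
  | i + 1 => fun s => leibniz χ.deriv f i s + leibniz χ (fun j => f (j + 1)) i s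

theorem LocallyIntegrable.leibniz {f : ℕ → ℝ → ℝ} (hf : ∀ i, LocallyIntegrable (f i)) (χ : CcFun)
    (i : ℕ) : LocallyIntegrable (leibniz χ f i) := by
  induction i generalizing f χ with
  | zero =>
    exact (((hf 0).integrable_mul_cc χ).congr
      (Eventually.of_forall fun s => mul_comm _ _)).locallyIntegrable
  | succ i ih => exact (ih hf χ.deriv).add (ih (fun j => hf (j + 1)) χ)

theorem HasWeakDeriv.leibniz {f : ℕ → ℝ → ℝ} (hf : ∀ i, LocallyIntegrable (f i)) (χ : CcFun)
    (i : ℕ) (h : ∀ j ≤ i, HasWeakDeriv (f j) (f (j + 1))) :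
    HasWeakDeriv (leibniz χ f i) (leibniz χ f (i + 1)) := by
  induction i generalizing f χ with
  | zero => exact (h 0 le_rfl).cc_mul (hf 0) (hf 1) χ
  | succ i ih =>
    exact (ih hf χ.deriv fun j hj => h j (by omega)).add
      (ih (fun j => hf (j + 1)) χ fun j hj => h (j + 1) (by omega))
      (LocallyIntegrable.leibniz hf _ _) (LocallyIntegrable.leibniz hf _ _)
      (LocallyIntegrable.leibniz (fun j => hf (j + 1)) _ _)
      (LocallyIntegrable.leibniz (fun j => hf (j + 1)) _ _)

theorem leibniz_eq_zero {f : ℕ → ℝ → ℝ} {χ : CcFun} {K : Set ℝ} (hK : tsupport χ.toFun ⊆ K)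
    {s : ℝ} (hs : s ∉ K) (i : ℕ) : leibniz χ f i s = 0 := by
  induction i generalizing f χ with
  | zero => simp [leibniz, image_eq_zero_of_notMem_tsupport fun h => hs (hK h)]
  | succ i ih =>
    simp [leibniz, ih hK, ih (χ := χ.deriv) ((tsupport_deriv_subset (𝕜 := ℝ)).trans hK)]

/-- The recursion for `leibniz` doubles the number of summands at each order, which gives the factor
2^i; keeping binomial coefficients is not needed for a dominating function. -/
theorem abs_leibniz_le {f : ℕ → ℝ → ℝ} {χ : CcFun} {s B : ℝ} (i : ℕ)
    (hB : ∀ j ≤ i, |(χ.iter j).toFun s| ≤ B) :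
    |leibniz χ f i s| ≤ 2 ^ i * B * ∑ j ∈ Finset.range (i + 1), |f j s| := by
  induction i generalizing f χ with
  | zero =>
    simp only [leibniz, abs_mul, pow_zero, one_mul, zero_add, Finset.range_one,
      Finset.sum_singleton]
    exact mul_le_mul_of_nonneg_right (hB 0 le_rfl) (abs_nonneg _)
  | succ i ih =>
    have hB0 : 0 ≤ B := (abs_nonneg _).trans (hB 0 (Nat.zero_le _))
    have h1 := ih (f := f) (χ := χ.deriv) fun j hj => by
      rw [CcFun.iter_deriv]; exact hB (j + 1) (by omega)
    have h2 := ih (f := fun j => f (j + 1)) (χ := χ) fun j hj => hB j (by omega)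
    have h3 : ∑ j ∈ Finset.range (i + 1), |f j s| ≤ ∑ j ∈ Finset.range (i + 2), |f j s| := by
      rw [Finset.sum_range_succ _ (i + 1)]
      linarith [abs_nonneg (f (i + 1) s)]
    have h4 : ∑ j ∈ Finset.range (i + 1), |f (j + 1) s| ≤
        ∑ j ∈ Finset.range (i + 2), |f j s| := by
      rw [Finset.sum_range_succ' _ (i + 1)]
      linarith [abs_nonneg (f 0 s)]
    have hc : 0 ≤ 2 ^ i * B := by positivity
    calc |leibniz χ f (i + 1) s|
        ≤ |leibniz χ.deriv f i s| + |leibniz χ (fun j => f (j + 1)) i s| := abs_add_le _ _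
      _ ≤ 2 ^ i * B * ∑ j ∈ Finset.range (i + 2), |f j s| +
          2 ^ i * B * ∑ j ∈ Finset.range (i + 2), |f j s| :=
        add_le_add (h1.trans (mul_le_mul_of_nonneg_left h3 hc))
          (h2.trans (mul_le_mul_of_nonneg_left h4 hc))
      _ = _ := by ring

/-- Where all derivatives of χ vanish, only the summand without a derivative on χ survives. It is
used in the interior of the region where a cutoff is 1. -/
theorem leibniz_eq_mul {f : ℕ → ℝ → ℝ} {χ : CcFun} {s : ℝ}
    (h : ∀ j, (χ.iter (j + 1)).toFun s = 0) (i : ℕ) : leibniz χ f i s = χ.toFun s * f i s := by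
  induction i generalizing f χ with
  | zero => rfl
  | succ i ih =>
    have h1 := ih (f := f) (χ := χ.deriv) fun j => by rw [CcFun.iter_deriv]; exact h (j + 1)
    have h2 : χ.deriv.toFun s = 0 := h 0
    simp only [leibniz, h1, ih h, h2, zero_mul, zero_add]

/-! ### Mollification -/

section Mollify

open ContinuousLinearMap

/-- The convolution of a smooth function with compact support and a function with compact
support. -/
noncomputable def mollify (ρ : CcFun) (u : ℝ → ℝ) (hu : LocallyIntegrable u)
    (hc : HasCompactSupport u) : CcFun where
  toFun := convolution ρ.toFun u (lsmul ℝ ℝ) volume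
  smooth := ρ.compact.contDiff_convolution_left _ ρ.smooth hu
  compact := ρ.compact.convolution _ hc

/-- For fixed x the function t ↦ ρ(x - t) is a test function with derivative -ρ'(x - t), so the
definition of the weak derivative moves the derivative from ρ to u. -/
theorem convolution_deriv_eq {u v : ℝ → ℝ} (h : HasWeakDeriv u v) (ρ : CcFun) (x : ℝ) :
    convolution ρ.deriv.toFun u (lsmul ℝ ℝ) volume x =
      convolution ρ.toFun v (lsmul ℝ ℝ) volume x := by
  rw [convolution_eq_swap, convolution_eq_swap]
  let η : CcFun :=
    { toFun := fun t => ρ.toFun (x - t)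
      smooth := ρ.smooth.comp (contDiff_const.sub contDiff_id)
      compact := ρ.compact.comp_homeomorph (Homeomorph.subLeft x) }
  have hη : ∀ t, η.deriv.toFun t = -ρ.deriv.toFun (x - t) := fun t => by
    refine (η.hasDerivAt t).unique ?_
    have h := (ρ.hasDerivAt (x - t)).comp t ((hasDerivAt_id t).const_sub x)
    rw [mul_neg_one] at h
    exact h
  have h1 := h η
  simp only [hη, mul_neg, integral_neg, neg_inj] at h1
  simp only [lsmul_apply, smul_eq_mul]
  simp only [mul_comm] at h1 ⊢
  exact h1

theorem iter_mollify {u : ℕ → ℝ → ℝ} (hu : ∀ i, LocallyIntegrable (u i))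
    (hc : ∀ i, HasCompactSupport (u i)) {m : ℕ} (h : ∀ i < m, HasWeakDeriv (u i) (u (i + 1)))
    (ρ : CcFun) {i : ℕ} (hi : i ≤ m) :
    (mollify ρ (u 0) (hu 0) (hc 0)).iter i = mollify ρ (u i) (hu i) (hc i) := by
  induction i with
  | zero => rfl
  | succ i ih =>
    change ((mollify ρ (u 0) (hu 0) (hc 0)).iter i).deriv = _
    rw [ih (by omega)]
    refine CcFun.ext_toFun (funext fun s => ?_)
    refine ((mollify ρ (u i) (hu i) (hc i)).hasDerivAt s).unique ?_
    have h1 := ρ.compact.hasDerivAt_convolution_left (lsmul ℝ ℝ) (μ := volume)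
      (ρ.smooth.of_le (by simp)) (hu i) s
    exact h1.congr_deriv (convolution_deriv_eq (h i (by omega)) ρ s)

/-- Fubini turns the pairing with a mollification into the integral of ρ against the correlation t ↦
∫ u(x - t)G(x) dx. Weak information for all ρ thus becomes information on a continuous function of
t. -/
theorem integral_mollify_mul {u G : ℝ → ℝ} (hu : Integrable u) (hc : HasCompactSupport u)
    (hG : Integrable G) (ρ : CcFun) :
    ∫ x, (mollify ρ u hu.locallyIntegrable hc).toFun x * G x =
      ∫ t, ρ.toFun t * ∫ x, u (x - t) * G x := by
  have h1 : Integrable (fun p : ℝ × ℝ => G p.2 * u (p.2 - p.1)) (volume.prod volume) := by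
    have := hG.convolution_integrand (lsmul ℝ ℝ) (hu.comp_neg) (μ := volume)
    simpa using this
  have h2 : Integrable (fun p : ℝ × ℝ => ρ.toFun p.1 * (u (p.2 - p.1) * G p.2))
      (volume.prod volume) := by
    obtain ⟨B, hB⟩ := ρ.exists_bound
    have h3 := h1.bdd_mul (f := fun p : ℝ × ℝ => ρ.toFun p.1) (c := B)
      (ρ.continuous.comp continuous_fst).aestronglyMeasurable
      (Eventually.of_forall fun p => hB p.1)
    refine h3.congr (Eventually.of_forall fun p => ?_)
    simp only
    ring
  calc ∫ x, (mollify ρ u hu.locallyIntegrable hc).toFun x * G x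
      = ∫ x, ∫ t, ρ.toFun t * (u (x - t) * G x) := by
        refine integral_congr_ae (Eventually.of_forall fun x => ?_)
        simp only [mollify, convolution_def, lsmul_apply, smul_eq_mul]
        rw [← integral_mul_const]
        simp only [mul_assoc]
    _ = ∫ t, ∫ x, ρ.toFun t * (u (x - t) * G x) := integral_integral_swap h2.swap
    _ = _ := by simp only [integral_const_mul]

/-- The correlation of square integrable functions is continuous. -/
theorem continuous_integral_translate_mul {u G : ℝ → ℝ} (hu : MemLp u 2 volume)
    (hG : MemLp G 2 volume) : Continuous fun t : ℝ => ∫ x, u (x - t) * G x := by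
  let g : C(ℝ, C(ℝ, ℝ)) := ContinuousMap.curry ⟨fun p : ℝ × ℝ => p.2 - p.1, by fun_prop⟩
  have hg : ∀ t, MeasurePreserving (g t) volume volume := fun t =>
    measurePreserving_sub_right volume t
  have h1 : Continuous fun t => Lp.compMeasurePreserving (g t) (hg t) (hu.toLp u) :=
    Continuous.compMeasurePreservingLp continuous_const g.continuous hg (by simp)
  have h2 : Continuous fun t => inner ℝ (hG.toLp G)
      (Lp.compMeasurePreserving (g t) (hg t) (hu.toLp u)) := continuous_const.inner h1
  refine h2.congr fun t => ?_
  rw [L2.inner_def]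
  refine integral_congr_ae ?_
  have e1 : (fun x => (Lp.compMeasurePreserving (g t) (hg t) (hu.toLp u) : ℝ → ℝ) x) =ᵐ[volume]
      fun x => u (x - t) :=
    (Lp.coeFn_compMeasurePreserving _ (hg t)).trans
      ((hg t).quasiMeasurePreserving.ae_eq_comp hu.coeFn_toLp)
  filter_upwards [e1, hG.coeFn_toLp] with x h1 h2
  rw [h1, h2]
  rfl

/-- If the pairing with all mollifications by functions supported near the origin vanishes, then so
does the pairing itself. -/
theorem sum_integral_mul_eq_zero_of_mollify {m : ℕ} {u G : ℕ → ℝ → ℝ}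
    (hu : ∀ i, MemLp (u i) 2 volume) (hc : ∀ i, HasCompactSupport (u i))
    (hG : ∀ i, MemLp (G i) 2 volume) (hGi : ∀ i, Integrable (G i)) (hui : ∀ i, Integrable (u i))
    (h : ∀ ρ : CcFun, tsupport ρ.toFun ⊆ Metric.ball 0 1 → ∑ i ∈ Finset.range m,
      ∫ x, (mollify ρ (u i) (hui i).locallyIntegrable (hc i)).toFun x * G i x = 0) :
    ∑ i ∈ Finset.range m, ∫ x, u i x * G i x = 0 := by
  -- The hypothesis says that c integrates to zero against every ρ supported in the unit ball. So c
  -- = 0 almost everywhere there, and by continuity c(0) = 0, which is the claim.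
  let c : ℝ → ℝ := fun t => ∑ i ∈ Finset.range m, ∫ x, u i (x - t) * G i x
  have hcont : Continuous c :=
    continuous_finsetSum _ fun i _ => continuous_integral_translate_mul (hu i) (hG i)
  have h1 : ∀ᵐ t, t ∈ Metric.ball (0 : ℝ) 1 → c t = 0 := by
    refine Metric.isOpen_ball.ae_eq_zero_of_integral_contDiff_smul_eq_zero
      (hcont.locallyIntegrable.locallyIntegrableOn _) fun ρ hρ hρc hρs => ?_
    have h2 := h ⟨ρ, hρ, hρc⟩ hρs
    simp only [integral_mollify_mul (hui _) (hc _) (hGi _)] at h2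
    rw [← integral_finsetSum] at h2
    · simpa only [smul_eq_mul, c, Finset.mul_sum] using h2
    · intro i _
      have := (continuous_integral_translate_mul (hu i) (hG i)).locallyIntegrable
        (μ := volume) |>.integrable_mul_cc ⟨ρ, hρ, hρc⟩
      simpa only [mul_comm] using this
  have h3 : EqOn c 0 (Metric.ball (0 : ℝ) 1) :=
    Measure.eqOn_open_of_ae_eq (μ := volume)
      ((ae_restrict_iff' Metric.isOpen_ball.measurableSet).2 h1) Metric.isOpen_ball
      hcont.continuousOn continuousOn_const
  simpa [c] using h3 (Metric.mem_ball_self one_pos)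

end Mollify

/-! ### Weighted Sobolev spaces as Hilbert spaces -/

namespace CcFun

/-- The sum. -/
noncomputable def add (φ ψ : CcFun) : CcFun where
  toFun := fun s => φ.toFun s + ψ.toFun s
  smooth := φ.smooth.add ψ.smooth
  compact := φ.compact.add ψ.compact

theorem iter_add (φ ψ : CcFun) (i : ℕ) : (φ.add ψ).iter i = (φ.iter i).add (ψ.iter i) := by
  induction i with
  | zero => rfl
  | succ i ih =>
    change ((φ.add ψ).iter i).deriv = _
    rw [ih]
    exact ext_toFun (funext fun s => (((φ.iter i).add (ψ.iter i)).hasDerivAt s).unique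
      (((φ.iter i).hasDerivAt s).add ((ψ.iter i).hasDerivAt s)))

end CcFun

namespace SobolevWeights

variable (w : SobolevWeights)

theorem μ_ac (m : ℕ) : w.μ m ≪ volume := withDensity_absolutelyContinuous _ _

theorem continuous_exponent (a : ℝ) : Continuous fun s => Real.exp (a * (s * w.β s)) := by
  have := w.β_smooth.continuous
  fun_prop

theorem integral_μ (m : ℕ) (f : ℝ → ℝ) :
    ∫ s, f s ∂w.μ m = ∫ s, Real.exp (w.δ m * (s * w.β s)) * f s := by
  change ∫ s, f s ∂volume.withDensity _ = _
  rw [integral_withDensity_eq_integral_toReal_smul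
    (w.continuous_exponent _).measurable.ennreal_ofReal (by simp)]
  simp only [ENNReal.toReal_ofReal (Real.exp_pos _).le, smul_eq_mul]

theorem inner_Lp (m : ℕ) (f g : Lp ℝ 2 (w.μ m)) :
    inner ℝ f g = ∫ s, Real.exp (w.δ m * (s * w.β s)) * (f s * g s) := by
  rw [L2.inner_def, ← integral_μ]
  exact integral_congr_ae (Eventually.of_forall fun s => mul_comm _ _)

/-- The function `φ` divided by the weight of level `m`. -/
noncomputable def unweight (m : ℕ) (φ : CcFun) : CcFun where
  toFun := fun s => Real.exp (-(w.δ m * (s * w.β s))) * φ.toFun s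
  smooth := (Real.contDiff_exp.comp
    (contDiff_const.mul (contDiff_id.mul w.β_smooth)).neg).mul φ.smooth
  compact := φ.compact.mul_left

theorem coeFn_toLp_cc (m : ℕ) (φ : CcFun) :
    ((w.memLp_cc m φ).toLp φ.toFun : ℝ → ℝ) =ᵐ[volume] φ.toFun :=
  (w.volume_ac m).ae_eq (MemLp.coeFn_toLp _)

/-- The pairing `f ↦ ∫ f φ`. -/
noncomputable def pairLp (m : ℕ) (φ : CcFun) : Lp ℝ 2 (w.μ m) →L[ℝ] ℝ :=
  innerSL ℝ ((w.memLp_cc m (w.unweight m φ)).toLp (w.unweight m φ).toFun)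

theorem pairLp_apply (m : ℕ) (φ : CcFun) (f : Lp ℝ 2 (w.μ m)) :
    w.pairLp m φ f = ∫ s, f s * φ.toFun s := by
  rw [pairLp, innerSL_apply_apply, inner_Lp]
  refine integral_congr_ae ((w.coeFn_toLp_cc m (w.unweight m φ)).mono fun s hs => ?_)
  simp only [hs]
  change _ * (Real.exp (-(w.δ m * (s * w.β s))) * φ.toFun s * f s) = _
  rw [← mul_assoc, ← mul_assoc, ← Real.exp_add, add_neg_cancel, Real.exp_zero, one_mul, mul_comm]

/-- Each weak derivative relation is an equation between two continuous functionals, since pairing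
with a test function is an inner product with the test function divided by the weight. -/
theorem isClosed_sobolev (m : ℕ) :
    IsClosed (w.sobolev m : Set (PiLp 2 (fun _ : Fin (m + 1) => Lp ℝ 2 (w.μ m)))) := by
  have h : (w.sobolev m : Set (PiLp 2 (fun _ : Fin (m + 1) => Lp ℝ 2 (w.μ m)))) =
      ⋂ i : Fin m, ⋂ φ : CcFun, {f | w.pairLp m φ.deriv (PiLp.proj 2 (𝕜 := ℝ) _ i.castSucc f) =
        -w.pairLp m φ (PiLp.proj 2 (𝕜 := ℝ) _ i.succ f)} := by
    ext f
    simp only [mem_iInter, pairLp_apply, mem_ofPred_eq, PiLp.proj_apply]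
    rfl
  rw [h]
  exact isClosed_iInter fun i => isClosed_iInter fun φ =>
    isClosed_eq (by fun_prop) (by fun_prop)

instance (m : ℕ) : CompleteSpace (w.sobolev m) := (w.isClosed_sobolev m).completeSpace_coe

/-- The weak derivative of order `i`. -/
noncomputable def comp (m : ℕ) (i : Fin (m + 1)) : w.sobolev m →L[ℝ] Lp ℝ 2 (w.μ m) :=
  (PiLp.proj 2 (𝕜 := ℝ) (fun _ : Fin (m + 1) => Lp ℝ 2 (w.μ m)) i).comp (w.sobolev m).subtypeL

theorem comp_apply (m : ℕ) (i : Fin (m + 1)) (f : w.sobolev m) : w.comp m i f = f.1 i := rfl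

theorem comp_ofCc (m : ℕ) (i : Fin (m + 1)) (φ : CcFun) : w.comp m i (w.ofCc m φ) =
    (w.memLp_cc m (φ.iter i)).toLp (φ.iter i).toFun := rfl

theorem norm_comp_le (m : ℕ) (i : Fin (m + 1)) (f : w.sobolev m) : ‖w.comp m i f‖ ≤ ‖f‖ :=
  PiLp.norm_apply_le f.1 i

theorem ext_comp {m : ℕ} {f g : w.sobolev m} (h : ∀ i, w.comp m i f = w.comp m i g) : f = g :=
  Subtype.ext (PiLp.ext h)

/-- The pairing `f ↦ ∫ f φ` on `W^{m,δ_m}`. -/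
noncomputable def pairCLM (m : ℕ) (φ : CcFun) : w.sobolev m →L[ℝ] ℝ :=
  (w.pairLp m φ).comp (w.comp m 0)

theorem pairCLM_apply (m : ℕ) (φ : CcFun) (f : w.sobolev m) : w.pairCLM m φ f = w.pair f φ :=
  w.pairLp_apply m φ _

theorem comp_sobolevIncl (m : ℕ) (i : Fin (m + 1)) (f : w.sobolev (m + 1)) :
    w.comp m i (w.sobolevIncl m f) = w.lower m (w.comp (m + 1) i.castSucc f) := rfl

theorem pair_sobolevIncl (m : ℕ) (φ : CcFun) (f : w.sobolev (m + 1)) :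
    w.pair (w.sobolevIncl m f) φ = w.pair f φ :=
  integral_congr_ae ((w.lower_coe m (f.1 0)).mono fun s hs => by
    change w.lower m (f.1 0) s * _ = _
    rw [hs])

theorem lower_toLp (m : ℕ) (φ : CcFun) :
    w.lower m ((w.memLp_cc (m + 1) φ).toLp φ.toFun) = (w.memLp_cc m φ).toLp φ.toFun := by
  refine Lp.ext ((w.μ_ac m).ae_eq ?_)
  exact ((w.lower_coe m _).trans (w.coeFn_toLp_cc (m + 1) φ)).trans (w.coeFn_toLp_cc m φ).symm

theorem sobolevIncl_ofCc (m : ℕ) (φ : CcFun) :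
    w.sobolevIncl m (w.ofCc (m + 1) φ) = w.ofCc m φ :=
  w.ext_comp fun i => by
    rw [comp_sobolevIncl, comp_ofCc, comp_ofCc, lower_toLp]
    rfl

theorem lower_injective (m : ℕ) : Function.Injective (w.lower m) := by
  intro f g h
  refine Lp.ext ((w.μ_ac (m + 1)).ae_eq ?_)
  have h1 := w.lower_coe m f
  rw [h] at h1
  exact h1.symm.trans (w.lower_coe m g)

/-- The inclusion drops the derivative of top order. If all the others vanish, the top one is a weak
derivative of 0, hence 0 by the fundamental lemma of the calculus of variations. -/
theorem sobolevIncl_injective (m : ℕ) : Function.Injective (w.sobolevIncl m) := by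
  refine (injective_iff_map_eq_zero _).2 fun f hf => w.ext_comp ?_
  have h1 : ∀ i : Fin (m + 1), w.comp (m + 1) i.castSucc f = 0 := fun i => by
    apply w.lower_injective m
    rw [← comp_sobolevIncl, hf, map_zero, map_zero]
  refine Fin.lastCases ?_ (fun i => by rw [h1, map_zero])
  rw [map_zero]
  have h2 : ∀ φ : CcFun, w.pairLp (m + 1) φ (w.comp (m + 1) (Fin.last (m + 1)) f) = 0 := fun φ => by
    have h := f.2 (Fin.last m) φ
    rw [← pairLp_apply, ← neg_eq_iff_eq_neg, ← comp_apply, h1, map_zero, neg_zero] at h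
    rw [pairLp_apply]
    exact h.symm
  refine Lp.ext ((w.μ_ac (m + 1)).ae_eq ?_)
  refine EventuallyEq.trans ?_ ((w.volume_ac (m + 1)).ae_eq (Lp.coeFn_zero _ _ _)).symm
  refine ae_eq_zero_of_integral_contDiff_smul_eq_zero ?_ fun φ hφ hc => ?_
  · exact (((Lp.memLp _).of_measure_le_smul ENNReal.ofReal_ne_top
      (w.volume_le (m + 1))).locallyIntegrable (by norm_num))
  · have h3 := h2 ⟨φ, hφ, hc⟩
    rw [pairLp_apply] at h3
    simpa only [smul_eq_mul, mul_comm] using h3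

theorem ofCc_add (m : ℕ) (φ ψ : CcFun) : w.ofCc m (φ.add ψ) = w.ofCc m φ + w.ofCc m ψ :=
  w.ext_comp fun i => by
    rw [map_add, comp_ofCc, comp_ofCc, comp_ofCc, ← MemLp.toLp_add]
    simp only [CcFun.iter_add]
    rfl

theorem ofCc_smul (m : ℕ) (c : ℝ) (φ : CcFun) : w.ofCc m (φ.smul c) = c • w.ofCc m φ :=
  w.ext_comp fun i => by
    rw [map_smul, comp_ofCc, comp_ofCc, ← MemLp.toLp_const_smul]
    simp only [CcFun.iter_smul]
    rfl

/-- The subspace of smooth functions with compact support. -/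
noncomputable def ccSubmodule (m : ℕ) : Submodule ℝ (w.sobolev m) where
  carrier := range (w.ofCc m)
  zero_mem' := ⟨CcFun.smul ⟨0, contDiff_const, HasCompactSupport.zero⟩ 0, by
    rw [ofCc_smul, zero_smul]⟩
  add_mem' := by
    rintro _ _ ⟨φ, rfl⟩ ⟨ψ, rfl⟩
    exact ⟨φ.add ψ, w.ofCc_add m φ ψ⟩
  smul_mem' := by
    rintro c _ ⟨φ, rfl⟩
    exact ⟨φ.smul c, w.ofCc_smul m c φ⟩

/-- The weak derivative of order `i` as a function, with value `0` for `m < i`. -/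
noncomputable def fn {m : ℕ} (f : w.sobolev m) (i : ℕ) : ℝ → ℝ :=
  if h : i < m + 1 then w.comp m ⟨i, h⟩ f else 0

theorem fn_of_lt {m : ℕ} (f : w.sobolev m) (i : Fin (m + 1)) : w.fn f i = w.comp m i f :=
  dif_pos i.2

theorem memLp_fn {m : ℕ} (f : w.sobolev m) (i : ℕ) : MemLp (w.fn f i) 2 (w.μ m) := by
  unfold fn
  split_ifs
  · exact Lp.memLp _
  · exact MemLp.zero

theorem memLp_fn_volume {m : ℕ} (f : w.sobolev m) (i : ℕ) : MemLp (w.fn f i) 2 volume :=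
  (w.memLp_fn f i).of_measure_le_smul ENNReal.ofReal_ne_top (w.volume_le m)

theorem hasWeakDeriv_fn {m : ℕ} (f : w.sobolev m) {i : ℕ} (hi : i < m) :
    HasWeakDeriv (w.fn f i) (w.fn f (i + 1)) := fun φ => by
  have h := f.2 ⟨i, hi⟩ φ
  rw [← comp_apply, ← comp_apply, ← fn_of_lt, ← fn_of_lt] at h
  exact h

theorem inner_eq_sum {m : ℕ} (f g : w.sobolev m) :
    inner ℝ f g = ∑ i ∈ Finset.range (m + 1),
      ∫ s, Real.exp (w.δ m * (s * w.β s)) * (w.fn f i s * w.fn g i s) := by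
  rw [Submodule.coe_inner, PiLp.inner_apply, Finset.sum_range]
  refine Finset.sum_congr rfl fun i _ => ?_
  rw [inner_Lp, fn_of_lt, fn_of_lt]
  rfl

end SobolevWeights

/-! ### Density of the smooth functions with compact support -/

namespace CcFun

/-- A smooth function with support in `[-2, 2]` which is `1` on `[-1, 1]`. -/
noncomputable def bump : CcFun :=
  let b : ContDiffBump (0 : ℝ) := ⟨1, 2, one_pos, one_lt_two⟩
  ⟨b, b.contDiff, b.hasCompactSupport⟩

theorem bump_eq_one {s : ℝ} (hs : |s| ≤ 1) : bump.toFun s = 1 :=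
  ContDiffBump.one_of_mem_closedBall _ (by simpa [Metric.mem_closedBall] using hs)

theorem bump_eq_zero {s : ℝ} (hs : 2 ≤ |s|) : bump.toFun s = 0 :=
  ContDiffBump.zero_of_le_dist _ (by simpa using hs)

theorem iter_bump_eq_zero (i : ℕ) {s : ℝ} (hs : |s| < 1) : (bump.iter (i + 1)).toFun s = 0 := by
  have hU : IsOpen {s : ℝ | |s| < 1} := isOpen_lt continuous_abs continuous_const
  induction i generalizing s with
  | zero =>
    have h : bump.toFun =ᶠ[𝓝 s] fun _ => 1 :=
      Filter.mem_of_superset (hU.mem_nhds hs) fun x hx => bump_eq_one (le_of_lt hx)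
    exact (bump.hasDerivAt s).unique ((hasDerivAt_const s (1 : ℝ)).congr_of_eventuallyEq h)
  | succ i ih =>
    have h : (bump.iter (i + 1)).toFun =ᶠ[𝓝 s] fun _ => 0 :=
      Filter.mem_of_superset (hU.mem_nhds hs) fun x hx => ih hx
    exact ((bump.iter (i + 1)).hasDerivAt s).unique
      ((hasDerivAt_const s (0 : ℝ)).congr_of_eventuallyEq h)

/-- A smooth function with support in `[-2R, 2R]` which is `1` on `[-R, R]`. -/
noncomputable def cutoff (R : ℝ) (hR : 0 < R) : CcFun := bump.dilate R⁻¹ (inv_ne_zero hR.ne')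

theorem cutoff_eq_one {R : ℝ} (hR : 0 < R) {s : ℝ} (hs : |s| ≤ R) : (cutoff R hR).toFun s = 1 :=
  bump_eq_one (by rwa [abs_mul, abs_inv, abs_of_pos hR, inv_mul_le_one₀ hR])

theorem tsupport_cutoff_subset {R : ℝ} (hR : 0 < R) :
    tsupport (cutoff R hR).toFun ⊆ Metric.closedBall 0 (2 * R) := by
  refine closure_minimal (fun s hs => ?_) Metric.isClosed_closedBall
  by_contra h
  refine hs (bump_eq_zero ?_)
  rw [Metric.mem_closedBall, dist_zero_right, Real.norm_eq_abs, not_le] at h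
  rw [abs_mul, abs_inv, abs_of_pos hR, inv_mul_eq_div, le_div_iff₀ hR]
  exact h.le

theorem iter_cutoff_eq_zero {R : ℝ} (hR : 0 < R) {s : ℝ} (hs : |s| < R) (i : ℕ) :
    ((cutoff R hR).iter (i + 1)).toFun s = 0 := by
  rw [cutoff, iter_dilate, iter_bump_eq_zero, mul_zero]
  rwa [abs_mul, abs_inv, abs_of_pos hR, inv_mul_lt_one₀ hR]

/-- The derivative of order i of a dilated bump carries the factor R^{-i}, which is at most 1 for R
≥ 1. Uniformity in R gives the dominating function when the cutoffs tend to 1. -/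
theorem exists_abs_iter_cutoff_le (m : ℕ) :
    ∃ B, ∀ (R : ℝ) (hR : 0 < R), 1 ≤ R → ∀ i ≤ m, ∀ s, |((cutoff R hR).iter i).toFun s| ≤ B := by
  choose B hB using fun i => (bump.iter i).exists_bound
  refine ⟨∑ i ∈ Finset.range (m + 1), B i, fun R hR h1 i hi s => ?_⟩
  have h0 : ∀ i, 0 ≤ B i := fun i => (abs_nonneg _).trans (hB i 0)
  rw [cutoff, iter_dilate, abs_mul, abs_pow, abs_inv, abs_of_pos hR]
  calc R⁻¹ ^ i * |(bump.iter i).toFun (R⁻¹ * s)| ≤ 1 * B i :=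
        mul_le_mul (pow_le_one₀ (inv_nonneg.2 hR.le) (inv_le_one_of_one_le₀ h1)) (hB i _)
          (abs_nonneg _) zero_le_one
    _ ≤ _ := by
        rw [one_mul]
        exact Finset.single_le_sum (fun i _ => h0 i) (Finset.mem_range.2 (by omega))

end CcFun

theorem MeasureTheory.MemLp.cc_mul {μ : Measure ℝ} {p : ℝ≥0∞} {f : ℝ → ℝ} (hf : MemLp f p μ)
    (χ : CcFun) : MemLp (fun s => χ.toFun s * f s) p μ := by
  obtain ⟨B, hB⟩ := χ.exists_bound
  refine hf.of_le_mul (c := B) (χ.continuous.aestronglyMeasurable.mul hf.1)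
    (Eventually.of_forall fun s => ?_)
  rw [norm_mul]
  exact mul_le_mul_of_nonneg_right (hB s) (norm_nonneg _)

theorem MemLp.leibniz {μ : Measure ℝ} {p : ℝ≥0∞} {f : ℕ → ℝ → ℝ} (hf : ∀ i, MemLp (f i) p μ)
    (χ : CcFun) (i : ℕ) : MemLp (leibniz χ f i) p μ := by
  induction i generalizing f χ with
  | zero => exact (hf 0).cc_mul χ
  | succ i ih => exact (ih hf χ.deriv).add (ih (fun j => hf (j + 1)) χ)

theorem Integrable.leibniz {f : ℕ → ℝ → ℝ} (hf : ∀ i, LocallyIntegrable (f i)) (χ : CcFun)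
    (i : ℕ) : Integrable (leibniz χ f i) := by
  induction i generalizing f χ with
  | zero =>
    exact ((hf 0).integrable_mul_cc χ).congr (Eventually.of_forall fun s => mul_comm _ _)
  | succ i ih => exact (ih hf χ.deriv).add (ih (fun j => hf (j + 1)) χ)

namespace SobolevWeights

variable (w : SobolevWeights)

theorem fn_ofCc (m : ℕ) (φ : CcFun) {i : ℕ} (hi : i < m + 1) :
    w.fn (w.ofCc m φ) i =ᵐ[volume] (φ.iter i).toFun := by
  have h := w.fn_of_lt (w.ofCc m φ) ⟨i, hi⟩
  rw [comp_ofCc] at h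
  change w.fn (w.ofCc m φ) i = _ at h
  rw [h]
  exact w.coeFn_toLp_cc m _

theorem locallyIntegrable_fn {m : ℕ} (f : w.sobolev m) (i : ℕ) : LocallyIntegrable (w.fn f i) :=
  (w.memLp_fn_volume f i).locallyIntegrable (by norm_num)

/-- If `g` is orthogonal to the smooth functions with compact support, then it is orthogonal to the
product of `f` and a smooth function with compact support. -/
theorem sum_integral_leibniz_eq_zero {m : ℕ} (f g : w.sobolev m)
    (hg : ∀ φ, inner ℝ (w.ofCc m φ) g = 0) {R : ℝ} (hR : 0 < R) {χ : CcFun}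
    (hχ : tsupport χ.toFun ⊆ Metric.closedBall 0 R) :
    ∑ i ∈ Finset.range (m + 1), ∫ s, Real.exp (w.δ m * (s * w.β s)) *
      (leibniz χ (w.fn f) i s * w.fn g i s) = 0 := by
  have hLI := w.locallyIntegrable_fn f
  have hc : ∀ i, HasCompactSupport (leibniz χ (w.fn f) i) := fun i =>
    HasCompactSupport.intro χ.compact fun s hs => leibniz_eq_zero subset_rfl hs i
  have hR1 : 0 < R + 1 := by linarith
  -- The weight is absorbed into the fixed factor of the pairing, cut off to have compact support.
  -- It is unchanged on the ball of radius R + 1, which contains the supports of all mollifications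
  -- by ρ supported in the unit ball.
  let η : CcFun :=
    { toFun := fun s => (CcFun.cutoff (R + 1) hR1).toFun s * Real.exp (w.δ m * (s * w.β s))
      smooth := (CcFun.smooth _).mul (Real.contDiff_exp.comp
        (contDiff_const.mul (contDiff_id.mul w.β_smooth)))
      compact := (CcFun.compact _).mul_right }
  have hη : ∀ s, |s| ≤ R + 1 → η.toFun s = Real.exp (w.δ m * (s * w.β s)) := fun s hs => by
    change (CcFun.cutoff (R + 1) hR1).toFun s * _ = _
    rw [CcFun.cutoff_eq_one hR1 hs, one_mul]
  have key := sum_integral_mul_eq_zero_of_mollify (m := m + 1) (u := leibniz χ (w.fn f))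
    (G := fun i s => η.toFun s * w.fn g i s)
    (MemLp.leibniz (w.memLp_fn_volume f) χ) hc (fun i => (w.memLp_fn_volume g i).cc_mul η)
    (fun i => ((w.locallyIntegrable_fn g i).integrable_mul_cc η).congr
      (Eventually.of_forall fun s => mul_comm _ _)) (Integrable.leibniz hLI χ) ?_
  · rw [← key]
    refine Finset.sum_congr rfl fun i _ => integral_congr_ae (Eventually.of_forall fun s => ?_)
    change _ = leibniz χ (w.fn f) i s * (η.toFun s * w.fn g i s)
    by_cases hs : s ∈ Metric.closedBall (0 : ℝ) R
    · rw [hη s]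
      · ring
      · rw [Metric.mem_closedBall, dist_zero_right, Real.norm_eq_abs] at hs
        linarith
    · simp only [leibniz_eq_zero hχ hs i, zero_mul, mul_zero]
  · intro ρ hρ
    have h1 := hg (mollify ρ _ (LocallyIntegrable.leibniz hLI χ 0) (hc 0))
    rw [inner_eq_sum] at h1
    rw [← h1]
    refine Finset.sum_congr rfl fun i hi => integral_congr_ae ?_
    filter_upwards [w.fn_ofCc m (mollify ρ _ (LocallyIntegrable.leibniz hLI χ 0) (hc 0))
      (Finset.mem_range.1 hi)] with s hs
    rw [hs, iter_mollify (LocallyIntegrable.leibniz hLI χ) hc (m := m) (fun j hj =>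
      HasWeakDeriv.leibniz hLI χ j fun l hl => w.hasWeakDeriv_fn f (by omega)) ρ
      (by have := Finset.mem_range.1 hi; omega)]
    by_cases h0 : (mollify ρ (leibniz χ (w.fn f) i)
      (LocallyIntegrable.leibniz hLI χ i) (hc i)).toFun s = 0
    · rw [h0]; ring
    · have h2 := support_convolution_subset (L := ContinuousLinearMap.lsmul ℝ ℝ)
        (μ := volume) (f := ρ.toFun) (g := leibniz χ (w.fn f) i) h0
      obtain ⟨a, ha, b, hb, rfl⟩ := h2
      have ha1 := hρ (subset_tsupport _ ha)
      have hb1 : b ∈ Metric.closedBall (0 : ℝ) R := by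
        by_contra h
        exact hb (leibniz_eq_zero hχ h i)
      rw [Metric.mem_ball, dist_zero_right, Real.norm_eq_abs] at ha1
      rw [Metric.mem_closedBall, dist_zero_right, Real.norm_eq_abs] at hb1
      change _ * (η.toFun (a + b) * _) = _
      rw [hη (a + b) ((abs_add_le a b).trans (by linarith))]
      ring

/-- The product of f with a cutoff at radius N + 1 is orthogonal to g, and dominated convergence
lets N tend to infinity. The derivatives falling on the cutoff are bounded uniformly and eventually
vanish at each point. -/
theorem inner_eq_zero_of_forall_ofCc {m : ℕ} (f g : w.sobolev m)
    (hg : ∀ φ, inner ℝ (w.ofCc m φ) g = 0) : inner ℝ f g = 0 := by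
  obtain ⟨B, hB⟩ := CcFun.exists_abs_iter_cutoff_le m
  have hN : ∀ N : ℕ, (0 : ℝ) < N + 1 := fun N => by positivity
  have h0 : ∀ N : ℕ, ∑ i ∈ Finset.range (m + 1),
      ∫ s, leibniz (CcFun.cutoff (N + 1) (hN N)) (w.fn f) i s * w.fn g i s ∂w.μ m = 0 := fun N => by
    simp only [integral_μ]
    exact w.sum_integral_leibniz_eq_zero f g hg (R := 2 * (N + 1)) (by linarith [hN N])
      (CcFun.tsupport_cutoff_subset (hN N))
  have h1 : ∀ i ∈ Finset.range (m + 1), Tendsto (fun N : ℕ =>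
      ∫ s, leibniz (CcFun.cutoff (N + 1) (hN N)) (w.fn f) i s * w.fn g i s ∂w.μ m) atTop
      (𝓝 (∫ s, w.fn f i s * w.fn g i s ∂w.μ m)) := fun i hi => by
    refine tendsto_integral_of_dominated_convergence
      (fun s => ∑ j ∈ Finset.range (i + 1), 2 ^ i * B * (|w.fn f j s| * |w.fn g i s|))
      (fun N => ((MemLp.leibniz (w.memLp_fn f) _ i).1.mul (w.memLp_fn g i).1)) ?_ ?_ ?_
    · refine integrable_finsetSum _ fun j _ => Integrable.const_mul ?_ _
      exact (w.memLp_fn f j).abs.integrable_mul (w.memLp_fn g i).abs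
    · refine fun N => Eventually.of_forall fun s => ?_
      rw [norm_mul, Real.norm_eq_abs, Real.norm_eq_abs]
      refine (mul_le_mul_of_nonneg_right (abs_leibniz_le i fun j hj =>
        hB (N + 1) (hN N) (by linarith [(Nat.cast_nonneg N : (0 : ℝ) ≤ N)]) j
          (by have := Finset.mem_range.1 hi; omega) s) (abs_nonneg _)).trans_eq ?_
      rw [Finset.mul_sum, Finset.sum_mul]
      simp only [mul_assoc]
    · refine Eventually.of_forall fun s => tendsto_const_nhds.congr' ?_
      obtain ⟨N₀, hN₀⟩ := exists_nat_gt |s|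
      filter_upwards [eventually_ge_atTop N₀] with N hNN
      have hs : |s| < (N : ℝ) + 1 := by
        have : (N₀ : ℝ) ≤ N := by exact_mod_cast hNN
        linarith
      rw [leibniz_eq_mul (fun j => CcFun.iter_cutoff_eq_zero (hN N) hs j),
        CcFun.cutoff_eq_one (hN N) hs.le, one_mul]
  have h2 := tendsto_finsetSum (Finset.range (m + 1)) h1
  rw [inner_eq_sum]
  simp only [← integral_μ]
  exact tendsto_nhds_unique h2 (by simp only [h0]; exact tendsto_const_nhds)

theorem dense_range_ofCc (m : ℕ) : Dense (range (w.ofCc m)) := by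
  have h : (w.ccSubmodule m).topologicalClosure = ⊤ := by
    rw [Submodule.topologicalClosure_eq_top_iff, Submodule.eq_bot_iff]
    intro g hg
    have h1 : inner ℝ g g = 0 := w.inner_eq_zero_of_forall_ofCc g g fun φ =>
      (Submodule.mem_orthogonal _ _).1 hg _ ⟨φ, rfl⟩
    exact inner_self_eq_zero.1 h1
  exact Submodule.dense_iff_topologicalClosure_eq_top.2 h

end SobolevWeights

/-! ### Compactness of the inclusions of the weighted Sobolev spaces -/

namespace CcFun

theorem memLp (φ : CcFun) (μ : Measure ℝ) [IsLocallyFiniteMeasure μ] : MemLp φ.toFun 2 μ :=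
  φ.continuous.memLp_of_hasCompactSupport φ.compact

/-- Cauchy–Schwarz for φ' against the indicator of the interval between the two points. -/
theorem abs_sub_le_sqrt_mul (φ : CcFun) {s t h : ℝ} (hst : |s - t| ≤ h) :
    |φ.toFun s - φ.toFun t| ≤ √h * ‖(φ.deriv.memLp volume).toLp φ.deriv.toFun‖ := by
  rw [← intervalIntegral.integral_eq_sub_of_hasDerivAt (fun x _ => φ.hasDerivAt x)
    (φ.deriv.continuous.intervalIntegrable _ _), intervalIntegral.abs_integral_eq_abs_integral_uIoc]
  have hv : volume (uIoc t s) ≠ ⊤ := by rw [Real.volume_uIoc]; exact ENNReal.ofReal_ne_top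
  have h1 : ∫ x in uIoc t s, φ.deriv.toFun x = inner ℝ
      (indicatorConstLp 2 measurableSet_uIoc hv (1 : ℝ))
      ((φ.deriv.memLp volume).toLp φ.deriv.toFun) := by
    rw [L2.inner_indicatorConstLp_one]
    exact setIntegral_congr_ae measurableSet_uIoc
      ((φ.deriv.memLp volume).coeFn_toLp.mono fun x hx _ => hx.symm)
  rw [h1]
  refine (abs_real_inner_le_norm _ _).trans (mul_le_mul_of_nonneg_right ?_ (norm_nonneg _))
  rw [norm_indicatorConstLp (by norm_num) (by norm_num), norm_one, one_mul, measureReal_def,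
    Real.volume_uIoc, ENNReal.toReal_ofReal (abs_nonneg _), ENNReal.toReal_ofNat,
    ← Real.sqrt_eq_rpow]
  exact Real.sqrt_le_sqrt hst

end CcFun

theorem isCompactOperator_finsetSum {E F ι : Type*} [NormedAddCommGroup E] [NormedSpace ℝ E]
    [NormedAddCommGroup F] [NormedSpace ℝ F] (s : Finset ι) (f : ι → E →L[ℝ] F)
    (h : ∀ i ∈ s, IsCompactOperator (f i)) : IsCompactOperator (∑ i ∈ s, f i : E →L[ℝ] F) := by
  classical
  induction s using Finset.induction_on with
  | empty =>
    rw [Finset.sum_empty]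
    exact isCompactOperator_zero
  | insert i s hi ih =>
    rw [Finset.sum_insert hi]
    exact (h i (Finset.mem_insert_self i s)).add
      (ih fun j hj => h j (Finset.mem_insert_of_mem hj))

namespace SobolevWeights

variable (w : SobolevWeights)

theorem mul_β_eq_abs {s : ℝ} (hs : 1 ≤ |s|) : s * w.β s = |s| := by
  rcases le_total 0 s with h | h
  · rw [abs_of_nonneg h] at hs ⊢
    rw [w.β_one s hs, mul_one]
  · rw [abs_of_nonpos h] at hs ⊢
    have := w.β_odd (-s)
    rw [neg_neg, w.β_one _ hs] at this
    rw [this, mul_neg_one]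

/-- Outside [-N, N) one has sβ(s) = |s| ≥ N, so the ratio of consecutive weights is at most
e^{-(δ_{m+1} - δ_m)N}. This gain makes the inclusions compact on the unbounded line. -/
theorem restrict_compl_Ico_le (m : ℕ) {N : ℝ} (hN : 1 ≤ N) :
    (w.μ m).restrict (Ico (-N) N)ᶜ ≤
      ENNReal.ofReal (Real.exp (-((w.δ (m + 1) - w.δ m) * N))) • w.μ (m + 1) := by
  have hS : MeasurableSet (Ico (-N) N)ᶜ := measurableSet_Ico.compl
  have hd : w.δ m ≤ w.δ (m + 1) := w.δ_mono.monotone (Nat.le_succ m)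
  change (volume.withDensity _).restrict _ ≤ _ • volume.withDensity _
  rw [restrict_withDensity hS, ← withDensity_indicator hS,
    ← withDensity_smul _ (w.continuous_exponent _).measurable.ennreal_ofReal]
  refine withDensity_mono (Eventually.of_forall fun s => ?_)
  by_cases hs : s ∈ (Ico (-N) N)ᶜ
  · have h1 : N ≤ |s| := by
      by_contra h
      obtain ⟨h1, h2⟩ := abs_lt.1 (not_le.1 h)
      exact hs ⟨h1.le, h2⟩
    rw [indicator_of_mem hs, Pi.smul_apply, smul_eq_mul, ← ENNReal.ofReal_mul (Real.exp_pos _).le,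
      ← Real.exp_add, w.mul_β_eq_abs (hN.trans h1)]
    refine ENNReal.ofReal_le_ofReal (Real.exp_le_exp.2 ?_)
    nlinarith
  · rw [indicator_of_notMem hs]
    exact zero_le

/-- The inclusion of the weighted space into `L²(ℝ)`. -/
noncomputable def toL2 (m : ℕ) : Lp ℝ 2 (w.μ m) →L[ℝ] Lp ℝ 2 (volume : Measure ℝ) :=
  Lp.LpToLpOfMeasureLeSMul ENNReal.ofReal_ne_top (w.volume_le m)

theorem toL2_toLp (m : ℕ) (φ : CcFun) :
    w.toL2 m ((w.memLp_cc m φ).toLp φ.toFun) = (φ.memLp volume).toLp φ.toFun :=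
  Lp.ext (((Lp.coeFn_LpToLpOfMeasureLeSMul _ _ _).trans (w.coeFn_toLp_cc m φ)).trans
    (MemLp.coeFn_toLp _).symm)

theorem measure_Ico_ne_top (m : ℕ) (a b : ℝ) : w.μ m (Ico a b) ≠ ⊤ := measure_Ico_lt_top.ne

/-- The orthogonal projection onto the functions which are constant on the intervals
`[-N + jh, -N + (j + 1)h)`, `0 ≤ j < M`, and zero elsewhere. -/
noncomputable def average (m : ℕ) (i : Fin (m + 1)) (N h : ℝ) (M : ℕ) :
    w.sobolev (m + 1) →L[ℝ] Lp ℝ 2 (w.μ m) :=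
  ∑ j ∈ Finset.range M, ((h⁻¹ • innerSL ℝ (indicatorConstLp 2 (μ := (volume : Measure ℝ))
    (measurableSet_Ico (a := -N + j * h) (b := -N + (j + 1) * h)) measure_Ico_lt_top.ne (1 : ℝ))).comp
      ((w.toL2 (m + 1)).comp (w.comp (m + 1) i.castSucc))).smulRight
    (indicatorConstLp 2 (measurableSet_Ico (a := -N + j * h) (b := -N + (j + 1) * h))
      (w.measure_Ico_ne_top m _ _) (1 : ℝ))

theorem isCompactOperator_average (m : ℕ) (i : Fin (m + 1)) (N h : ℝ) (M : ℕ) :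
    IsCompactOperator (w.average m i N h M) := by
  refine isCompactOperator_finsetSum _ _ fun j _ => ?_
  exact (isCompactOperator_of_locallyCompactSpace_dom
    ((h⁻¹ • innerSL ℝ (indicatorConstLp 2 (μ := (volume : Measure ℝ))
    (measurableSet_Ico (a := -N + j * h) (b := -N + (j + 1) * h)) measure_Ico_lt_top.ne (1 : ℝ))).comp
      ((w.toL2 (m + 1)).comp (w.comp (m + 1) i.castSucc)))).clm_comp
    (ContinuousLinearMap.toSpanSingleton ℝ
      (indicatorConstLp 2 (measurableSet_Ico (a := -N + j * h) (b := -N + (j + 1) * h))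
      (w.measure_Ico_ne_top m _ _) (1 : ℝ)))

theorem average_ofCc (m : ℕ) (i : Fin (m + 1)) (N h : ℝ) (M : ℕ) (φ : CcFun) :
    (w.average m i N h M (w.ofCc (m + 1) φ) : ℝ → ℝ) =ᵐ[w.μ m] fun s => ∑ j ∈ Finset.range M,
      h⁻¹ * (∫ x in Ico (-N + j * h) (-N + (j + 1) * h), (φ.iter i).toFun x) *
        (Ico (-N + j * h) (-N + (j + 1) * h)).indicator (fun _ => 1) s := by
  have h1 : w.average m i N h M (w.ofCc (m + 1) φ) = ∑ j ∈ Finset.range M,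
      (h⁻¹ * ∫ x in Ico (-N + j * h) (-N + (j + 1) * h), (φ.iter i).toFun x) •
        indicatorConstLp 2 (measurableSet_Ico (a := -N + j * h) (b := -N + (j + 1) * h))
          (w.measure_Ico_ne_top m _ _) (1 : ℝ) := by
    rw [average, sum_apply]
    refine Finset.sum_congr rfl fun j _ => ?_
    rw [ContinuousLinearMap.smulRight_apply, ContinuousLinearMap.comp_apply,
      ContinuousLinearMap.comp_apply, comp_ofCc, smul_apply,
      innerSL_apply_apply, smul_eq_mul]
    congr 2
    rw [L2.inner_indicatorConstLp_one]
    refine setIntegral_congr_ae measurableSet_Ico ?_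
    have := w.toL2_toLp (m + 1) (φ.iter i)
    change ∀ᵐ x, _ → w.toL2 (m + 1) ((w.memLp_cc (m + 1) (φ.iter i)).toLp (φ.iter i).toFun) x = _
    rw [this]
    exact (MemLp.coeFn_toLp _).mono fun x hx _ => hx
  rw [h1]
  refine (Lp.coeFn_finsetSum _ _).trans ?_
  have h2 : ∀ᵐ s ∂w.μ m, ∀ j ∈ Finset.range M,
      ((h⁻¹ * ∫ x in Ico (-N + j * h) (-N + (j + 1) * h), (φ.iter i).toFun x) •
        indicatorConstLp 2 (measurableSet_Ico (a := -N + j * h) (b := -N + (j + 1) * h))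
          (w.measure_Ico_ne_top m _ _) (1 : ℝ) : Lp ℝ 2 (w.μ m)) s =
      (h⁻¹ * ∫ x in Ico (-N + j * h) (-N + (j + 1) * h), (φ.iter i).toFun x) *
        (Ico (-N + j * h) (-N + (j + 1) * h)).indicator (fun _ => 1) s := by
    refine (ae_ball_iff (Finset.range M).countable_toSet).2 fun j _ => ?_
    filter_upwards [Lp.coeFn_smul (h⁻¹ * ∫ x in Ico (-N + j * h) (-N + (j + 1) * h),
        (φ.iter i).toFun x) (indicatorConstLp 2 (measurableSet_Ico (a := -N + j * h)
        (b := -N + (j + 1) * h)) (w.measure_Ico_ne_top m _ _) (1 : ℝ)),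
      indicatorConstLp_coeFn (p := 2) (hs := measurableSet_Ico (a := -N + j * h)
        (b := -N + (j + 1) * h)) (hμs := w.measure_Ico_ne_top m _ _) (c := (1 : ℝ))] with s h1 h2
    rw [h1, Pi.smul_apply, h2, smul_eq_mul]
  filter_upwards [h2] with s hs
  rw [Finset.sum_apply]
  exact Finset.sum_congr rfl hs

theorem sum_indicator_eq {N h : ℝ} (hh : 0 < h) {M : ℕ} {s : ℝ} {j : ℕ} (hj : j < M)
    (hs : s ∈ Ico (-N + j * h) (-N + (j + 1) * h)) (a : ℕ → ℝ) :
    ∑ j ∈ Finset.range M, a j * (Ico (-N + j * h) (-N + (j + 1) * h)).indicator (fun _ => 1) s =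
      a j := by
  rw [Finset.sum_eq_single j, indicator_of_mem hs, mul_one]
  · intro l _ hl
    rw [indicator_of_notMem, mul_zero]
    intro hsl
    refine hl ?_
    have h1 : (l : ℝ) * h < (j + 1) * h := by linarith [hs.2, hsl.1]
    have h2 : (j : ℝ) * h < (l + 1) * h := by linarith [hs.1, hsl.2]
    have h3 : (l : ℝ) < j + 1 := lt_of_mul_lt_mul_right h1 hh.le
    have h4 : (j : ℝ) < l + 1 := lt_of_mul_lt_mul_right h2 hh.le
    have h5 : l < j + 1 := by exact_mod_cast h3
    have h6 : j < l + 1 := by exact_mod_cast h4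
    omega
  · exact fun h => absurd (Finset.mem_range.2 hj) h

/-- By density it suffices to treat test functions. On an interval of length h a function differs
from its mean by at most √h times the L² norm of its derivative. Outside [-N, N) the average is
zero, and the gain of weight estimates the function itself. -/
theorem norm_lower_comp_sub_average_le (m : ℕ) (i : Fin (m + 1)) {N h : ℝ} {M : ℕ} (hN : 1 ≤ N)
    (hh : 0 < h) (hM : M * h = 2 * N) (f : w.sobolev (m + 1)) :
    ‖w.lower m (w.comp (m + 1) i.castSucc f) - w.average m i N h M f‖ ≤
      ((w.μ m).real (Ico (-N) N) ^ (2⁻¹ : ℝ) * (√h * ‖w.toL2 (m + 1)‖) +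
        Real.exp (-((w.δ (m + 1) - w.δ m) * N)) ^ (2⁻¹ : ℝ)) * ‖f‖ := by
  refine isClosed_property (e := w.ofCc (m + 1)) (p := fun f =>
    ‖w.lower m (w.comp (m + 1) i.castSucc f) - w.average m i N h M f‖ ≤
      ((w.μ m).real (Ico (-N) N) ^ (2⁻¹ : ℝ) * (√h * ‖w.toL2 (m + 1)‖) +
        Real.exp (-((w.δ (m + 1) - w.δ m) * N)) ^ (2⁻¹ : ℝ)) * ‖f‖) (w.dense_range_ofCc (m + 1))
    (isClosed_le (by fun_prop) (by fun_prop)) (fun φ => ?_) f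
  set ψ := φ.iter i with hψ
  set x := w.ofCc (m + 1) φ with hx
  set a : ℕ → ℝ := fun j => h⁻¹ * ∫ x in Ico (-N + j * h) (-N + (j + 1) * h), ψ.toFun x with ha
  set F : ℝ → ℝ := fun s => ψ.toFun s - ∑ j ∈ Finset.range M,
    a j * (Ico (-N + j * h) (-N + (j + 1) * h)).indicator (fun _ => 1) s with hF
  have hFae : (w.lower m (w.comp (m + 1) i.castSucc x) - w.average m i N h M x :
      Lp ℝ 2 (w.μ m)) =ᵐ[w.μ m] F := by
    have h1 : w.lower m (w.comp (m + 1) i.castSucc x) = (w.memLp_cc m ψ).toLp ψ.toFun :=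
      w.lower_toLp m ψ
    refine (Lp.coeFn_sub _ _).trans ?_
    rw [h1]
    exact (MemLp.coeFn_toLp _).sub (w.average_ofCc m i N h M φ)
  -- Since i ≤ m, the derivative of order i + 1 is still a component of the norm on level m + 1.
  have hd : ‖(ψ.deriv.memLp volume).toLp ψ.deriv.toFun‖ ≤ ‖w.toL2 (m + 1)‖ * ‖x‖ := by
    rw [← w.toL2_toLp (m + 1) ψ.deriv]
    exact (ContinuousLinearMap.le_opNorm _ _).trans (mul_le_mul_of_nonneg_left
      (w.norm_comp_le (m + 1) i.succ x) (norm_nonneg _))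
  have hin : ∀ s ∈ Ico (-N) N, |F s| ≤ √h * ‖w.toL2 (m + 1)‖ * ‖x‖ := fun s hs => by
    have hs0 : 0 ≤ (s + N) / h := div_nonneg (by linarith [hs.1]) hh.le
    -- The floor of (s + N)/h is the index of the interval containing s; it is less than M because
    -- the intervals fill exactly [-N, N).
    obtain ⟨hj1, hj2⟩ := (Nat.floor_eq_iff hs0).1 (rfl : ⌊(s + N) / h⌋₊ = _)
    set j := ⌊(s + N) / h⌋₊
    rw [le_div_iff₀ hh] at hj1
    rw [div_lt_iff₀ hh] at hj2
    have hsj : s ∈ Ico (-N + j * h) (-N + (j + 1) * h) := ⟨by linarith, by linarith⟩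
    have hjM : j < M := by
      have : (j : ℝ) * h < M * h := by rw [hM]; linarith [hs.2]
      exact_mod_cast lt_of_mul_lt_mul_right this hh.le
    simp only [hF]
    rw [sum_indicator_eq hh hjM hsj]
    have hvol : volume.real (Ico (-N + j * h) (-N + (j + 1) * h)) = h := by
      rw [Real.volume_real_Ico_of_le (by nlinarith)]
      ring
    have h1 : ψ.toFun s - a j =
        h⁻¹ * ∫ x in Ico (-N + j * h) (-N + (j + 1) * h), (ψ.toFun s - ψ.toFun x) := by
      rw [integral_sub (integrable_const _) ψ.integrable.integrableOn,
        setIntegral_const, hvol, smul_eq_mul, mul_sub, inv_mul_cancel_left₀ hh.ne']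
    have h2 := norm_setIntegral_le_of_norm_le_const (μ := volume)
      (s := Ico (-N + j * h) (-N + (j + 1) * h)) (f := fun x => ψ.toFun s - ψ.toFun x)
      (C := √h * ‖(ψ.deriv.memLp volume).toLp ψ.deriv.toFun‖) measure_Ico_lt_top
      fun x hx => ψ.abs_sub_le_sqrt_mul (abs_le.2 ⟨by linarith [hx.2, hsj.1], by linarith [hx.1, hsj.2]⟩)
    rw [hvol, Real.norm_eq_abs] at h2
    rw [h1, abs_mul, abs_of_pos (inv_pos.2 hh)]
    calc _ ≤ h⁻¹ * (√h * ‖(ψ.deriv.memLp volume).toLp ψ.deriv.toFun‖ * h) :=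
          mul_le_mul_of_nonneg_left h2 (inv_pos.2 hh).le
      _ = √h * ‖(ψ.deriv.memLp volume).toLp ψ.deriv.toFun‖ := by field_simp
      _ ≤ √h * (‖w.toL2 (m + 1)‖ * ‖x‖) := mul_le_mul_of_nonneg_left hd (Real.sqrt_nonneg _)
      _ = _ := by ring
  have hout : ∀ s ∈ (Ico (-N) N)ᶜ, F s = ψ.toFun s := fun s hs => by
    simp only [hF]
    rw [Finset.sum_eq_zero, sub_zero]
    intro j hj
    rw [indicator_of_notMem, mul_zero]
    intro hsj
    have h1 : ((j : ℝ) + 1) * h ≤ M * h := by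
      refine mul_le_mul_of_nonneg_right ?_ hh.le
      exact_mod_cast Finset.mem_range.1 hj
    exact hs ⟨by nlinarith [hsj.1, (Nat.cast_nonneg j : (0 : ℝ) ≤ j)], by nlinarith [hsj.2]⟩
  have hS : MeasurableSet (Ico (-N) N) := measurableSet_Ico
  have hFm : AEStronglyMeasurable F (w.μ m) := (Lp.aestronglyMeasurable _).congr hFae
  have e1 : eLpNorm F 2 ((w.μ m).restrict (Ico (-N) N)) ≤ ENNReal.ofReal
      ((w.μ m).real (Ico (-N) N) ^ (2⁻¹ : ℝ) * (√h * ‖w.toL2 (m + 1)‖) * ‖x‖) := by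
    refine (eLpNorm_le_of_ae_bound (C := √h * ‖w.toL2 (m + 1)‖ * ‖x‖)
      ((ae_restrict_iff' hS).2 (Eventually.of_forall hin))).trans_eq ?_
    rw [Measure.restrict_apply_univ, mul_assoc ((w.μ m).real _ ^ _),
      ENNReal.ofReal_mul (p := (w.μ m).real _ ^ _) (by positivity),
      ← ENNReal.ofReal_rpow_of_nonneg measureReal_nonneg (by norm_num), ENNReal.toReal_ofNat,
      ofReal_measureReal (w.measure_Ico_ne_top m _ _)]
  have e2 : eLpNorm F 2 ((w.μ m).restrict (Ico (-N) N)ᶜ) ≤ ENNReal.ofReal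
      (Real.exp (-((w.δ (m + 1) - w.δ m) * N)) ^ (2⁻¹ : ℝ) * ‖x‖) := by
    rw [eLpNorm_congr_ae ((ae_restrict_iff' hS.compl).2 (Eventually.of_forall hout))]
    refine (eLpNorm_le_of_measure_le_smul (w.restrict_compl_Ico_le m hN)).trans ?_
    rw [smul_eq_mul, ENNReal.ofReal_mul (by positivity),
      ← ENNReal.ofReal_rpow_of_nonneg (Real.exp_pos _).le (by norm_num),
      show (1 / (2 : ℝ≥0∞)).toReal = 2⁻¹ by simp]
    have h3 : ‖(w.memLp_cc (m + 1) ψ).toLp ψ.toFun‖ ≤ ‖x‖ := w.norm_comp_le (m + 1) i.castSucc x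
    rw [Lp.norm_toLp] at h3
    gcongr
    exact (ENNReal.le_ofReal_iff_toReal_le (w.memLp_cc (m + 1) ψ).2.ne (norm_nonneg _)).2 h3
  rw [Lp.norm_def, eLpNorm_congr_ae hFae, add_mul]
  refine ENNReal.toReal_le_of_le_ofReal (by positivity) ?_
  rw [ENNReal.ofReal_add (by positivity) (by positivity)]
  calc eLpNorm F 2 (w.μ m)
      = eLpNorm ((Ico (-N) N).indicator F + (Ico (-N) N)ᶜ.indicator F) 2 (w.μ m) := by
        rw [indicator_self_add_compl]
    _ ≤ eLpNorm ((Ico (-N) N).indicator F) 2 (w.μ m) +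
        eLpNorm ((Ico (-N) N)ᶜ.indicator F) 2 (w.μ m) :=
        eLpNorm_add_le (hFm.indicator hS) (hFm.indicator hS.compl) (by norm_num)
    _ ≤ _ := by
        rw [eLpNorm_indicator_eq_eLpNorm_restrict hS, eLpNorm_indicator_eq_eLpNorm_restrict hS.compl]
        exact add_le_add e1 e2

/-- The operator is a norm limit of averaging operators of finite rank, and compact operators are
closed in norm. -/
theorem isCompactOperator_lower_comp (m : ℕ) (i : Fin (m + 1)) :
    IsCompactOperator ((w.lower m).comp (w.comp (m + 1) i.castSucc)) := by
  set A := (w.lower m).comp (w.comp (m + 1) i.castSucc)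
  suffices h : A ∈ closure {f : w.sobolev (m + 1) →L[ℝ] Lp ℝ 2 (w.μ m) | IsCompactOperator f} from
    isClosed_setOfPred_isCompactOperator.closure_subset h
  refine (Metric.mem_closure_iff (α := w.sobolev (m + 1) →L[ℝ] Lp ℝ 2 (w.μ m))).2 fun ε hε => ?_
  have hd : 0 < w.δ (m + 1) - w.δ m := sub_pos.2 (w.δ_mono (Nat.lt_succ_self m))
  have t1 : Tendsto (fun N : ℝ => Real.exp (-((w.δ (m + 1) - w.δ m) * N)) ^ (2⁻¹ : ℝ)) atTop (𝓝 0) := by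
    have h1 : Tendsto (fun N : ℝ => Real.exp (-((w.δ (m + 1) - w.δ m) * N))) atTop (𝓝 0) :=
      Real.tendsto_exp_neg_atTop_nhds_zero.comp (tendsto_id.const_mul_atTop hd)
    have h2 := h1.rpow_const (p := (2⁻¹ : ℝ)) (Or.inr (by norm_num))
    rwa [Real.zero_rpow (by norm_num)] at h2
  -- N is fixed first, to make the tail small; the mesh 2N/M is refined afterwards, because the
  -- bound on [-N, N) involves the measure of that interval.
  obtain ⟨N, hN1, hN⟩ := ((eventually_ge_atTop 1).and (t1.eventually_lt_const (half_pos hε))).exists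
  set K := (w.μ m).real (Ico (-N) N) ^ (2⁻¹ : ℝ) with hK
  have t2 : Tendsto (fun M : ℕ => K * (√(2 * N / M) * ‖w.toL2 (m + 1)‖)) atTop (𝓝 0) := by
    have h1 : Tendsto (fun M : ℕ => 2 * N / (M : ℝ)) atTop (𝓝 0) :=
      tendsto_const_nhds.div_atTop tendsto_natCast_atTop_atTop
    have h2 := ((h1.sqrt).mul_const ‖w.toL2 (m + 1)‖).const_mul K
    rwa [Real.sqrt_zero, zero_mul, mul_zero] at h2
  obtain ⟨M, hM1, hM⟩ := ((eventually_ge_atTop 1).and (t2.eventually_lt_const (half_pos hε))).exists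
  have hM0 : (0 : ℝ) < M := by exact_mod_cast hM1
  refine ⟨w.average m i N (2 * N / M) M, w.isCompactOperator_average m i _ _ _, ?_⟩
  refine lt_of_eq_of_lt (dist_eq_norm A _) ?_
  refine lt_of_le_of_lt (ContinuousLinearMap.opNorm_le_bound _ (by positivity) fun f =>
    w.norm_lower_comp_sub_average_le m i hN1 (by positivity) (by field_simp) f) ?_
  rw [← hK]
  linarith

theorem isCompactOperator_sobolevIncl (m : ℕ) : IsCompactOperator (w.sobolevIncl m) := by
  let S : w.sobolev (m + 1) →L[ℝ] PiLp 2 (fun _ : Fin (m + 1) => Lp ℝ 2 (w.μ m)) :=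
    ∑ i : Fin (m + 1), ((PiLp.continuousLinearEquiv 2 ℝ
      (fun _ : Fin (m + 1) => Lp ℝ 2 (w.μ m))).symm.toContinuousLinearMap.comp
      (ContinuousLinearMap.single ℝ (fun _ : Fin (m + 1) => Lp ℝ 2 (w.μ m)) i)).comp
        ((w.lower m).comp (w.comp (m + 1) i.castSucc))
  have hS : IsCompactOperator S :=
    isCompactOperator_finsetSum _ _ fun i _ =>
      (w.isCompactOperator_lower_comp m i).clm_comp ((PiLp.continuousLinearEquiv 2 ℝ
      (fun _ : Fin (m + 1) => Lp ℝ 2 (w.μ m))).symm.toContinuousLinearMap.comp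
      (ContinuousLinearMap.single ℝ (fun _ : Fin (m + 1) => Lp ℝ 2 (w.μ m)) i))
  have hSe : ∀ f, S f = (w.sobolevIncl m f).1 := fun f => by
    ext1 j
    simp only [S, sum_apply]
    rw [WithLp.ofLp_sum, Finset.sum_apply, Finset.sum_eq_single j]
    · simp
      rfl
    · intro i _ hij
      simp [hij.symm]
    · exact fun h => absurd (Finset.mem_univ j) h
  have hmem : ∀ f, S f ∈ w.sobolev m := fun f => by rw [hSe]; exact (w.sobolevIncl m f).2
  have h := hS.codRestrict (V := w.sobolev m) hmem
    (w.isClosed_sobolev m)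
  have e : (w.sobolevIncl m : w.sobolev (m + 1) → w.sobolev m) = codRestrict S (w.sobolev m) hmem :=
    funext fun f => Subtype.ext (hSe f).symm
  rw [e]
  exact h

theorem isScBanach_scale : w.scale.IsScBanach where
  complete := fun m => inferInstanceAs (CompleteSpace (w.sobolev m))
  injective := w.sobolevIncl_injective
  compact := w.isCompactOperator_sobolevIncl
  dense := fun m => (w.dense_range_ofCc m).mono (by
    rintro _ ⟨φ, rfl⟩
    exact ⟨fun i => w.ofCc i φ, fun i => w.sobolevIncl_ofCc i φ, rfl⟩)

end SobolevWeights

/-! ### Reflexivity -/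

/-- Composing a functional on the dual with H → H* gives a functional on H, and its Riesz vector is
the preimage. -/
theorem surjective_inclusionInDoubleDual_of_innerProductSpace (H : Type*) [NormedAddCommGroup H]
    [InnerProductSpace ℝ H] [CompleteSpace H] :
    Function.Surjective (NormedSpace.inclusionInDoubleDual ℝ H) := by
  intro ξ
  let D : H →L[ℝ] StrongDual ℝ H := innerSL ℝ
  refine ⟨(InnerProductSpace.toDual ℝ H).symm (ξ.comp D), ?_⟩
  ext l
  rw [NormedSpace.dual_def]
  obtain ⟨y, rfl⟩ := (InnerProductSpace.toDual ℝ H).surjective l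
  rw [InnerProductSpace.toDual_apply_apply, real_inner_comm, InnerProductSpace.toDual_symm_apply]
  rfl

theorem surjective_inclusionInDoubleDual_prod {E F : Type*} [NormedAddCommGroup E]
    [NormedSpace ℝ E] [NormedAddCommGroup F] [NormedSpace ℝ F]
    (hE : Function.Surjective (NormedSpace.inclusionInDoubleDual ℝ E))
    (hF : Function.Surjective (NormedSpace.inclusionInDoubleDual ℝ F)) :
    Function.Surjective (NormedSpace.inclusionInDoubleDual ℝ (E × F)) := by
  intro ξ
  let P : StrongDual ℝ E →L[ℝ] StrongDual ℝ (E × F) :=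
    (ContinuousLinearMap.compL ℝ (E × F) E ℝ).flip (ContinuousLinearMap.fst ℝ E F)
  let Q : StrongDual ℝ F →L[ℝ] StrongDual ℝ (E × F) :=
    (ContinuousLinearMap.compL ℝ (E × F) F ℝ).flip (ContinuousLinearMap.snd ℝ E F)
  obtain ⟨x, hx⟩ := hE (ξ.comp P)
  obtain ⟨y, hy⟩ := hF (ξ.comp Q)
  refine ⟨(x, y), ?_⟩
  ext l
  have h1 := DFunLike.congr_fun hx (l.comp (ContinuousLinearMap.inl ℝ E F))
  have h2 := DFunLike.congr_fun hy (l.comp (ContinuousLinearMap.inr ℝ E F))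
  rw [NormedSpace.dual_def] at h1 h2 ⊢
  have h3 : l = P (l.comp (ContinuousLinearMap.inl ℝ E F)) +
      Q (l.comp (ContinuousLinearMap.inr ℝ E F)) := by
    ext z <;> simp [P, Q, ← Prod.zero_eq_mk]
  have h4 : l (x, y) = l.comp (ContinuousLinearMap.inl ℝ E F) x +
      l.comp (ContinuousLinearMap.inr ℝ E F) y := by
    simp [← map_add]
  rw [h4, h1, h2]
  conv_rhs => rw [h3, map_add]
  rfl

/-! ### Translates of smooth functions with compact support -/

theorem hasDerivAt_of_norm_le_sq {F : Type*} [NormedAddCommGroup F] [NormedSpace ℝ F] {f : ℝ → F}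
    {v : F} {x K : ℝ} (h : ∀ y : ℝ, |y| ≤ 1 → ‖f (x + y) - f x - y • v‖ ≤ K * y ^ 2) :
    HasDerivAt f v x := by
  rw [hasDerivAt_iff_isLittleO_nhds_zero]
  refine IsBigO.trans_isLittleO (g := fun y : ℝ => y ^ 2) ?_ (isLittleO_pow_id one_lt_two)
  refine IsBigO.of_bound K ?_
  filter_upwards [Metric.closedBall_mem_nhds (0 : ℝ) one_pos] with y hy
  rw [Real.norm_eq_abs (y ^ 2), abs_of_nonneg (sq_nonneg y)]
  exact h y (by simpa using hy)

namespace CcFun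

theorem exists_tsupport_subset (φ : CcFun) : ∃ R, 0 ≤ R ∧ tsupport φ.toFun ⊆ Metric.closedBall 0 R := by
  obtain ⟨R, hR⟩ := φ.compact.isCompact.isBounded.subset_closedBall 0
  exact ⟨max R 0, le_max_right _ _, hR.trans (Metric.closedBall_subset_closedBall (le_max_left _ _))⟩

theorem eq_zero_of_lt_abs {φ : CcFun} {R : ℝ} (hφ : tsupport φ.toFun ⊆ Metric.closedBall 0 R) {s : ℝ}
    (hs : R < |s|) : φ.toFun s = 0 :=
  image_eq_zero_of_notMem_tsupport fun h => by
    have := hφ h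
    rw [Metric.mem_closedBall, dist_zero_right, Real.norm_eq_abs] at this
    linarith

theorem abs_shift_sub_le (φ : CcFun) {B : ℝ} (hB : ∀ s, |(φ.iter 2).toFun s| ≤ B) (s y : ℝ) :
    |φ.toFun (s + y) - φ.toFun s - y * φ.deriv.toFun s| ≤ B * y ^ 2 := by
  have h1 : ∀ x, |φ.deriv.toFun x - φ.deriv.toFun s| ≤ B * |x - s| := fun x =>
    Convex.norm_image_sub_le_of_norm_hasDerivWithin_le
      (fun z _ => (φ.deriv.hasDerivAt z).hasDerivWithinAt) (fun z _ => hB z) convex_univ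
      (mem_univ s) (mem_univ x)
  have hB0 : 0 ≤ B := (abs_nonneg _).trans (hB 0)
  have h2 := Convex.norm_image_sub_le_of_norm_hasDerivWithin_le (s := Metric.closedBall s |y|)
    (f := fun x => φ.toFun x - x * φ.deriv.toFun s)
    (f' := fun x => φ.deriv.toFun x - 1 * φ.deriv.toFun s) (C := B * |y|)
    (fun z _ => ((φ.hasDerivAt z).sub ((hasDerivAt_id z).mul_const _)).hasDerivWithinAt)
    (fun z hz => by
      rw [one_mul]
      rw [Metric.mem_closedBall, Real.dist_eq] at hz
      exact (h1 z).trans (mul_le_mul_of_nonneg_left hz hB0)) (convex_closedBall _ _)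
    (Metric.mem_closedBall_self (abs_nonneg y)) (y := s + y)
    (by rw [Metric.mem_closedBall, Real.dist_eq, add_sub_cancel_left])
  rw [add_sub_cancel_left, Real.norm_eq_abs, Real.norm_eq_abs, mul_assoc, abs_mul_abs_self] at h2
  calc _ = |φ.toFun (s + y) - (s + y) * φ.deriv.toFun s - (φ.toFun s - s * φ.deriv.toFun s)| := by
        congr 1; ring
    _ ≤ _ := h2.trans_eq (by ring)

/-- The remainder `φ(· + T + y) - φ(· + T) - y φ'(· + T)`. -/
noncomputable def remainder (φ : CcFun) (T y : ℝ) : CcFun :=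
  ((φ.shift (T + y)).sub (φ.shift T)).sub ((φ.deriv.shift T).smul y)

theorem abs_iter_remainder_le (φ : CcFun) (T y : ℝ) (i : ℕ) {B : ℝ}
    (hB : ∀ s, |(φ.iter (i + 2)).toFun s| ≤ B) (s : ℝ) :
    |((φ.remainder T y).iter i).toFun s| ≤ B * y ^ 2 := by
  rw [remainder, iter_sub, iter_sub, iter_smul, iter_shift, iter_shift, iter_shift, iter_deriv]
  have := (φ.iter i).abs_shift_sub_le (B := B) hB (s + T) y
  rw [add_assoc] at this
  exact this

theorem remainder_eq_zero {φ : CcFun} {R : ℝ} (hφ : tsupport φ.toFun ⊆ Metric.closedBall 0 R)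
    {T y : ℝ} (hy : |y| ≤ 1) {s : ℝ} (hs : R + 1 < |s + T|) : (φ.remainder T y).toFun s = 0 := by
  change φ.toFun (s + (T + y)) - φ.toFun (s + T) - y * φ.deriv.toFun (s + T) = 0
  rw [eq_zero_of_lt_abs hφ, eq_zero_of_lt_abs hφ, eq_zero_of_lt_abs (φ := φ.deriv) ((support_iter_subset φ 1).trans hφ)]
  · ring
  · linarith
  · linarith
  · have := abs_sub_abs_le_abs_sub (s + T) (-y)
    rw [abs_neg, sub_neg_eq_add, add_assoc] at this
    linarith

theorem iter_eq_zero_of_forall {ψ : CcFun} {T R : ℝ} (h : ∀ s, R < |s + T| → ψ.toFun s = 0) (i : ℕ)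
    {s : ℝ} (hs : R < |s + T|) : (ψ.iter i).toFun s = 0 := by
  refine image_eq_zero_of_notMem_tsupport fun hi => ?_
  have h1 : tsupport ψ.toFun ⊆ Metric.closedBall (-T) R := by
    refine closure_minimal (fun x hx => ?_) Metric.isClosed_closedBall
    rw [Metric.mem_closedBall, Real.dist_eq, sub_neg_eq_add]
    by_contra hx1
    exact hx (h x (not_le.1 hx1))
  have h2 := h1 (support_iter_subset ψ i hi)
  rw [Metric.mem_closedBall, Real.dist_eq, sub_neg_eq_add] at h2
  linarith

end CcFun

namespace SobolevWeights

variable (w : SobolevWeights)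

theorem δ_nonneg (m : ℕ) : 0 ≤ w.δ m := by
  rw [← w.δ_zero]
  exact w.δ_mono.monotone (Nat.zero_le m)

theorem mul_β_le_abs (s : ℝ) : s * w.β s ≤ |s| :=
  (le_abs_self _).trans (by
    rw [abs_mul]
    exact mul_le_of_le_one_right (abs_nonneg _) (w.β_le s))

/-- For |s| ≥ 1 the exponent is |s|; otherwise it is at least -1 ≥ |s| - 2. The weight is thus
comparable with an exponential of |s| on the whole line. -/
theorem abs_sub_two_le (s : ℝ) : |s| - 2 ≤ s * w.β s := by
  rcases le_total 1 |s| with h | h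
  · rw [w.mul_β_eq_abs h]; linarith
  · linarith [w.mul_β_ge s]

theorem μ_closedBall_le (m : ℕ) {R T : ℝ} (hT : 0 ≤ T) :
    w.μ m (Metric.closedBall (-T) R) ≤
      ENNReal.ofReal (Real.exp (w.δ m * (T + R)) * (2 * R)) := by
  change volume.withDensity _ _ ≤ _
  rw [withDensity_apply _ Metric.isClosed_closedBall.measurableSet]
  refine (setLIntegral_mono (g := fun _ => ENNReal.ofReal (Real.exp (w.δ m * (T + R))))
    measurable_const fun s hs => ?_).trans ?_
  · refine ENNReal.ofReal_le_ofReal (Real.exp_le_exp.2 (mul_le_mul_of_nonneg_left ?_ (w.δ_nonneg m)))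
    rw [Metric.mem_closedBall, Real.dist_eq, sub_neg_eq_add] at hs
    refine (w.mul_β_le_abs s).trans ?_
    have := abs_sub_abs_le_abs_sub s (-T)
    rw [abs_neg, sub_neg_eq_add, abs_of_nonneg hT] at this
    linarith
  · rw [setLIntegral_const, Real.volume_closedBall, ← ENNReal.ofReal_mul (Real.exp_pos _).le]

theorem norm_toLp_le (m : ℕ) {R T B : ℝ} (hR : 0 ≤ R) (hT : 0 ≤ T) {ψ : CcFun}
    (h0 : ∀ s, R < |s + T| → ψ.toFun s = 0) (hB : ∀ s, |s + T| ≤ R → |ψ.toFun s| ≤ B) :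
    ‖(w.memLp_cc m ψ).toLp ψ.toFun‖ ≤
      Real.exp (w.δ m / 2 * T) * (Real.exp (w.δ m / 2 * R) * √(2 * R) * B) := by
  have hS : MeasurableSet (Metric.closedBall (-T) R) := Metric.isClosed_closedBall.measurableSet
  have hB0 : 0 ≤ B := (abs_nonneg _).trans (hB (-T) (by simpa using hR))
  have hmem : ∀ s, s ∈ Metric.closedBall (-T) R ↔ |s + T| ≤ R := fun s => by
    rw [Metric.mem_closedBall, Real.dist_eq, sub_neg_eq_add]
  rw [Lp.norm_toLp]
  refine ENNReal.toReal_le_of_le_ofReal (by positivity) ?_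
  have h1 : (Metric.closedBall (-T) R).indicator ψ.toFun = ψ.toFun := indicator_eq_self.2 fun s hs => by
    rw [hmem]
    by_contra h
    exact hs (h0 s (not_le.1 h))
  rw [← h1, eLpNorm_indicator_eq_eLpNorm_restrict hS]
  refine (eLpNorm_le_of_ae_bound (C := B) ((ae_restrict_iff' hS).2 (Eventually.of_forall
    fun s hs => hB s ((hmem s).1 hs)))).trans ?_
  rw [Measure.restrict_apply_univ]
  have h2 : Real.exp (w.δ m / 2 * T) * (Real.exp (w.δ m / 2 * R) * √(2 * R) * B) =
      (Real.exp (w.δ m * (T + R)) * (2 * R)) ^ (2⁻¹ : ℝ) * B := by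
    rw [Real.mul_rpow (Real.exp_pos _).le (by linarith), ← Real.exp_mul, Real.sqrt_eq_rpow,
      show w.δ m * (T + R) * 2⁻¹ = w.δ m / 2 * T + w.δ m / 2 * R by ring, Real.exp_add, one_div]
    ring
  rw [h2, ENNReal.ofReal_mul (by positivity),
    ← ENNReal.ofReal_rpow_of_nonneg (by positivity) (by norm_num), ENNReal.toReal_ofNat]
  gcongr
  exact w.μ_closedBall_le m hT

/-- A function supported near -T meets the weight e^{δ_m T} up to a constant factor, whose square
root appears in the norm. The constant depends on ψ only through R, so that Taylor remainders can be
inserted for ψ. -/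
theorem exists_norm_ofCc_le (m : ℕ) {R : ℝ} (hR : 0 ≤ R) : ∃ C, 0 ≤ C ∧ ∀ T, 0 ≤ T → ∀ (ψ : CcFun) (B : ℝ),
    (∀ s, R < |s + T| → ψ.toFun s = 0) → (∀ i ≤ m, ∀ s, |(ψ.iter i).toFun s| ≤ B) →
    ‖w.ofCc m ψ‖ ≤ C * B * Real.exp (w.δ m / 2 * T) := by
  refine ⟨√(m + 1) * (Real.exp (w.δ m / 2 * R) * √(2 * R)), by positivity, fun T hT ψ B h0 hB => ?_⟩
  have hB0 : 0 ≤ B := (abs_nonneg _).trans (hB 0 (Nat.zero_le m) 0)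
  set D := Real.exp (w.δ m / 2 * T) * (Real.exp (w.δ m / 2 * R) * √(2 * R) * B) with hD
  have h1 : ∀ i : Fin (m + 1), ‖(w.ofCc m ψ).1 i‖ ≤ D := fun i =>
    w.norm_toLp_le m hR hT (fun s hs => CcFun.iter_eq_zero_of_forall h0 i hs)
      fun s _ => hB i (by omega) s
  have h2 : ‖w.ofCc m ψ‖ ≤ √(m + 1) * D := by
    rw [Submodule.coe_norm, PiLp.norm_eq_of_L2]
    refine Real.sqrt_le_iff.2 ⟨by positivity, ?_⟩
    rw [mul_pow, Real.sq_sqrt (by positivity)]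
    refine (Finset.sum_le_sum fun i _ => pow_le_pow_left₀ (norm_nonneg _) (h1 i) 2).trans ?_
    simp
  refine h2.trans_eq ?_
  rw [hD]
  ring

/-- The pairing is represented by ψ divided by the weight. Near -T the division contributes a factor
of order e^{-δ_m T} and the norm a factor of order e^{δ_m T/2}; the product decays. -/
theorem exists_norm_pairCLM_le (m : ℕ) {R : ℝ} (hR : 0 ≤ R) : ∃ C, 0 ≤ C ∧ ∀ T, 0 ≤ T →
    ∀ (ψ : CcFun) (B : ℝ), (∀ s, R < |s + T| → ψ.toFun s = 0) → (∀ s, |ψ.toFun s| ≤ B) →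
    ‖w.pairCLM m ψ‖ ≤ C * B * Real.exp (-(w.δ m / 2) * T) := by
  refine ⟨Real.exp (w.δ m * (R + 2)) * (Real.exp (w.δ m / 2 * R) * √(2 * R)), by positivity,
    fun T hT ψ B h0 hB => ?_⟩
  have hB0 : 0 ≤ B := (abs_nonneg _).trans (hB 0)
  have h1 := w.norm_toLp_le m hR hT (ψ := w.unweight m ψ)
    (B := Real.exp (-(w.δ m * (T - R - 2))) * B) (fun s hs => by simp [unweight, h0 s hs])
    fun s hs => by
      simp only [unweight, abs_mul, abs_of_pos (Real.exp_pos _)]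
      refine mul_le_mul (Real.exp_le_exp.2 (neg_le_neg (mul_le_mul_of_nonneg_left ?_ (w.δ_nonneg m))))
        (hB s) (abs_nonneg _) (Real.exp_pos _).le
      have := abs_sub_abs_le_abs_sub T (s + T)
      rw [abs_of_nonneg hT, sub_add_cancel_right, abs_neg] at this
      linarith [w.abs_sub_two_le s]
  refine ContinuousLinearMap.opNorm_le_bound _ (by positivity) fun f => ?_
  have h2 : ‖w.pairCLM m ψ f‖ ≤ ‖(w.memLp_cc m (w.unweight m ψ)).toLp (w.unweight m ψ).toFun‖ *
      ‖w.comp m 0 f‖ := by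
    rw [pairCLM, ContinuousLinearMap.comp_apply, pairLp, innerSL_apply_apply]
    exact norm_inner_le_norm _ _
  refine h2.trans ((mul_le_mul h1 (w.norm_comp_le m 0 f) (norm_nonneg _) (by positivity)).trans_eq ?_)
  have h3 : Real.exp (w.δ m / 2 * T) * Real.exp (-(w.δ m * (T - R - 2))) =
      Real.exp (w.δ m * (R + 2)) * Real.exp (-(w.δ m / 2) * T) := by
    rw [← Real.exp_add, ← Real.exp_add]
    congr 1
    ring
  linear_combination (Real.exp (w.δ m / 2 * R) * √(2 * R) * B * ‖f‖) * h3

theorem pairCLM_add (m : ℕ) (φ ψ : CcFun) : w.pairCLM m (φ.add ψ) = w.pairCLM m φ + w.pairCLM m ψ := by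
  ext f
  rw [add_apply, pairCLM_apply, pairCLM_apply, pairCLM_apply]
  unfold pair
  rw [← integral_add (w.integrable_mul _ φ.continuous φ.compact)
    (w.integrable_mul _ ψ.continuous ψ.compact)]
  simp only [CcFun.add, mul_add]

theorem pairCLM_smul (m : ℕ) (c : ℝ) (φ : CcFun) : w.pairCLM m (φ.smul c) = c • w.pairCLM m φ := by
  ext f
  rw [smul_apply, pairCLM_apply, pairCLM_apply, smul_eq_mul]
  unfold pair
  rw [← integral_const_mul]
  simp only [CcFun.smul]
  congr 1
  ext s
  ring

theorem _root_.CcFun.sub_eq (φ ψ : CcFun) : φ.sub ψ = φ.add (ψ.smul (-1)) :=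
  CcFun.ext_toFun (funext fun s => by simp only [CcFun.sub, CcFun.add, CcFun.smul]; ring)

theorem pairCLM_sub (m : ℕ) (φ ψ : CcFun) : w.pairCLM m (φ.sub ψ) = w.pairCLM m φ - w.pairCLM m ψ := by
  ext f
  rw [CcFun.sub_eq, pairCLM_add, pairCLM_smul]
  simp [sub_eq_add_neg]

theorem ofCc_sub (m : ℕ) (φ ψ : CcFun) : w.ofCc m (φ.sub ψ) = w.ofCc m φ - w.ofCc m ψ := by
  rw [CcFun.sub_eq, ofCc_add, ofCc_smul, neg_one_smul ℝ, sub_eq_add_neg]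

theorem exists_bound_iter (φ : CcFun) (m : ℕ) : ∃ B, 0 ≤ B ∧ ∀ i ≤ m, ∀ s, |(φ.iter i).toFun s| ≤ B := by
  choose B hB using fun i => (φ.iter i).exists_bound
  have h0 : ∀ i, 0 ≤ B i := fun i => (abs_nonneg _).trans (hB i 0)
  refine ⟨∑ i ∈ Finset.range (m + 1), B i, Finset.sum_nonneg fun i _ => h0 i, fun i hi s => ?_⟩
  exact (hB i s).trans (Finset.single_le_sum (fun i _ => h0 i) (Finset.mem_range.2 (by omega)))

theorem exists_norm_ofCc_shift_le (m : ℕ) (φ : CcFun) : ∃ C, 0 ≤ C ∧ ∀ T, 0 ≤ T →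
    ‖w.ofCc m (φ.shift T)‖ ≤ C * Real.exp (w.δ m / 2 * T) := by
  obtain ⟨R, hR, hφ⟩ := φ.exists_tsupport_subset
  obtain ⟨C, hC0, hC⟩ := w.exists_norm_ofCc_le m hR
  obtain ⟨B, hB0, hB⟩ := exists_bound_iter φ m
  refine ⟨C * B, by positivity, fun T hT => hC T hT _ B (fun s hs => CcFun.eq_zero_of_lt_abs hφ hs) ?_⟩
  intro i hi s
  rw [CcFun.iter_shift]
  exact hB i hi _

theorem exists_norm_pairCLM_shift_le (m : ℕ) (φ : CcFun) : ∃ C, 0 ≤ C ∧ ∀ T, 0 ≤ T →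
    ‖w.pairCLM m (φ.shift T)‖ ≤ C * Real.exp (-(w.δ m / 2) * T) := by
  obtain ⟨R, hR, hφ⟩ := φ.exists_tsupport_subset
  obtain ⟨C, hC0, hC⟩ := w.exists_norm_pairCLM_le m hR
  obtain ⟨B, hB⟩ := φ.exists_bound
  have hB0 : 0 ≤ B := (abs_nonneg _).trans (hB 0)
  exact ⟨C * B, by positivity, fun T hT => hC T hT _ B (fun s hs => CcFun.eq_zero_of_lt_abs hφ hs)
    fun s => hB _⟩

theorem hasDerivAt_ofCc_shift (m : ℕ) (φ : CcFun) {T : ℝ} (hT : 0 ≤ T) :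
    HasDerivAt (fun T => w.ofCc m (φ.shift T)) (w.ofCc m (φ.deriv.shift T)) T := by
  obtain ⟨R, hR, hφ⟩ := φ.exists_tsupport_subset
  -- The radius is enlarged by 1 because the remainder involves translates by y with |y| ≤ 1.
  obtain ⟨C, hC0, hC⟩ := w.exists_norm_ofCc_le m (R := R + 1) (by linarith)
  obtain ⟨B, hB0, hB⟩ := exists_bound_iter φ (m + 2)
  refine hasDerivAt_of_norm_le_sq (F := w.sobolev m) (K := C * B * Real.exp (w.δ m / 2 * T)) fun y hy => ?_
  rw [← ofCc_smul, ← ofCc_sub, ← ofCc_sub]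
  refine (hC T hT (φ.remainder T y) (B * y ^ 2) (fun s hs => CcFun.remainder_eq_zero hφ hy hs)
    fun i hi s => φ.abs_iter_remainder_le T y i (hB (i + 2) (by omega)) s).trans_eq ?_
  ring

theorem hasDerivAt_pairCLM_shift (m : ℕ) (φ : CcFun) {T : ℝ} (hT : 0 ≤ T) :
    HasDerivAt (fun T => w.pairCLM m (φ.shift T)) (w.pairCLM m (φ.deriv.shift T)) T := by
  obtain ⟨R, hR, hφ⟩ := φ.exists_tsupport_subset
  obtain ⟨C, hC0, hC⟩ := w.exists_norm_pairCLM_le m (R := R + 1) (by linarith)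
  obtain ⟨B, hB⟩ := (φ.iter 2).exists_bound
  refine hasDerivAt_of_norm_le_sq (F := w.sobolev m →L[ℝ] ℝ)
    (K := C * B * Real.exp (-(w.δ m / 2) * T)) fun y hy => ?_
  rw [← pairCLM_smul, ← pairCLM_sub, ← pairCLM_sub]
  refine (hC T hT (φ.remainder T y) (B * y ^ 2) (fun s hs => CcFun.remainder_eq_zero hφ hy hs)
    fun s => φ.abs_iter_remainder_le T y 0 hB s).trans_eq ?_
  ring

end SobolevWeights

/-! ### Smooth families which are flat at the origin -/

section FlatFamily

variable {F : Type*} [NormedAddCommGroup F] [NormedSpace ℝ F]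

open Classical in
/-- The function `t ↦ t^{-p} e^{q/t} Q(e^{1/t})`, extended by `0` to `t ≤ 0`. -/
noncomputable def flatFamily (p q : ℕ) (Q : ℝ → F) (t : ℝ) : F :=
  if t ≤ 0 then 0 else ((1 / t) ^ p * Real.exp (1 / t) ^ q) • Q (Real.exp (1 / t))

theorem flatFamily_of_nonpos (p q : ℕ) (Q : ℝ → F) {t : ℝ} (ht : t ≤ 0) : flatFamily p q Q t = 0 :=
  if_pos ht

theorem flatFamily_of_pos (p q : ℕ) (Q : ℝ → F) {t : ℝ} (ht : 0 < t) :
    flatFamily p q Q t = ((1 / t) ^ p * Real.exp (1 / t) ^ q) • Q (Real.exp (1 / t)) :=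
  if_neg ht.not_ge

theorem norm_flatFamily_le (p q : ℕ) {Q : ℝ → F} {κ C : ℝ}
    (hQ : ∀ T, 0 ≤ T → ‖Q T‖ ≤ C * Real.exp (-κ * T)) {t : ℝ} (ht : 0 < t) :
    ‖flatFamily p q Q t‖ ≤ C * (Real.exp (1 / t) ^ (p + q) * Real.exp (-κ * Real.exp (1 / t))) := by
  have h1 : 0 < 1 / t := one_div_pos.2 ht
  have h2 : 1 / t ≤ Real.exp (1 / t) := by linarith [Real.add_one_le_exp (1 / t)]
  rw [flatFamily_of_pos p q Q ht, norm_smul, Real.norm_eq_abs, abs_of_nonneg (by positivity), pow_add]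
  calc _ ≤ (Real.exp (1 / t) ^ p * Real.exp (1 / t) ^ q) *
        (C * Real.exp (-κ * Real.exp (1 / t))) := by
        gcongr
        exact hQ _ (Real.exp_pos _).le
    _ = _ := by ring

/-- With T = e^{1/t} one has 1/t ≤ T, so all prefactors are bounded by a power of T, and e^{-κT}
beats every power as T tends to infinity. -/
theorem tendsto_norm_flatFamily (p q : ℕ) {Q : ℝ → F} {κ C : ℝ} (hκ : 0 < κ)
    (hQ : ∀ T, 0 ≤ T → ‖Q T‖ ≤ C * Real.exp (-κ * T)) :
    Tendsto (flatFamily p q Q) (𝓝[>] 0) (𝓝 0) := by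
  have h1 : Tendsto (fun t : ℝ => Real.exp (1 / t)) (𝓝[>] 0) atTop := by
    simp only [one_div]
    exact Real.tendsto_exp_atTop.comp tendsto_inv_nhdsGT_zero
  have h2 : Tendsto (fun T : ℝ => C * (T ^ (p + q) * Real.exp (-κ * T))) atTop (𝓝 0) := by
    have := (tendsto_rpow_mul_exp_neg_mul_atTop_nhds_zero ((p + q : ℕ) : ℝ) κ hκ).const_mul C
    simpa only [Real.rpow_natCast, mul_zero] using this
  refine squeeze_zero_norm' ?_ (h2.comp h1)
  filter_upwards [self_mem_nhdsWithin] with t ht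
  exact norm_flatFamily_le p q hQ ht

/-- For t ≠ 0 this is the product and chain rule. At 0 the difference quotient from the right is the
flat family with p + 1 in place of p, which tends to 0. -/
theorem hasDerivAt_flatFamily (p q : ℕ) {Q Q' : ℝ → F} {κ C : ℝ} (hκ : 0 < κ)
    (hQ : ∀ T, 0 ≤ T → ‖Q T‖ ≤ C * Real.exp (-κ * T))
    (hd : ∀ T, 0 < T → HasDerivAt Q (Q' T) T) (t : ℝ) :
    HasDerivAt (flatFamily p q Q) (-((p : ℝ) • flatFamily (p + 1) q Q t +
      (q : ℝ) • flatFamily (p + 2) q Q t + flatFamily (p + 2) (q + 1) Q' t)) t := by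
  rcases lt_trichotomy t 0 with ht | rfl | ht
  · rw [flatFamily_of_nonpos _ _ _ ht.le, flatFamily_of_nonpos _ _ _ ht.le,
      flatFamily_of_nonpos _ _ _ ht.le, smul_zero, smul_zero, add_zero, add_zero, neg_zero]
    refine (hasDerivAt_const t (0 : F)).congr_of_eventuallyEq ?_
    filter_upwards [Iio_mem_nhds ht] with s hs
    exact flatFamily_of_nonpos _ _ _ (le_of_lt hs)
  · rw [flatFamily_of_nonpos _ _ _ le_rfl, flatFamily_of_nonpos _ _ _ le_rfl,
      flatFamily_of_nonpos _ _ _ le_rfl, smul_zero, smul_zero, add_zero, add_zero, neg_zero]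
    rw [hasDerivAt_iff_tendsto_slope]
    have h0 : Tendsto (slope (flatFamily p q Q) 0) (𝓝[<] 0) (𝓝 0) := by
      refine tendsto_const_nhds.congr' ?_
      filter_upwards [self_mem_nhdsWithin] with s hs
      rw [slope_def_module, flatFamily_of_nonpos _ _ _ (le_of_lt hs), flatFamily_of_nonpos _ _ _ le_rfl,
        sub_self, smul_zero]
    have h1 : Tendsto (slope (flatFamily p q Q) 0) (𝓝[>] 0) (𝓝 0) := by
      refine (tendsto_norm_flatFamily (p + 1) q hκ hQ).congr' ?_
      filter_upwards [self_mem_nhdsWithin] with s hs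
      rw [slope_def_module, flatFamily_of_pos _ _ _ hs, flatFamily_of_nonpos _ _ _ le_rfl,
        flatFamily_of_pos _ _ _ hs, sub_zero, sub_zero, smul_smul]
      congr 1
      rw [one_div]
      ring
    rw [← nhdsLT_sup_nhdsGT]
    exact h0.sup h1
  · have e1 : HasDerivAt (fun t : ℝ => 1 / t) (-(1 / t) ^ 2) t := by
      have := hasDerivAt_inv ht.ne'
      simp only [one_div]
      rwa [inv_pow]
    have e2 := e1.exp
    have e3 := (e1.pow p).mul (e2.pow q)
    have e4 := e3.smul ((hd _ (Real.exp_pos (1 / t))).scomp t e2)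
    refine (e4.congr_of_eventuallyEq ?_).congr_deriv ?_
    · filter_upwards [Ioi_mem_nhds ht] with s hs
      exact flatFamily_of_pos _ _ _ hs
    · rw [flatFamily_of_pos _ _ _ ht, flatFamily_of_pos _ _ _ ht, flatFamily_of_pos _ _ _ ht]
      have p1 : (p : ℝ) * (1 / t) ^ (p - 1) * (1 / t) = p * (1 / t) ^ p := by
        rcases p with _ | p
        · simp
        · rw [Nat.add_sub_cancel, pow_succ]; ring
      have p2 : (q : ℝ) * Real.exp (1 / t) ^ (q - 1) * Real.exp (1 / t) = q * Real.exp (1 / t) ^ q := by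
        rcases q with _ | q
        · simp
        · rw [Nat.add_sub_cancel, pow_succ]; ring
      simp only [Pi.pow_apply, Pi.mul_apply, Function.comp_apply]
      simp only [smul_smul, ← add_smul, neg_add, ← neg_smul]
      rw [add_comm]
      congr 2
      · generalize Real.exp (1 / t) = E at *
        generalize 1 / t = a at *
        linear_combination (-a * E ^ q) * p1 - a ^ (p + 2) * p2
      · ring

/-- Differentiation stays within flat families, raising p and q and passing from `Q j` to `Q (j +
1)`. The induction on the order therefore quantifies over all p, q and j. -/
theorem contDiff_flatFamily (p q : ℕ) {Q : ℕ → ℝ → F} {κ : ℝ} (hκ : 0 < κ)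
    (hQ : ∀ j, ∃ C, ∀ T, 0 ≤ T → ‖Q j T‖ ≤ C * Real.exp (-κ * T))
    (hd : ∀ j T, 0 < T → HasDerivAt (Q j) (Q (j + 1) T) T) : ContDiff ℝ ∞ (flatFamily p q (Q 0)) := by
  have hD : ∀ j p q t, HasDerivAt (flatFamily p q (Q j)) (-((p : ℝ) • flatFamily (p + 1) q (Q j) t +
      (q : ℝ) • flatFamily (p + 2) q (Q j) t + flatFamily (p + 2) (q + 1) (Q (j + 1)) t)) t :=
    fun j p q t => by
      obtain ⟨C, h⟩ := hQ j
      exact hasDerivAt_flatFamily p q hκ h (hd j) t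
  rw [contDiff_infty]
  suffices h : ∀ n : ℕ, ∀ j p q, ContDiff ℝ n (flatFamily p q (Q j)) from fun n => h n 0 p q
  intro n
  induction n with
  | zero =>
    intro j p q
    rw [Nat.cast_zero, contDiff_zero, continuous_iff_continuousAt]
    exact fun t => (hD j p q t).continuousAt
  | succ n ih =>
    intro j p q
    rw [Nat.cast_succ, contDiff_succ_iff_deriv]
    refine ⟨fun t => (hD j p q t).differentiableAt, by simp, ?_⟩
    rw [funext fun t => (hD j p q t).deriv]
    exact ((((ih j _ _).const_smul _).add ((ih j _ _).const_smul _)).add (ih (j + 1) _ _)).neg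

end FlatFamily

/-! ### Families of operators of rank one -/

/-- Uniform boundedness reduces joint continuity to continuity in t on a dense set of vectors. This
is what remains when no level is lost, where there need be no decay in operator norm. -/
theorem continuous_uncurry_of_denseRange {X H F : Type*} [NormedAddCommGroup H] [NormedSpace ℝ H]
    [NormedAddCommGroup F] [NormedSpace ℝ F] {p : ℝ → H →L[ℝ] F} {C : ℝ} (hC : ∀ t, ‖p t‖ ≤ C)
    {e : X → H} (he : DenseRange e) (h : ∀ x, Continuous fun t => p t (e x)) :
    Continuous fun x : ℝ × H => p x.1 x.2 := by
  have hC0 : 0 ≤ C := (norm_nonneg _).trans (hC 0)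
  rw [Metric.continuous_iff]
  rintro ⟨t₀, x₀⟩ ε hε
  have hη : 0 < ε / (4 * (C + 1)) := by positivity
  obtain ⟨z, hz⟩ := he.exists_dist_lt x₀ hη
  obtain ⟨η, hη0, hη1⟩ := Metric.continuous_iff.1 (h z) t₀ (ε / 4) (by positivity)
  refine ⟨min η (ε / (4 * (C + 1))), lt_min hη0 hη, ?_⟩
  rintro ⟨t, x⟩ hd
  rw [Prod.dist_eq, max_lt_iff] at hd
  have h1 := hη1 t (hd.1.trans_le (min_le_left _ _))
  have h2 : ‖x - x₀‖ < ε / (4 * (C + 1)) := by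
    rw [← dist_eq_norm]; exact hd.2.trans_le (min_le_right _ _)
  rw [dist_eq_norm] at h1 hz
  have key : ∀ y, ‖y‖ ≤ ε / (4 * (C + 1)) → ∀ s, ‖p s y‖ ≤ ε / 4 := fun y hy s => by
    refine ((p s).le_of_opNorm_le (hC s) y).trans ?_
    calc C * ‖y‖ ≤ (C + 1) * (ε / (4 * (C + 1))) := by gcongr; linarith
      _ = ε / 4 := by field_simp
  rw [dist_eq_norm]
  have e1 : p t x - p t₀ x₀ = p t (x - x₀) + p t (x₀ - e z) + (p t (e z) - p t₀ (e z)) -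
      p t₀ (x₀ - e z) := by
    simp only [map_sub]; abel
  rw [e1]
  have a1 := key _ h2.le t
  have a2 := key _ hz.le t
  have a3 := key _ hz.le t₀
  calc _ ≤ ‖p t (x - x₀)‖ + ‖p t (x₀ - e z)‖ + ‖p t (e z) - p t₀ (e z)‖ + ‖p t₀ (x₀ - e z)‖ :=
        (norm_sub_le _ _).trans (add_le_add_left ((norm_add_le _ _).trans
          (add_le_add_left (norm_add_le _ _) _)) _)
    _ < ε := by linarith

theorem norm_flatFamily_zero_le {F : Type*} [NormedAddCommGroup F] [NormedSpace ℝ F] {Q : ℝ → F}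
    {C : ℝ} (hC : 0 ≤ C) (hQ : ∀ T, 0 ≤ T → ‖Q T‖ ≤ C) (t : ℝ) : ‖flatFamily 0 0 Q t‖ ≤ C := by
  rcases le_or_gt t 0 with ht | ht
  · rwa [flatFamily_of_nonpos _ _ _ ht, norm_zero]
  · rw [flatFamily_of_pos _ _ _ ht, pow_zero, pow_zero, one_mul, one_smul]
    exact hQ _ (Real.exp_pos _).le

theorem flatFamily_comp {X Y Z : Type*} [NormedAddCommGroup X] [NormedSpace ℝ X]
    [NormedAddCommGroup Y] [NormedSpace ℝ Y] [NormedAddCommGroup Z] [NormedSpace ℝ Z] (p q : ℕ)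
    {Q : ℝ → Y →L[ℝ] Z} {P : ℝ → X →L[ℝ] Z} (L : X →L[ℝ] Y) (h : ∀ T, (Q T).comp L = P T) (t : ℝ) :
    (flatFamily p q Q t).comp L = flatFamily p q P t := by
  rcases le_or_gt t 0 with ht | ht
  · rw [flatFamily_of_nonpos _ _ _ ht, flatFamily_of_nonpos _ _ _ ht, ContinuousLinearMap.zero_comp]
  · rw [flatFamily_of_pos _ _ _ ht, flatFamily_of_pos _ _ _ ht, ContinuousLinearMap.smul_comp, h]

theorem apply_flatFamily {X Y X' Y' : Type*} [NormedAddCommGroup X] [NormedSpace ℝ X]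
    [NormedAddCommGroup Y] [NormedSpace ℝ Y] [NormedAddCommGroup X'] [NormedSpace ℝ X']
    [NormedAddCommGroup Y'] [NormedSpace ℝ Y'] (p q : ℕ) {Q : ℝ → X →L[ℝ] Y} {P : ℝ → X' →L[ℝ] Y'}
    (L : Y →ₗ[ℝ] Y') {x : X} {x' : X'} (h : ∀ T, L (Q T x) = P T x') (t : ℝ) :
    L (flatFamily p q Q t x) = flatFamily p q P t x' := by
  rcases le_or_gt t 0 with ht | ht
  · rw [flatFamily_of_nonpos _ _ _ ht, flatFamily_of_nonpos _ _ _ ht, zero_apply, zero_apply,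
      map_zero]
  · rw [flatFamily_of_pos _ _ _ ht, flatFamily_of_pos _ _ _ ht, smul_apply, smul_apply, map_smul, h]

theorem deriv_flatFamily_zero {F : Type*} [NormedAddCommGroup F] [NormedSpace ℝ F] {Q Q' : ℝ → F}
    {κ C : ℝ} (hκ : 0 < κ) (hQ : ∀ T, 0 ≤ T → ‖Q T‖ ≤ C * Real.exp (-κ * T))
    (hd : ∀ T, 0 < T → HasDerivAt Q (Q' T) T) (t : ℝ) :
    deriv (flatFamily 0 0 Q) t = -flatFamily 2 1 Q' t := by
  rw [(hasDerivAt_flatFamily 0 0 hκ hQ hd t).deriv]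
  simp

/-- The derivatives of a family which obeys the Leibniz rule. -/
noncomputable def leibnizDeriv {G : Type*} [AddCommGroup G] (R : CcFun → CcFun → ℝ → G) :
    ℕ → CcFun → CcFun → ℝ → G
  | 0, φ, ψ => R φ ψ
  | j + 1, φ, ψ => fun T => leibnizDeriv R j φ.deriv ψ T + leibnizDeriv R j φ ψ.deriv T

theorem contDiff_flatFamily_of_leibniz {G : Type*} [NormedAddCommGroup G] [NormedSpace ℝ G]
    {R : CcFun → CcFun → ℝ → G} {κ : ℝ} (hκ : 0 < κ)
    (hb : ∀ φ ψ, ∃ C, ∀ T, 0 ≤ T → ‖R φ ψ T‖ ≤ C * Real.exp (-κ * T))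
    (hd : ∀ φ ψ T, 0 < T → HasDerivAt (R φ ψ) (R φ.deriv ψ T + R φ ψ.deriv T) T) (p q : ℕ)
    (φ ψ : CcFun) : ContDiff ℝ ∞ (flatFamily p q (R φ ψ)) := by
  refine contDiff_flatFamily p q (Q := fun j => leibnizDeriv R j φ ψ) hκ (fun j => ?_)
    fun j T hT => ?_
  · induction j generalizing φ ψ with
    | zero => exact hb φ ψ
    | succ j ih =>
      obtain ⟨C, hC⟩ := ih φ.deriv ψ
      obtain ⟨D, hD⟩ := ih φ ψ.deriv
      exact ⟨C + D, fun T hT => (norm_add_le _ _).trans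
        ((add_le_add (hC T hT) (hD T hT)).trans_eq (add_mul _ _ _).symm)⟩
  · induction j generalizing φ ψ with
    | zero => exact hd φ ψ T hT
    | succ j ih => exact (ih φ.deriv ψ).add (ih φ ψ.deriv)

theorem HasDerivAt.smulRight {H F : Type*} [NormedAddCommGroup H] [NormedSpace ℝ H]
    [NormedAddCommGroup F] [NormedSpace ℝ F] {c : ℝ → H →L[ℝ] ℝ} {c' : H →L[ℝ] ℝ} {v : ℝ → F} {v' : F}
    {T : ℝ} (hc : HasDerivAt c c' T) (hv : HasDerivAt v v' T) :
    HasDerivAt (fun T => (c T).smulRight (v T)) (c'.smulRight (v T) + (c T).smulRight v') T := by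
  have h := ((ContinuousLinearMap.smulRightL ℝ H F).isBoundedBilinearMap.hasFDerivAt
    (c T, v T)).comp_hasDerivAt T (hc.prodMk hv)
  rw [add_comm]
  exact h

/-- A uniformly bounded flat family of operators which is smooth after the loss of one level defines
an sc-smooth map. -/
theorem isSc_and_isTangentMap_flatFamily {H F : ScScale} (hH : H.IsScBanach) (hF : F.IsScBanach)
    (Q : ∀ m, ℝ → H.X m →L[ℝ] F.X m) (P P' : ∀ m, ℝ → H.X (m + 1) →L[ℝ] F.X m) {κ : ℕ → ℝ}
    (hκ : ∀ m, 0 < κ m) (hQ : ∀ m, ∃ C, 0 ≤ C ∧ ∀ T, 0 ≤ T → ‖Q m T‖ ≤ C)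
    (hQP : ∀ m T, (Q m T).comp (hH.clmι m) = P m T)
    (hPs : ∀ m, ContDiff ℝ ∞ (flatFamily 0 0 (P m)))
    (hPb : ∀ m, ∃ C, ∀ T, 0 ≤ T → ‖P m T‖ ≤ C * Real.exp (-κ m * T))
    (hPd : ∀ m T, 0 < T → HasDerivAt (P m) (P' m T) T)
    (hc : ∀ m T x, F.ι m (Q (m + 1) T x) = Q m T (H.ι m x)) :
    (∀ k, IsSc k ((ScScale.const ℝ).prod H) F univ (fun m x => flatFamily 0 0 (Q m) x.1 x.2)) ∧
    IsTangentMap ((ScScale.const ℝ).prod H) F univ (fun m x => flatFamily 0 0 (Q m) x.1 x.2)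
      (fun m y => (flatFamily 0 0 (Q (m + 1)) y.1.1 y.1.2,
        flatFamily 0 0 (Q m) y.1.1 y.2.2 - (y.2.1 : ℝ) • flatFamily 2 1 (P' m) y.1.1 y.1.2)) := by
  have e : ∀ m, (fun t => (flatFamily 0 0 (Q m) t).comp (hH.clmι m)) = flatFamily 0 0 (P m) :=
    fun m => funext fun t => flatFamily_comp 0 0 _ (hQP m) t
  have hd : ∀ m t, deriv (fun t => (flatFamily 0 0 (Q m) t).comp (hH.clmι m)) t =
      -flatFamily 2 1 (P' m) t := fun m t => by
    obtain ⟨C, hC⟩ := hPb m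
    rw [e, deriv_flatFamily_zero (hκ m) hC (hPd m)]
  have h := isSc_and_isTangentMap_strongFamily hH hF (fun m => flatFamily 0 0 (Q m)) (fun m => ?_)
    (fun m => by rw [e]; exact hPs m) fun m t x => apply_flatFamily 0 0 (F.ι m) (fun T => hc m T x) t
  · refine ⟨h.1, ?_⟩
    simp only [hd, neg_apply, smul_neg, ← sub_eq_add_neg] at h
    exact h.2
  · obtain ⟨C, hC, h⟩ := hQ m
    -- The dense set consists of the vectors coming from one level higher, where the family is
    -- smooth in operator norm.
    refine continuous_uncurry_of_denseRange (norm_flatFamily_zero_le hC h) (hH.denseRange_ι m)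
      fun x => ?_
    have h1 := (hPs m).continuous
    have h2 : Continuous fun t => flatFamily 0 0 (P m) t x := by fun_prop
    exact h2.congr fun t => by rw [← e]; rfl

namespace SobolevWeights

variable (w : SobolevWeights)

/-- The operator `f ↦ ⟨f, φ(· + T)⟩ ψ(· + T)` from the level `l` to the level `m`. -/
noncomputable def rank (l m : ℕ) (φ ψ : CcFun) (T : ℝ) : w.sobolev l →L[ℝ] w.sobolev m :=
  (w.pairCLM l (φ.shift T)).smulRight (w.ofCc m (ψ.shift T))

theorem rank_apply (l m : ℕ) (φ ψ : CcFun) (T : ℝ) (f : w.sobolev l) :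
    w.rank l m φ ψ T f = w.pair f (φ.shift T) • w.ofCc m (ψ.shift T) := by
  rw [rank, ContinuousLinearMap.smulRight_apply, pairCLM_apply]

/-- Pairing on level l decays like e^{-δ_l T/2}, and the translated function grows at most like
e^{δ_m T/2} on level m. The bound decays for m < l and is constant for l = m. -/
theorem exists_norm_rank_le (l m : ℕ) (φ ψ : CcFun) : ∃ C, 0 ≤ C ∧ ∀ T, 0 ≤ T →
    ‖w.rank l m φ ψ T‖ ≤ C * Real.exp (-((w.δ l - w.δ m) / 2) * T) := by
  obtain ⟨C, hC, h⟩ := w.exists_norm_pairCLM_shift_le l φ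
  obtain ⟨D, hD, h'⟩ := w.exists_norm_ofCc_shift_le m ψ
  refine ⟨C * D, by positivity, fun T hT => ?_⟩
  rw [rank, ContinuousLinearMap.norm_smulRight_apply]
  refine (mul_le_mul (h T hT) (h' T hT) (norm_nonneg _) (by positivity)).trans_eq ?_
  rw [mul_mul_mul_comm, ← Real.exp_add]
  congr 2
  ring

theorem hasDerivAt_rank (l m : ℕ) (φ ψ : CcFun) {T : ℝ} (hT : 0 ≤ T) :
    HasDerivAt (w.rank l m φ ψ) (w.rank l m φ.deriv ψ T + w.rank l m φ ψ.deriv T) T :=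
  (w.hasDerivAt_pairCLM_shift l φ hT).smulRight (w.hasDerivAt_ofCc_shift m ψ hT)

theorem contDiff_rank {l m : ℕ} (hlm : m < l) (φ ψ : CcFun) (p q : ℕ) :
    ContDiff ℝ ∞ (flatFamily p q (w.rank l m φ ψ)) :=
  contDiff_flatFamily_of_leibniz (half_pos (sub_pos.2 (w.δ_mono hlm)))
    (fun φ ψ => (w.exists_norm_rank_le l m φ ψ).imp fun _ h => h.2)
    (fun φ ψ _ hT => w.hasDerivAt_rank l m φ ψ hT.le) p q φ ψ

theorem δ_pos {l : ℕ} (hl : 0 < l) : 0 < w.δ l := by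
  rw [← w.δ_zero]
  exact w.δ_mono hl

theorem contDiff_pairCLM {l : ℕ} (hl : 0 < l) (φ : CcFun) (p q : ℕ) :
    ContDiff ℝ ∞ (flatFamily p q fun T => w.pairCLM l (φ.shift T)) :=
  contDiff_flatFamily p q (Q := fun j T => w.pairCLM l ((φ.iter j).shift T)) (κ := w.δ l / 2)
    (half_pos (w.δ_pos hl)) (fun j => (w.exists_norm_pairCLM_shift_le l (φ.iter j)).imp fun _ h => h.2)
    fun j _ hT => w.hasDerivAt_pairCLM_shift l (φ.iter j) hT.le

theorem sobolevIncl_rank (l m : ℕ) (φ ψ : CcFun) (T : ℝ) (f : w.sobolev (l + 1)) :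
    w.sobolevIncl m (w.rank (l + 1) (m + 1) φ ψ T f) = w.rank l m φ ψ T (w.sobolevIncl l f) := by
  rw [rank_apply, rank_apply, map_smul, sobolevIncl_ofCc, pair_sobolevIncl]

/-- The operators `t^{-p} e^{q/t} ⟨·, φ(· + e^{1/t})⟩ ψ(· + e^{1/t})` form an sc-smooth family which
gains one level. -/
theorem isSc_rank_shift (p q : ℕ) (φ ψ : CcFun) (k : ℕ) :
    IsSc k ((ScScale.const ℝ).prod w.scale.shift) w.scale univ
      (fun m x => flatFamily p q (w.rank (m + 1) m φ ψ) x.1 x.2) :=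
  isSc_smoothFamily w.isScBanach_scale w.isScBanach_scale
    (fun m => flatFamily p q (w.rank (m + 1) m φ ψ))
    (fun m => w.contDiff_rank (Nat.lt_succ_self m) φ ψ p q)
    fun m t x => apply_flatFamily p q (w.sobolevIncl m)
      (fun T => w.sobolevIncl_rank (m + 1) m φ ψ T x) t

theorem isSc_and_isTangentMap_rank (φ ψ : CcFun) :
    (∀ k, IsSc k ((ScScale.const ℝ).prod w.scale) w.scale univ
      (fun m x => flatFamily 0 0 (w.rank m m φ ψ) x.1 x.2)) ∧
    IsTangentMap ((ScScale.const ℝ).prod w.scale) w.scale univ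
      (fun m x => flatFamily 0 0 (w.rank m m φ ψ) x.1 x.2)
      (fun m y => (flatFamily 0 0 (w.rank (m + 1) (m + 1) φ ψ) y.1.1 y.1.2,
        flatFamily 0 0 (w.rank m m φ ψ) y.1.1 y.2.2 - (y.2.1 : ℝ) • flatFamily 2 1
          (fun T => w.rank (m + 1) m φ.deriv ψ T + w.rank (m + 1) m φ ψ.deriv T) y.1.1 y.1.2)) :=
  isSc_and_isTangentMap_flatFamily w.isScBanach_scale w.isScBanach_scale
    (fun m => w.rank m m φ ψ) (fun m => w.rank (m + 1) m φ ψ)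
    (fun m T => w.rank (m + 1) m φ.deriv ψ T + w.rank (m + 1) m φ ψ.deriv T)
    (κ := fun m => (w.δ (m + 1) - w.δ m) / 2)
    (fun m => half_pos (sub_pos.2 (w.δ_mono (Nat.lt_succ_self m))))
    (fun m => (w.exists_norm_rank_le m m φ ψ).imp fun C h => ⟨h.1, fun T hT => by
      simpa using h.2 T hT⟩)
    (fun m T => ContinuousLinearMap.ext fun f => by
      rw [ContinuousLinearMap.comp_apply, rank_apply, rank_apply]
      congr 1
      exact w.pair_sobolevIncl m _ f)
    (fun m => w.contDiff_rank (Nat.lt_succ_self m) φ ψ 0 0)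
    (fun m => (w.exists_norm_rank_le (m + 1) m φ ψ).imp fun _ h => h.2)
    (fun m _ hT => w.hasDerivAt_rank (m + 1) m φ ψ hT.le)
    fun m T x => w.sobolevIncl_rank m m φ ψ T x

/-- The target carries the constant scale, so the decay is that of the pairing alone. On level 0 the
bound is constant as δ_0 = 0; after the loss of a level the rate δ_{m+1}/2 is positive. -/
theorem isSc_and_isTangentMap_pairCLM (φ : CcFun) :
    (∀ k, IsSc k ((ScScale.const ℝ).prod w.scale) (ScScale.const ℝ) univ
      (fun m x => flatFamily 0 0 (fun T => w.pairCLM m (φ.shift T)) x.1 x.2)) ∧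
    IsTangentMap ((ScScale.const ℝ).prod w.scale) (ScScale.const ℝ) univ
      (fun m x => flatFamily 0 0 (fun T => w.pairCLM m (φ.shift T)) x.1 x.2)
      (fun m y => (flatFamily 0 0 (fun T => w.pairCLM (m + 1) (φ.shift T)) y.1.1 y.1.2,
        flatFamily 0 0 (fun T => w.pairCLM m (φ.shift T)) y.1.1 y.2.2 - (y.2.1 : ℝ) •
          flatFamily 2 1 (fun T => w.pairCLM (m + 1) (φ.deriv.shift T)) y.1.1 y.1.2)) :=
  isSc_and_isTangentMap_flatFamily w.isScBanach_scale (ScScale.IsScBanach.const ℝ)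
    (fun m T => w.pairCLM m (φ.shift T)) (fun m T => w.pairCLM (m + 1) (φ.shift T))
    (fun m T => w.pairCLM (m + 1) (φ.deriv.shift T)) (κ := fun m => w.δ (m + 1) / 2)
    (fun m => half_pos (w.δ_pos (Nat.succ_pos m)))
    (fun m => (w.exists_norm_pairCLM_shift_le m φ).imp fun C h => ⟨h.1, fun T hT =>
      (h.2 T hT).trans (mul_le_of_le_one_right h.1
        (Real.exp_le_one_iff.2 (by nlinarith [w.δ_nonneg m])))⟩)
    (fun m T => ContinuousLinearMap.ext fun f => by
      rw [ContinuousLinearMap.comp_apply, pairCLM_apply, pairCLM_apply]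
      exact w.pair_sobolevIncl m _ f)
    (fun m => w.contDiff_pairCLM (Nat.succ_pos m) φ 0 0)
    (fun m => (w.exists_norm_pairCLM_shift_le (m + 1) φ).imp fun _ h => h.2)
    (fun m _ hT => w.hasDerivAt_pairCLM_shift (m + 1) φ hT.le)
    fun m T x => by
      rw [pairCLM_apply, pairCLM_apply]
      exact (w.pair_sobolevIncl m _ x).symm

end SobolevWeights

/-! ### Bilinear tensors pulled back along an immersion: nondegeneracy and smoothness. -/

namespace ScRetract

theorem IsMPolyfold.scDeriv_r_mem {M : ScRetract} (hM : M.IsMPolyfold) (p : M.E.X 1)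
    (v : M.E.X 0) : scDeriv M.E M.E univ M.r p v ∈ M.tangentSpace (M.r 1 p) := by
  have h := hM.Tr_Tr 0 (p, v)
  rw [hM.Tr_zero p v, hM.Tr_zero] at h
  exact ⟨_, congrArg Prod.snd h⟩

namespace IsImmersion

variable {M : ScRetract} {V : Type} [NormedAddCommGroup V] [NormedSpace ℝ V]
  [FiniteDimensional ℝ V] {Φ : ScFun M.E (ScScale.const V)} {b : M.E.X 1 → M.E.X 0 → M.E.X 0 → ℝ}
  {B : V →L[ℝ] V →L[ℝ] ℝ}

theorem finiteDimensional_tangentSpace (hΦ : M.IsImmersion Φ) {p : M.E.X 1} (hp : p ∈ M.pts 1) :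
    FiniteDimensional ℝ (M.tangentSpace p) := by
  refine FiniteDimensional.of_injective (V₂ := V)
    ((scDeriv M.E (ScScale.const V) univ Φ p).toLinearMap.domRestrict (M.tangentSpace p))
    ((injective_iff_map_eq_zero _).2 fun v hv => ?_)
  exact Subtype.ext (hΦ.injective p hp v v.2 hv)

/-- The tangent spaces embed into V, hence are finite-dimensional. An injective linear map to the
dual, which has the same dimension, is then automatically a topological isomorphism. -/
theorem isStronglyNondegenerate (hΦ : M.IsImmersion Φ)
    (hb : ∀ p ∈ M.pts 1, ∀ v ∈ M.tangentSpace p, ∀ w ∈ M.tangentSpace p, b p v w =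
      B (scDeriv M.E (ScScale.const V) univ Φ p v) (scDeriv M.E (ScScale.const V) univ Φ p w))
    (hb0 : ∀ p ∈ M.pts 1, ∀ v ∈ M.tangentSpace p, v ≠ 0 → ∃ w ∈ M.tangentSpace p, b p v w ≠ 0) :
    M.IsStronglyNondegenerate b := by
  intro p hp
  have := hΦ.finiteDimensional_tangentSpace hp
  let D : M.tangentSpace p →L[ℝ] V :=
    (scDeriv M.E (ScScale.const V) univ Φ p).comp (M.tangentSpace p).subtypeL
  let L : M.tangentSpace p →L[ℝ] StrongDual ℝ (M.tangentSpace p) := B.bilinearComp D D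
  have hL : ∀ v w, L v w = b p v w := fun v w => (hb p hp v v.2 w w.2).symm
  have hi : Function.Injective L.toLinearMap := (injective_iff_map_eq_zero _).2 fun v hv => by
    by_contra h
    obtain ⟨w, hw, hw'⟩ := hb0 p hp v v.2 fun h' => h (Subtype.ext h')
    refine hw' ?_
    rw [← hL v ⟨w, hw⟩]
    exact DFunLike.congr_fun hv _
  have hd : Module.finrank ℝ (M.tangentSpace p) =
      Module.finrank ℝ (StrongDual ℝ (M.tangentSpace p)) := by
    rw [← (LinearMap.toContinuousLinearMap :
      (M.tangentSpace p →ₗ[ℝ] ℝ) ≃ₗ[ℝ] _).finrank_eq]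
    exact (Subspace.dual_finrank_eq (K := ℝ) (V := M.tangentSpace p)).symm
  exact ⟨(LinearMap.linearEquivOfInjective L.toLinearMap hi hd).toContinuousLinearEquiv,
    fun v w => hL v w⟩

/-- Chain rule for Φ ∘ r = Φ. -/
theorem scDeriv_Tr (hΦ : M.IsImmersion Φ) (hM : M.IsMPolyfold)
    (hr : ∀ m x, Φ m (M.r m x) = Φ m x) (p : M.E.X 1) (v : M.E.X 0) :
    scDeriv M.E (ScScale.const V) univ Φ (M.r 1 p) (scDeriv M.E M.E univ M.r p v) =
      scDeriv M.E (ScScale.const V) univ Φ p v := by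
  have h := isTangentMap_scTangentMap (hΦ.smooth 1)
  have h1 := h.comp hM.scBanach hM.scBanach isOpen_univ isOpen_univ hM.isTangentMap_Tr
    (mapsTo_univ _ _)
  have h2 := (h1.congr (f' := Φ) fun m x _ => (hr m x).symm).eqOn hM.scBanach
    (ScScale.IsScBanach.const V) isOpen_univ h 0 (mem_univ (p, v))
  rw [← hΦ.tangent_snd hM, ← hΦ.tangent_snd hM, ← h2, ← hM.Tr_zero]

/-- Because DΦ(r(p)) Dr(p) = DΦ(p), composing the tensor with the retraction of the Whitney sum
gives B(DΦ(p)v, DΦ(p)w) on the ambient scale, which is a constant bilinear map applied to tangent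
maps of Φ. -/
theorem isTensor02 (hΦ : M.IsImmersion Φ) (hM : M.IsMPolyfold)
    (hr : ∀ m x, Φ m (M.r m x) = Φ m x)
    (hb : ∀ p ∈ M.pts 1, ∀ v ∈ M.tangentSpace p, ∀ w ∈ M.tangentSpace p, b p v w =
      B (scDeriv M.E (ScScale.const V) univ Φ p v) (scDeriv M.E (ScScale.const V) univ Φ p w)) :
    M.IsTensor02 b where
  add_left p hp v hv v' hv' w hw := by
    rw [hb p hp _ (add_mem hv hv') w hw, hb p hp v hv w hw, hb p hp v' hv' w hw, map_add, map_add,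
      add_apply]
  add_right p hp v hv w hw w' hw' := by
    rw [hb p hp v hv _ (add_mem hw hw'), hb p hp v hv w hw, hb p hp v hv w' hw', map_add, map_add]
  smul_left p hp c v hv w hw := by
    rw [hb p hp _ (Submodule.smul_mem _ c hv) w hw, hb p hp v hv w hw, map_smul, map_smul,
      smul_apply, smul_eq_mul]
  smul_right p hp c v hv w hw := by
    rw [hb p hp v hv _ (Submodule.smul_mem _ c hw), hb p hp v hv w hw, map_smul, map_smul,
      smul_eq_mul]
  continuous p hp := by
    refine ContinuousOn.congr (Continuous.continuousOn ?_) fun vw hvw => hb p hp _ hvw.1 _ hvw.2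
    fun_prop
  smooth := by
    have hE := hM.scBanach
    have hV := ScScale.IsScBanach.const V
    set T := scTangentMap M.E (ScScale.const V) univ Φ with hT
    have hTs : ∀ k, IsSc k M.E.tangent (ScScale.const V) univ (fun m y => (T m y).2) := fun k =>
      IsSc.snd (F := ScScale.const V) hE.tangent hV hV isOpen_univ
        ((hΦ.smooth (k + 1)).scTangentMap hE hV isOpen_univ)
    have h1 : ∀ k, IsSc k M.E.whitney (ScScale.const V) univ (fun m y => (T m (y.1, y.2.1)).2) :=
      fun k => (hTs k).comp_clm (E := M.E.whitney) hE.whitney hE.tangent isOpen_univ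
        (fun m => (ContinuousLinearMap.fst ℝ (M.E.X (m + 1)) (M.E.X m × M.E.X m)).prod
          ((ContinuousLinearMap.fst ℝ (M.E.X m) (M.E.X m)).comp
            (ContinuousLinearMap.snd ℝ (M.E.X (m + 1)) (M.E.X m × M.E.X m)))) fun _ _ => rfl
    have h2 : ∀ k, IsSc k M.E.whitney (ScScale.const V) univ (fun m y => (T m (y.1, y.2.2)).2) :=
      fun k => (hTs k).comp_clm (E := M.E.whitney) hE.whitney hE.tangent isOpen_univ
        (fun m => (ContinuousLinearMap.fst ℝ (M.E.X (m + 1)) (M.E.X m × M.E.X m)).prod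
          ((ContinuousLinearMap.snd ℝ (M.E.X m) (M.E.X m)).comp
            (ContinuousLinearMap.snd ℝ (M.E.X (m + 1)) (M.E.X m × M.E.X m)))) fun _ _ => rfl
    have h3 : ∀ k, IsSc k M.E.whitney (ScScale.const ℝ) univ
        (fun m y => B (T m (y.1, y.2.1)).2 (T m (y.1, y.2.2)).2) := fun k =>
      isSc_bilinear_comp (B := fun _ => B) hE.whitney hV hV (ScScale.IsScBanach.const ℝ) isOpen_univ
        (fun _ _ _ => rfl) (h1 k) (h2 k)
    intro k
    refine (h3 k).congr fun m y _ => ?_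
    have e3 := (h3 0).isSc0.incl_apply m (mem_univ y)
    rw [ScScale.const_incl] at e3
    obtain ⟨x, v, w⟩ := y
    simp only
    rw [e3, ScScale.prod_incl, ScScale.prod_incl, ScScale.prod_incl, ScScale.prod_incl]
    have e : ∀ u : M.E.X m, (M.E.shift.incl m (M.r (m + 1) x), M.E.incl m (M.Tr m (x, u)).2) =
        (M.r 1 (M.E.shift.incl m x),
          scDeriv M.E M.E univ M.r (M.E.shift.incl m x) (M.E.incl m u)) := fun u => by
      have h := (hM.isSc_Tr (k := 0)).isSc0.incl_apply m (mem_univ (x, u))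
      rw [ScScale.prod_incl, ScScale.prod_incl, hM.Tr_zero, hM.Tr_fst] at h
      exact h
    have e1 := congrArg Prod.fst (e v)
    have e2 := fun u => congrArg Prod.snd (e u)
    simp only [whitneyR] at e1 e2 ⊢
    rw [e1, e2, e2, hb _ (mem_range_self _) _ (hM.scDeriv_r_mem _ _) _
      (hM.scDeriv_r_mem _ _)]
    rw [hΦ.scDeriv_Tr hM hr, hΦ.scDeriv_Tr hM hr, ← hΦ.tangent_snd hM, ← hΦ.tangent_snd hM]

end IsImmersion

end ScRetract

/-! ### The standard Kähler structure on a Euclidean space -/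

theorem pairRotation_pairRotation (c : ℕ → ℝ) (i : ℕ) :
    pairRotation (pairRotation c) i = -c i := by
  rcases Nat.even_or_odd i with h | h
  · simp [pairRotation, h, Nat.even_add_one]
  · obtain ⟨j, rfl⟩ := h
    simp [pairRotation]

theorem sum_pairRotation_mul_pairRotation (c d : ℕ → ℝ) {N : ℕ} (hN : Even N) :
    ∑ i ∈ Finset.range N, pairRotation c i * pairRotation d i = ∑ i ∈ Finset.range N, c i * d i := by
  obtain ⟨M, rfl⟩ := hN
  rw [← two_mul]
  induction M with
  | zero => rfl
  | succ M ih =>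
    rw [show 2 * (M + 1) = 2 * M + 1 + 1 by ring, Finset.sum_range_succ, Finset.sum_range_succ, ih, Finset.sum_range_succ,
      Finset.sum_range_succ]
    simp [pairRotation]
    ring

theorem pairRotation_eq_zero {c : ℕ → ℝ} {N : ℕ} (hN : Even N) (hc : ∀ i, N ≤ i → c i = 0) {i : ℕ}
    (hi : N ≤ i) : pairRotation c i = 0 := by
  unfold pairRotation
  split_ifs with h
  · rw [hc _ (hi.trans (Nat.le_succ i)), neg_zero]
  · refine hc _ ?_
    have : i ≠ N := fun h' => h (h' ▸ hN)
    omega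

theorem pairRotation_add (c d : ℕ → ℝ) (i : ℕ) :
    pairRotation (fun j => c j + d j) i = pairRotation c i + pairRotation d i := by
  unfold pairRotation
  split_ifs <;> ring

theorem pairRotation_smul (a : ℝ) (c : ℕ → ℝ) (i : ℕ) :
    pairRotation (fun j => a * c j) i = a * pairRotation c i := by
  unfold pairRotation
  split_ifs <;> ring

/-- Extension of a vector by zero. -/
def extendZero {k : ℕ} (a : Fin k → ℝ) (i : ℕ) : ℝ := if h : i < k then a ⟨i, h⟩ else 0

theorem extendZero_val {k : ℕ} (a : Fin k → ℝ) (i : Fin k) : extendZero a i = a i := by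
  simp [extendZero]

theorem extendZero_of_le {k : ℕ} (a : Fin k → ℝ) {i : ℕ} (h : k ≤ i) : extendZero a i = 0 :=
  dif_neg h.not_gt

namespace GammaData

/-- The model of the tangent spaces of `Γ_n^k`. -/
abbrev Model (n k : ℕ) : Type := (EuclideanSpace ℝ (Fin n) × ℝ) × (Fin k → ℝ)

variable {n k : ℕ}

theorem horiz_val (y : EuclideanSpace ℝ (Fin n) × ℝ) (i : Fin n) : horiz y i = y.1 i := by
  simp [horiz]

theorem horiz_self (y : EuclideanSpace ℝ (Fin n) × ℝ) : horiz y n = y.2 := by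
  simp [horiz]

theorem horiz_of_lt (y : EuclideanSpace ℝ (Fin n) × ℝ) {i : ℕ} (h : n + 1 ≤ i) : horiz y i = 0 := by
  rw [horiz, dif_neg (by omega), if_neg (by omega)]

theorem horiz_add (y z : EuclideanSpace ℝ (Fin n) × ℝ) :
    horiz (y + z) = fun i => horiz y i + horiz z i := by
  ext i
  unfold horiz
  split_ifs <;> simp

theorem horiz_smul (c : ℝ) (y : EuclideanSpace ℝ (Fin n) × ℝ) :
    horiz (c • y) = fun i => c * horiz y i := by
  ext i
  unfold horiz
  split_ifs <;> simp

/-- For odd n the n + 1 entries split into complete pairs, so the rotation of sequences preserves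
those supported on them. -/
theorem horiz_horizJ (hn : Odd n) (y : EuclideanSpace ℝ (Fin n) × ℝ) :
    horiz (horizJ y) = pairRotation (horiz y) := by
  ext i
  rcases lt_trichotomy i n with h | rfl | h
  · rw [horiz, dif_pos h]
    rfl
  · rw [horiz_self]
    rfl
  · rw [horiz_of_lt _ h, pairRotation_eq_zero hn.add_one (fun j hj => horiz_of_lt y hj) h]

theorem horizJ_horizJ (hn : Odd n) (y : EuclideanSpace ℝ (Fin n) × ℝ) : horizJ (horizJ y) = -y := by
  rw [horizJ, horiz_horizJ hn]
  refine Prod.ext (PiLp.ext fun i => ?_) ?_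
  · exact (pairRotation_pairRotation _ _).trans (congrArg Neg.neg (horiz_val y i))
  · exact (pairRotation_pairRotation _ _).trans (congrArg Neg.neg (horiz_self y))

theorem sum_horiz_mul (y z : EuclideanSpace ℝ (Fin n) × ℝ) :
    ∑ i ∈ Finset.range (n + 1), horiz y i * horiz z i = (∑ i, y.1 i * z.1 i) + y.2 * z.2 := by
  rw [Finset.sum_range_succ, horiz_self, horiz_self, Finset.sum_range]
  simp only [horiz_val]

theorem extendZero_pairRotation (hk : Even k) (a : Fin k → ℝ) :
    extendZero (fun j : Fin k => pairRotation (extendZero a) j) = pairRotation (extendZero a) := by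
  ext i
  rcases lt_or_ge i k with h | h
  · rw [extendZero, dif_pos h]
  · rw [extendZero_of_le _ h, pairRotation_eq_zero hk (fun j hj => extendZero_of_le a hj) h]

/-- The rotation `(c_1, c_2, …) ↦ (-c_2, c_1, …)` of `ℝ^k`. -/
noncomputable def vertJ : (Fin k → ℝ) →ₗ[ℝ] Fin k → ℝ where
  toFun a j := pairRotation (extendZero a) j
  map_add' a b := by
    ext j
    rw [Pi.add_apply, ← pairRotation_add]
    congr 1
    ext i
    unfold extendZero
    split_ifs <;> simp
  map_smul' c a := by
    ext j
    rw [Pi.smul_apply, RingHom.id_apply, smul_eq_mul, ← pairRotation_smul]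
    congr 1
    ext i
    unfold extendZero
    split_ifs <;> simp

theorem vertJ_vertJ (hk : Even k) (a : Fin k → ℝ) : vertJ (vertJ a) = -a := by
  ext j
  change pairRotation (extendZero fun j : Fin k => pairRotation (extendZero a) j) j = _
  rw [extendZero_pairRotation hk, pairRotation_pairRotation, extendZero_val, Pi.neg_apply]

theorem sum_vertJ_mul_vertJ (hk : Even k) (a b : Fin k → ℝ) :
    ∑ j, vertJ a j * vertJ b j = ∑ j, a j * b j := by
  have h := sum_pairRotation_mul_pairRotation (extendZero a) (extendZero b) hk
  simp only [Finset.sum_range, extendZero_val] at h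
  exact h

/-- The map `horizJ` as a linear map. -/
noncomputable def horizJLin : (EuclideanSpace ℝ (Fin n) × ℝ) →ₗ[ℝ] EuclideanSpace ℝ (Fin n) × ℝ where
  toFun := horizJ
  map_add' y z := by
    unfold horizJ
    rw [horiz_add]
    simp only [pairRotation_add]
    rfl
  map_smul' c y := by
    unfold horizJ
    rw [horiz_smul]
    simp only [pairRotation_smul]
    rfl

/-- The complex structure of the model. -/
noncomputable def modelJ : Model n k →L[ℝ] Model n k :=
  LinearMap.toContinuousLinearMap (horizJLin.prodMap vertJ)

theorem modelJ_apply (u : Model n k) : modelJ u = (horizJ u.1, vertJ u.2) := rfl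

theorem modelJ_modelJ (hn : Odd n) (hk : Even k) (u : Model n k) : modelJ (modelJ u) = -u := by
  rw [modelJ_apply, modelJ_apply, horizJ_horizJ hn, vertJ_vertJ hk]
  rfl

/-- The metric of the model. -/
noncomputable def modelMetric : Model n k →L[ℝ] Model n k →L[ℝ] ℝ :=
  (LinearMap.mk₂ ℝ (fun u v : Model n k =>
    (∑ i, u.1.1 i * v.1.1 i) + u.1.2 * v.1.2 + ∑ j, u.2 j * v.2 j)
    (fun u u' v => by simp [add_mul, Finset.sum_add_distrib]; ring)
    (fun c u v => by simp [mul_add, mul_assoc, Finset.mul_sum])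
    (fun u v v' => by simp [mul_add, Finset.sum_add_distrib]; ring)
    (fun c u v => by simp [mul_add, mul_left_comm, Finset.mul_sum])).toContinuousBilinearMap

theorem modelMetric_apply (u v : Model n k) : modelMetric u v =
    (∑ i, u.1.1 i * v.1.1 i) + u.1.2 * v.1.2 + ∑ j, u.2 j * v.2 j := rfl

theorem modelMetric_comm (u v : Model n k) : modelMetric u v = modelMetric v u := by
  simp only [modelMetric_apply, mul_comm]

theorem modelMetric_modelJ (hn : Odd n) (hk : Even k) (u v : Model n k) :
    modelMetric (modelJ u) (modelJ v) = modelMetric u v := by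
  rw [modelMetric_apply, modelMetric_apply, modelJ_apply, modelJ_apply, ← sum_horiz_mul,
    ← sum_horiz_mul, horiz_horizJ hn, horiz_horizJ hn,
    sum_pairRotation_mul_pairRotation _ _ hn.add_one, sum_vertJ_mul_vertJ hk]

theorem modelMetric_pos {u : Model n k} (hu : u ≠ 0) : 0 < modelMetric u u := by
  have h1 : 0 ≤ ∑ i, u.1.1 i * u.1.1 i := Finset.sum_nonneg fun i _ => mul_self_nonneg _
  have h2 : 0 ≤ ∑ j, u.2 j * u.2 j := Finset.sum_nonneg fun i _ => mul_self_nonneg _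
  have h3 := mul_self_nonneg u.1.2
  refine lt_of_le_of_ne (by rw [modelMetric_apply]; positivity) fun h => hu ?_
  rw [modelMetric_apply] at h
  have e1 : ∑ i, u.1.1 i * u.1.1 i = 0 := by linarith
  have e2 : ∑ j, u.2 j * u.2 j = 0 := by linarith
  have e3 : u.1.2 * u.1.2 = 0 := by linarith
  rw [Finset.sum_eq_zero_iff_of_nonneg fun i _ => mul_self_nonneg _] at e1 e2
  refine Prod.ext (Prod.ext (PiLp.ext fun i => ?_) (mul_self_eq_zero.1 e3)) (funext fun j => ?_)
  · exact mul_self_eq_zero.1 (e1 i (Finset.mem_univ i))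
  · exact mul_self_eq_zero.1 (e2 j (Finset.mem_univ j))

/-- The fundamental form of the model. -/
noncomputable def modelForm : Model n k →L[ℝ] Model n k →L[ℝ] ℝ := modelMetric.comp modelJ

theorem modelForm_apply (u v : Model n k) : modelForm u v = modelMetric (modelJ u) v := rfl

theorem modelForm_antisymm (hn : Odd n) (hk : Even k) (u v : Model n k) :
    modelForm u v = -modelForm v u := by
  rw [modelForm_apply, modelForm_apply, ← modelMetric_modelJ hn hk, modelJ_modelJ hn hk, map_neg,
    neg_apply, modelMetric_comm]

end GammaData

/-! ### Tangent maps of linear maps and of sums. -/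

section TangentMap

variable {E F : ScScale} {U : Set (E.X 0)}

theorem isTangentMap_linear (L : ∀ m, E.X m →L[ℝ] F.X m) (U : Set (E.X 0))
    (h : ∀ m x, F.ι m (L (m + 1) x) = L m (E.ι m x)) :
    IsTangentMap E F U (fun m x => L m x) (fun m y => (L (m + 1) y.1, L m y.2)) := by
  refine ⟨isSc_linear (k := 0) L U h, fun x _ => ⟨L 0, ?_, fun h => rfl⟩,
    isSc_linear (k := 0) (E := E.tangent) (F := F.tangent) (fun m => (L (m + 1)).prodMap (L m)) _
      fun m x => Prod.ext (h (m + 1) x.1) (h m x.2)⟩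
  refine (isLittleO_zero _ _).congr_left fun h => ?_
  simp

theorem IsTangentMap.add {f g : ScFun E F} {f' g' : ScFun E.tangent F.tangent}
    (hf : IsTangentMap E F U f f') (hg : IsTangentMap E F U g g') :
    IsTangentMap E F U (fun m x => f m x + g m x)
      (fun m y => ((f' m y).1 + (g' m y).1, (f' m y).2 + (g' m y).2)) :=
  (hf.prodMk hg).clm_comp (G := F) (fun m => ContinuousLinearMap.fst ℝ (F.X m) (F.X m) +
    ContinuousLinearMap.snd ℝ (F.X m) (F.X m)) fun m x => map_add (F.ι m) x.1 x.2

theorem IsTangentMap.sum {ι : Type*} (s : Finset ι) {f : ι → ScFun E F}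
    {f' : ι → ScFun E.tangent F.tangent} (hf : ∀ i ∈ s, IsTangentMap E F U (f i) (f' i)) :
    IsTangentMap E F U (fun m x => ∑ i ∈ s, f i m x)
      (fun m y => (∑ i ∈ s, (f' i m y).1, ∑ i ∈ s, (f' i m y).2)) := by
  classical
  induction s using Finset.induction_on with
  | empty => exact isTangentMap_linear (E := E) (F := F) (fun _ => 0) U fun m _ => map_zero (F.ι m)
  | insert a s ha ih =>
    simp only [Finset.sum_insert ha]
    exact (hf a (by simp)).add (ih fun i hi => hf i (by simp [hi]))

theorem IsTangentMap.congr_right {f : ScFun E F} {g g' : ScFun E.tangent F.tangent}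
    (h : IsTangentMap E F U f g) (hg : ∀ m y, g' m y = g m y) : IsTangentMap E F U f g' := by
  obtain rfl : g' = g := funext fun m => funext fun y => hg m y
  exact h

end TangentMap

namespace ScRetract

theorem t2Space_pts (M : ScRetract) (m : ℕ) : T2Space (M.pts m) := inferInstance

theorem paracompactSpace_pts (M : ScRetract) (m : ℕ) : ParacompactSpace (M.pts m) := inferInstance

end ScRetract

namespace SobolevWeights

variable (w : SobolevWeights)

theorem pair_ofCc (m : ℕ) (φ ψ : CcFun) :
    w.pair (w.ofCc m φ) ψ = ∫ s, φ.toFun s * ψ.toFun s := by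
  rw [← pairCLM_apply, pairCLM, ContinuousLinearMap.comp_apply, comp_ofCc, pairLp_apply]
  exact integral_congr_ae ((w.coeFn_toLp_cc m φ).mono fun s hs =>
    congrArg (· * ψ.toFun s) hs)

end SobolevWeights

/-! ### The retraction of Γ, its tangent spaces and its map to the model. -/

namespace GammaData

variable {n k : ℕ} (Γ : GammaData n k)

theorem isScBanach_space : Γ.space.IsScBanach :=
  ((ScScale.IsScBanach.const _).prod (ScScale.IsScBanach.const ℝ)).prod Γ.isScBanach_scale

theorem isReflexive_space : Γ.space.IsReflexive := fun m =>
  surjective_inclusionInDoubleDual_prod (surjective_inclusionInDoubleDual_prod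
    (surjective_inclusionInDoubleDual_of_innerProductSpace (EuclideanSpace ℝ (Fin n)))
    (surjective_inclusionInDoubleDual_of_innerProductSpace ℝ))
    (surjective_inclusionInDoubleDual_of_innerProductSpace (Γ.sobolev m))

theorem pair_moved (m : ℕ) (t : ℝ) (i j : Fin k) :
    Γ.pair (Γ.ofCc m (Γ.moved t i)) (Γ.moved t j) = if i = j then 1 else 0 := by
  rw [SobolevWeights.pair_ofCc, ← Γ.orthonormal]
  exact integral_add_right_eq_self (fun s => (Γ.γ i).toFun s * (Γ.γ j).toFun s) _

theorem pair_sum_moved (m : ℕ) (t : ℝ) (a : Fin k → ℝ) (i : Fin k) :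
    Γ.pair (∑ j, a j • Γ.ofCc m (Γ.moved t j)) (Γ.moved t i) = a i := by
  rw [← SobolevWeights.pairCLM_apply, map_sum]
  simp only [map_smul, SobolevWeights.pairCLM_apply, pair_moved]
  simp

/-- The function `(x, t, f) ↦ ⟨f, γ_j(· + e^{1/t})⟩`, which is `0` for `t ≤ 0`. -/
noncomputable def coeff (j : Fin k) : ScFun Γ.space (ScScale.const ℝ) := fun m p =>
  flatFamily 0 0 (fun T => Γ.pairCLM m ((Γ.γ j).shift T)) p.1.2 p.2

theorem coeff_of_nonpos (j : Fin k) (m : ℕ) {p : Γ.space.X m} (hp : p.1.2 ≤ 0) :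
    Γ.coeff j m p = 0 := by
  rw [coeff, flatFamily_of_nonpos _ _ _ hp, zero_apply]

theorem coeff_of_pos (j : Fin k) (m : ℕ) {p : Γ.space.X m} (hp : 0 < p.1.2) :
    Γ.coeff j m p = Γ.pair p.2 (Γ.moved p.1.2 j) := by
  rw [coeff, flatFamily_of_pos _ _ _ hp, pow_zero, pow_zero, one_mul, one_smul,
    SobolevWeights.pairCLM_apply, moved]

/-- The derivative of `coeff`. -/
noncomputable def coeffDeriv (j : Fin k) (m : ℕ) (y : Γ.space.tangent.X m) : ℝ :=
  flatFamily 0 0 (fun T => Γ.pairCLM m ((Γ.γ j).shift T)) y.1.1.2 y.2.2 -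
    y.2.1.2 • flatFamily 2 1 (fun T => Γ.pairCLM (m + 1) ((Γ.γ j).deriv.shift T)) y.1.1.2 y.1.2

theorem coeffDeriv_of_nonpos (j : Fin k) (m : ℕ) {y : Γ.space.tangent.X m} (hy : y.1.1.2 ≤ 0) :
    Γ.coeffDeriv j m y = 0 := by
  rw [coeffDeriv, flatFamily_of_nonpos _ _ _ hy, flatFamily_of_nonpos _ _ _ hy, zero_apply,
    zero_apply, smul_zero, sub_zero]

theorem coeffDeriv_of_pos (j : Fin k) (m : ℕ) {y : Γ.space.tangent.X m} (hy : 0 < y.1.1.2) :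
    Γ.coeffDeriv j m y = Γ.pair y.2.2 (Γ.moved y.1.1.2 j) -
      y.2.1.2 * (Real.exp (1 / y.1.1.2) / y.1.1.2 ^ 2 *
        Γ.pair y.1.2 ((Γ.γ j).deriv.shift (Real.exp (1 / y.1.1.2)))) := by
  rw [coeffDeriv, flatFamily_of_pos _ _ _ hy, flatFamily_of_pos _ _ _ hy, pow_zero, pow_zero,
    one_mul, one_smul, smul_apply, SobolevWeights.pairCLM_apply, SobolevWeights.pairCLM_apply, moved,
    smul_eq_mul, smul_eq_mul, pow_one]
  congr 3
  rw [one_div, inv_pow]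
  ring

/-- The map `((x, t), f) ↦ (t, f)`. -/
noncomputable def forget (m : ℕ) : Γ.space.X m →L[ℝ] ℝ × Γ.sobolev m :=
  ((ContinuousLinearMap.snd ℝ (EuclideanSpace ℝ (Fin n)) ℝ).comp
    (ContinuousLinearMap.fst ℝ (EuclideanSpace ℝ (Fin n) × ℝ) (Γ.sobolev m))).prod
    (ContinuousLinearMap.snd ℝ (EuclideanSpace ℝ (Fin n) × ℝ) (Γ.sobolev m))

theorem isSc_coeff (j : Fin k) (i : ℕ) : IsSc i Γ.space (ScScale.const ℝ) univ (Γ.coeff j) :=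
  ((Γ.isSc_and_isTangentMap_pairCLM (Γ.γ j)).1 i).comp_clm (E := Γ.space) Γ.isScBanach_space
    ((ScScale.IsScBanach.const ℝ).prod Γ.isScBanach_scale) isOpen_univ Γ.forget fun _ _ => rfl

theorem isTangentMap_coeff (j : Fin k) : IsTangentMap Γ.space (ScScale.const ℝ) univ (Γ.coeff j)
    (fun m y => (Γ.coeff j (m + 1) y.1, Γ.coeffDeriv j m y)) :=
  (Γ.isSc_and_isTangentMap_pairCLM (Γ.γ j)).2.comp Γ.isScBanach_space
    ((ScScale.IsScBanach.const ℝ).prod Γ.isScBanach_scale) isOpen_univ isOpen_univ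
    (isTangentMap_linear (E := Γ.space) (F := (ScScale.const ℝ).prod Γ.scale) Γ.forget univ
      fun _ _ => rfl) (mapsTo_univ _ _)

theorem isSc_rank (i j : Fin k) (l : ℕ) : IsSc l Γ.space Γ.scale univ
    (fun m p => flatFamily 0 0 (Γ.rank m m (Γ.γ i) (Γ.γ j)) p.1.2 p.2) :=
  ((Γ.isSc_and_isTangentMap_rank (Γ.γ i) (Γ.γ j)).1 l).comp_clm (E := Γ.space) Γ.isScBanach_space
    ((ScScale.IsScBanach.const ℝ).prod Γ.isScBanach_scale) isOpen_univ Γ.forget fun _ _ => rfl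

theorem isTangentMap_rank (i j : Fin k) : IsTangentMap Γ.space Γ.scale univ
    (fun m p => flatFamily 0 0 (Γ.rank m m (Γ.γ i) (Γ.γ j)) p.1.2 p.2)
    (fun m y => (flatFamily 0 0 (Γ.rank (m + 1) (m + 1) (Γ.γ i) (Γ.γ j)) y.1.1.2 y.1.2,
      flatFamily 0 0 (Γ.rank m m (Γ.γ i) (Γ.γ j)) y.1.1.2 y.2.2 - y.2.1.2 • flatFamily 2 1
        (fun T => Γ.rank (m + 1) m (Γ.γ i).deriv (Γ.γ j) T +
          Γ.rank (m + 1) m (Γ.γ i) (Γ.γ j).deriv T) y.1.1.2 y.1.2)) :=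
  (Γ.isSc_and_isTangentMap_rank (Γ.γ i) (Γ.γ j)).2.comp Γ.isScBanach_space
    ((ScScale.IsScBanach.const ℝ).prod Γ.isScBanach_scale) isOpen_univ isOpen_univ
    (isTangentMap_linear (E := Γ.space) (F := (ScScale.const ℝ).prod Γ.scale) Γ.forget univ
      fun _ _ => rfl) (mapsTo_univ _ _)

/-- In this form π_t is a finite sum of flat families of rank-one operators, for which sc-smoothness
across t = 0 is known. -/
theorem proj_eq_sum (m : ℕ) (t : ℝ) (f : Γ.sobolev m) :
    Γ.proj m t f = ∑ j, flatFamily 0 0 (Γ.rank m m (Γ.γ j) (Γ.γ j)) t f := by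
  rw [proj]
  split_ifs with ht
  · refine (Finset.sum_eq_zero fun j _ => ?_).symm
    rw [flatFamily_of_nonpos _ _ _ ht, zero_apply]
  · refine Finset.sum_congr rfl fun j _ => ?_
    rw [flatFamily_of_pos _ _ _ (not_le.1 ht), pow_zero, pow_zero, one_mul, one_smul,
      SobolevWeights.rank_apply, moved]

/-- The tangent vector `(δx, δt, ∑_j a_j γ_j(· + e^{1/t}) + δt ∑_j c_j ρ_{j,t})`, where the last
component is `0` for `t ≤ 0`. -/
noncomputable def frame (m : ℕ) (t : ℝ) (c : Fin k → ℝ) (u : Model n k) : Γ.space.X m :=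
  (u.1, if t ≤ 0 then 0 else
    (∑ j, u.2 j • Γ.ofCc m (Γ.moved t j)) + u.1.2 • ∑ j, c j • Γ.rho m t j)

/-- The derivative of `(t, f) ↦ π_t(f)` at `(t, f)`, applied to `(δt, h)`. -/
noncomputable def projDeriv (m : ℕ) (t : ℝ) (f : Γ.sobolev (m + 1)) (δt : ℝ) (h : Γ.sobolev m) :
    Γ.sobolev m :=
  ∑ j, (flatFamily 0 0 (Γ.rank m m (Γ.γ j) (Γ.γ j)) t h - δt • flatFamily 2 1
    (fun T => Γ.rank (m + 1) m (Γ.γ j).deriv (Γ.γ j) T +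
      Γ.rank (m + 1) m (Γ.γ j) (Γ.γ j).deriv T) t f)

theorem isTangentMap_proj : IsTangentMap Γ.space Γ.scale univ (fun m p => Γ.proj m p.1.2 p.2)
    (fun m y => (Γ.proj (m + 1) y.1.1.2 y.1.2, Γ.projDeriv m y.1.1.2 y.1.2 y.2.1.2 y.2.2)) := by
  refine ((IsTangentMap.sum Finset.univ fun j _ => Γ.isTangentMap_rank j j).congr
    fun m x _ => ?_).congr_right fun m y => ?_
  · exact Γ.proj_eq_sum m x.1.2 x.2
  · rw [Γ.proj_eq_sum]
    rfl

theorem projDeriv_of_nonpos (m : ℕ) {t : ℝ} (ht : t ≤ 0) (f : Γ.sobolev (m + 1)) (δt : ℝ)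
    (h : Γ.sobolev m) : Γ.projDeriv m t f δt h = 0 :=
  Finset.sum_eq_zero fun j _ => by
    rw [flatFamily_of_nonpos _ _ _ ht, flatFamily_of_nonpos _ _ _ ht, zero_apply, zero_apply,
      smul_zero, sub_zero]

/-- The rank-one terms are regrouped: differentiating the pairing contributes to the coefficients of
the γ_{j,t}, and differentiating the translated function produces δt ξ_t. -/
theorem projDeriv_of_pos (m : ℕ) {y : Γ.space.tangent.X m} (hy : 0 < y.1.1.2) :
    Γ.projDeriv m y.1.1.2 y.1.2 y.2.1.2 y.2.2 =
      (∑ j, Γ.coeffDeriv j m y • Γ.ofCc m (Γ.moved y.1.1.2 j)) +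
        y.2.1.2 • ∑ j, Γ.coeff j (m + 1) y.1 • Γ.rho m y.1.1.2 j := by
  rw [Finset.smul_sum, ← Finset.sum_add_distrib, projDeriv]
  refine Finset.sum_congr rfl fun j _ => ?_
  rw [flatFamily_of_pos _ _ _ hy, flatFamily_of_pos _ _ _ hy, Γ.coeffDeriv_of_pos j m hy,
    Γ.coeff_of_pos j (m + 1) hy, smul_apply, smul_apply, add_apply, SobolevWeights.rank_apply,
    SobolevWeights.rank_apply, SobolevWeights.rank_apply, rho, moved, one_div]
  module

/-- The retraction `r(x, t, f) = (x, t, π_t(f))`. -/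
noncomputable def retr : ScFun Γ.space Γ.space := fun m p => (p.1, Γ.proj m p.1.2 p.2)

theorem frame_coeffDeriv (m : ℕ) (y : Γ.space.tangent.X m) :
    Γ.frame m y.1.1.2 (fun j => Γ.coeff j (m + 1) y.1) (y.2.1, fun j => Γ.coeffDeriv j m y) =
      (y.2.1, Γ.projDeriv m y.1.1.2 y.1.2 y.2.1.2 y.2.2) := by
  unfold frame
  split_ifs with hy
  · rw [Γ.projDeriv_of_nonpos m hy]
  · rw [Γ.projDeriv_of_pos m (not_le.1 hy)]

/-- The derivative of r factors through that of `flat`. This factorisation yields both the shape of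
the tangent vectors and the injectivity of the derivative of `flat` on them. -/
theorem isTangentMap_retr : IsTangentMap Γ.space Γ.space univ Γ.retr
    (fun m y => (Γ.retr (m + 1) y.1, Γ.frame m y.1.1.2 (fun j => Γ.coeff j (m + 1) y.1)
      (y.2.1, fun j => Γ.coeffDeriv j m y))) := by
  have h2 := isTangentMap_linear (E := Γ.space)
    (F := (ScScale.const (EuclideanSpace ℝ (Fin n))).prod (ScScale.const ℝ))
    (fun m => ContinuousLinearMap.fst ℝ (EuclideanSpace ℝ (Fin n) × ℝ) (Γ.sobolev m)) univ
    fun _ _ => rfl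
  refine (h2.prodMk Γ.isTangentMap_proj).congr_right fun m y => ?_
  rw [frame_coeffDeriv]
  rfl

theorem isSc_retr (l : ℕ) : IsSc l Γ.space Γ.space univ Γ.retr := by
  have hE := Γ.isScBanach_space
  have h1 := IsSc.sum Finset.univ hE Γ.isScBanach_scale isOpen_univ fun j _ => Γ.isSc_rank j j l
  have h2 : IsSc l Γ.space _ univ fun _ x => x.1 := isSc_fst univ
  exact h2.prodMk hE ((ScScale.IsScBanach.const _).prod (ScScale.IsScBanach.const ℝ))
    Γ.isScBanach_scale isOpen_univ (h1.congr fun m x _ => Γ.proj_eq_sum m x.1.2 x.2)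

theorem coeff_retr (j : Fin k) (m : ℕ) (p : Γ.space.X m) :
    Γ.coeff j m (Γ.retr m p) = Γ.coeff j m p := by
  rcases le_or_gt p.1.2 0 with hp | hp
  · rw [Γ.coeff_of_nonpos j m hp]
    exact Γ.coeff_of_nonpos j m hp
  · rw [Γ.coeff_of_pos j m hp]
    refine (Γ.coeff_of_pos j m (p := (p.1, Γ.proj m p.1.2 p.2)) hp).trans ?_
    simp only [proj, if_neg hp.not_ge]
    exact Γ.pair_sum_moved m p.1.2 _ j

theorem proj_proj (m : ℕ) (t : ℝ) (f : Γ.sobolev m) : Γ.proj m t (Γ.proj m t f) = Γ.proj m t f := by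
  rcases le_or_gt t 0 with ht | ht
  · simp only [proj, if_pos ht]
  · simp only [proj, if_neg ht.not_ge, pair_sum_moved]

theorem retr_retr (m : ℕ) (p : Γ.space.X m) : Γ.retr m (Γ.retr m p) = Γ.retr m p :=
  Prod.ext rfl (Γ.proj_proj m p.1.2 p.2)

theorem isMPolyfold : Γ.X.IsMPolyfold where
  scBanach := Γ.isScBanach_space
  smooth := Γ.isSc_retr
  retraction := Γ.retr_retr
  hausdorff := Γ.X.t2Space_pts 0
  paracompact := Γ.X.paracompactSpace_pts 0

/-- The map `(x, t, f) ↦ (x, t, (⟨f, γ_j(· + e^{1/t})⟩)_j)`, with `0` in place of the last component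
for `t ≤ 0`. -/
noncomputable def flat : ScFun Γ.space (ScScale.const (Model n k)) := fun m p =>
  (p.1, fun j => Γ.coeff j m p)

/-- The derivative of `flat`. -/
noncomputable def flatDeriv (m : ℕ) (y : Γ.space.tangent.X m) : Model n k :=
  (y.2.1, fun j => Γ.coeffDeriv j m y)

/-- The inclusion of the horizontal part of the model. -/
noncomputable def horizIncl (m : ℕ) : Γ.space.X m →L[ℝ] Model n k :=
  (ContinuousLinearMap.inl ℝ (EuclideanSpace ℝ (Fin n) × ℝ) (Fin k → ℝ)).comp
    (ContinuousLinearMap.fst ℝ (EuclideanSpace ℝ (Fin n) × ℝ) (Γ.sobolev m))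

/-- The inclusion of a coordinate of the vertical part of the model. -/
noncomputable def vertIncl (n : ℕ) {k : ℕ} (j : Fin k) : ℝ →L[ℝ] Model n k :=
  (ContinuousLinearMap.inr ℝ (EuclideanSpace ℝ (Fin n) × ℝ) (Fin k → ℝ)).comp
    (ContinuousLinearMap.single ℝ (fun _ : Fin k => ℝ) j)

theorem model_eq (y : EuclideanSpace ℝ (Fin n) × ℝ) (a : Fin k → ℝ) :
    ((y, a) : Model n k) = (y, 0) + ∑ j, vertIncl n j (a j) := by
  have h : ∑ j, vertIncl n j (a j) = ((0, a) : Model n k) := by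
    simp only [vertIncl, ContinuousLinearMap.comp_apply, ← map_sum]
    refine Prod.ext rfl ?_
    exact Finset.univ_sum_single a
  rw [h]
  simp

theorem isSc_flat (l : ℕ) : IsSc l Γ.space (ScScale.const (Model n k)) univ Γ.flat := by
  have hE := Γ.isScBanach_space
  have hV := ScScale.IsScBanach.const (Model n k)
  have h1 : IsSc l Γ.space (ScScale.const (Model n k)) univ fun m p => Γ.horizIncl m p :=
    isSc_linear _ _ fun _ _ => rfl
  have h2 : ∀ j : Fin k, IsSc l Γ.space (ScScale.const (Model n k)) univ
      fun m p => vertIncl n j (Γ.coeff j m p) := fun j =>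
    (Γ.isSc_coeff j l).clm_comp (F := ScScale.const ℝ) (G := ScScale.const (Model n k)) hE (ScScale.IsScBanach.const ℝ) isOpen_univ
      (fun _ => vertIncl n j) fun _ _ => rfl
  exact (h1.add hE hV isOpen_univ (IsSc.sum Finset.univ hE hV isOpen_univ fun j _ => h2 j)).congr
    fun m p _ => model_eq p.1 _

theorem isTangentMap_flat : IsTangentMap Γ.space (ScScale.const (Model n k)) univ Γ.flat
    (fun m y => (Γ.flat (m + 1) y.1, Γ.flatDeriv m y)) := by
  have h1 : IsTangentMap Γ.space (ScScale.const (Model n k)) univ (fun m p => Γ.horizIncl m p)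
      (fun m y => (Γ.horizIncl (m + 1) y.1, Γ.horizIncl m y.2)) :=
    isTangentMap_linear _ _ fun _ _ => rfl
  have h2 : ∀ j : Fin k, IsTangentMap Γ.space (ScScale.const (Model n k)) univ
      (fun m p => vertIncl n j (Γ.coeff j m p)) (fun m y =>
        (vertIncl n j (Γ.coeff j (m + 1) y.1), vertIncl n j (Γ.coeffDeriv j m y))) := fun j =>
    (Γ.isTangentMap_coeff j).clm_comp (F := ScScale.const ℝ) (G := ScScale.const (Model n k))
      (fun _ => vertIncl n j) fun _ _ => rfl
  exact ((h1.add (IsTangentMap.sum Finset.univ fun j _ => h2 j)).congr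
    fun m p _ => model_eq p.1 _).congr_right fun m y =>
      Prod.ext (model_eq y.1.1 _) (model_eq y.2.1 _)

theorem scDeriv_flat (p : Γ.space.X 1) (v : Γ.space.X 0) :
    scDeriv Γ.space (ScScale.const (Model n k)) univ Γ.flat p v = Γ.flatDeriv 0 (p, v) :=
  Γ.isTangentMap_flat.scDeriv_apply Γ.isScBanach_space isOpen_univ (mem_univ _) v

theorem scDeriv_retr (p : Γ.space.X 1) (v : Γ.space.X 0) :
    scDeriv Γ.space Γ.space univ Γ.retr p v =
      Γ.frame 0 p.1.2 (fun j => Γ.coeff j 1 p) (Γ.flatDeriv 0 (p, v)) :=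
  Γ.isTangentMap_retr.scDeriv_apply Γ.isScBanach_space isOpen_univ (mem_univ _) v

theorem Tr_eq (m : ℕ) (y : Γ.space.tangent.X m) : Γ.X.Tr m y =
    (Γ.retr (m + 1) y.1, Γ.frame m y.1.1.2 (fun j => Γ.coeff j (m + 1) y.1) (Γ.flatDeriv m y)) :=
  Γ.isTangentMap_retr.scTangentMap_eqOn Γ.isScBanach_space Γ.isScBanach_space isOpen_univ m
    (mem_univ y)

theorem frame_of_nonpos (m : ℕ) {t : ℝ} (ht : t ≤ 0) (c : Fin k → ℝ) (u : Model n k) :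
    Γ.frame m t c u = (u.1, 0) := by
  rw [frame, if_pos ht]

theorem frame_of_pos (m : ℕ) {t : ℝ} (ht : 0 < t) (c : Fin k → ℝ) (u : Model n k) :
    Γ.frame m t c u = (u.1, (∑ j, u.2 j • Γ.ofCc m (Γ.moved t j)) + u.1.2 • ∑ j, c j • Γ.rho m t j) := by
  rw [frame, if_neg ht.not_ge]

/-- `frame` as a linear map. -/
noncomputable def frameLin (m : ℕ) (t : ℝ) (c : Fin k → ℝ) : Model n k →ₗ[ℝ] Γ.space.X m where
  toFun := Γ.frame m t c
  map_add' u v := by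
    rcases le_or_gt t 0 with ht | ht
    · simp only [frame_of_nonpos _ _ ht]
      exact Prod.ext rfl (add_zero _).symm
    · simp only [frame_of_pos _ _ ht]
      refine Prod.ext rfl ?_
      change _ = _ + _
      simp only [Prod.fst_add, Prod.snd_add, Pi.add_apply, add_smul, Finset.sum_add_distrib]
      abel
  map_smul' a u := by
    rcases le_or_gt t 0 with ht | ht
    · simp only [frame_of_nonpos _ _ ht]
      exact Prod.ext rfl (smul_zero _).symm
    · simp only [frame_of_pos _ _ ht]
      refine Prod.ext rfl ?_
      change _ = a • (_ + _)
      simp only [Prod.smul_fst, Prod.smul_snd, Pi.smul_apply, smul_eq_mul, mul_smul, smul_add,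
        Finset.smul_sum]

/-- A tangent vector satisfies v = Dr(p)v, and Dr(p)v is a linear function of the derivative of
`flat` at v. -/
theorem isImmersion_flat : Γ.X.IsImmersion Γ.flat where
  smooth := Γ.isSc_flat
  injective (p : Γ.space.X 1) hp v hv h := by
    have h1 := (Γ.isMPolyfold.mem_tangentSpace_iff hp).1 hv
    have h2 := Γ.scDeriv_retr p v
    have h3 := Γ.scDeriv_flat p v
    rw [← h3] at h2
    have h4 := (congrArg (Γ.frameLin 0 p.1.2 fun j => Γ.coeff j 1 p) h).trans (map_zero _)
    exact h1.symm.trans (h2.trans h4)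

/-- Every frame vector is thus tangent. For t ≤ 0 the vertical part of u is invisible both to
`frame` and to `flatDeriv`, so u itself is recovered only for t > 0. -/
theorem exists_scDeriv_retr_eq (p : Γ.space.X 1) (u : Model n k) : ∃ v : Γ.space.X 0,
    scDeriv Γ.space Γ.space univ Γ.retr p v = Γ.frame 0 p.1.2 (fun j => Γ.coeff j 1 p) u ∧
    (0 < p.1.2 → Γ.flatDeriv 0 (p, v) = u) := by
  rcases le_or_gt p.1.2 0 with hp | hp
  · refine ⟨(u.1, 0), ?_, fun h => absurd h hp.not_gt⟩
    rw [scDeriv_retr, frame_of_nonpos _ _ hp, frame_of_nonpos _ _ hp]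
    rfl
  -- Moving t already changes the coefficients; the vertical component of the witness is corrected
  -- by this amount.
  · have key : Γ.flatDeriv 0 (p, (u.1, ∑ j, (u.2 j - Γ.coeffDeriv j 0 (p, (u.1, 0))) •
        Γ.ofCc 0 (Γ.moved p.1.2 j))) = u := by
      refine Prod.ext rfl (funext fun i => ?_)
      refine (Γ.coeffDeriv_of_pos i 0 hp).trans ?_
      simp only [pair_sum_moved]
      rw [Γ.coeffDeriv_of_pos i 0 hp]
      have h0 : Γ.pair (0 : Γ.sobolev 0) (Γ.moved p.1.2 i) = 0 := by
        rw [← SobolevWeights.pairCLM_apply, map_zero]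
      simp only [h0]
      ring
    refine ⟨_, ?_, fun _ => key⟩
    rw [scDeriv_retr, key]

theorem retr_eq_self {m : ℕ} {p : Γ.space.X m} (hp : p ∈ Γ.X.pts m) : Γ.retr m p = p :=
  Γ.isMPolyfold.r_eq_self hp

theorem frame_mem {p : Γ.space.X 1} (u : Model n k) :
    Γ.frame 0 p.1.2 (fun j => Γ.coeff j 1 p) u ∈ Γ.X.tangentSpace p := by
  obtain ⟨v, hv, _⟩ := Γ.exists_scDeriv_retr_eq p u
  exact ⟨v, hv⟩

theorem frame_flatDeriv {p : Γ.space.X 1} (hp : p ∈ Γ.X.pts 1) {v : Γ.space.X 0}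
    (hv : v ∈ Γ.X.tangentSpace p) :
    Γ.frame 0 p.1.2 (fun j => Γ.coeff j 1 p) (Γ.flatDeriv 0 (p, v)) = v :=
  (Γ.scDeriv_retr p v).symm.trans ((Γ.isMPolyfold.mem_tangentSpace_iff hp).1 hv)

theorem flatDeriv_of_nonpos (m : ℕ) {y : Γ.space.tangent.X m} (hy : y.1.1.2 ≤ 0) :
    Γ.flatDeriv m y = (y.2.1, 0) :=
  Prod.ext rfl (funext fun j => Γ.coeffDeriv_of_nonpos j m hy)

theorem flat_retr (m : ℕ) (p : Γ.space.X m) : Γ.flat m (Γ.retr m p) = Γ.flat m p :=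
  Prod.ext rfl (funext fun j => Γ.coeff_retr j m p)

/-- The vector is Dr(p)v for some v whose image under the derivative of `flat` is u, and at p = r(p)
that derivative does not distinguish Dr(p)v from v. -/
theorem flatDeriv_frame {p : Γ.space.X 1} (hp : p ∈ Γ.X.pts 1) (ht : 0 < p.1.2) (u : Model n k) :
    Γ.flatDeriv 0 (p, Γ.frame 0 p.1.2 (fun j => Γ.coeff j 1 p) u) = u := by
  obtain ⟨v, hv, hv'⟩ := Γ.exists_scDeriv_retr_eq p u
  have h := Γ.isImmersion_flat.scDeriv_Tr Γ.isMPolyfold Γ.flat_retr p v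
  change scDeriv Γ.space _ univ Γ.flat (Γ.retr 1 p) (scDeriv Γ.space Γ.space univ Γ.retr p v) =
    scDeriv Γ.space _ univ Γ.flat p v at h
  rwa [Γ.retr_eq_self hp, scDeriv_flat, scDeriv_flat, hv, hv' ht] at h

theorem tangentSpace_eq_range (p : Γ.space.X 1) :
    (Γ.X.tangentSpace p : Submodule ℝ (Γ.space.X 0)) =
    LinearMap.range (Γ.frameLin 0 p.1.2 fun j => Γ.coeff j 1 p) := by
  refine le_antisymm ?_ ?_
  · rintro _ ⟨v, rfl⟩
    exact ⟨_, (Γ.scDeriv_retr p v).symm⟩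
  · rintro _ ⟨u, rfl⟩
    exact Γ.frame_mem u

theorem mk_mem_pts {t : ℝ} : (((0, t), 0) : Γ.space.X 1) ∈ Γ.X.pts 1 := by
  refine ⟨((0, t), 0), Prod.ext rfl ?_⟩
  change Γ.proj 1 t 0 = 0
  rw [proj_eq_sum]
  simp only [map_zero, Finset.sum_const_zero]

theorem finrank_model : Module.finrank ℝ (Model n k) = n + 1 + k := by
  simp

/-- The dimension of the tangent space jumps across t = 0: it is n + 1 at t = 0 and n + 1 + k at t =
1. Both numbers are even. -/
theorem odd_and_even (h : Γ.X.IsEvenDimensional) : Odd n ∧ Even k := by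
  have h1 := h _ (Γ.mk_mem_pts (t := 0))
  have h2 := h _ (Γ.mk_mem_pts (t := 1))
  have f1 := Γ.isImmersion_flat.finiteDimensional_tangentSpace (Γ.mk_mem_pts (t := 0))
  have f2 := Γ.isImmersion_flat.finiteDimensional_tangentSpace (Γ.mk_mem_pts (t := 1))
  replace h1 := h1.resolve_left (not_not.2 f1)
  replace h2 := h2.resolve_left (not_not.2 f2)
  have e1 : Module.finrank ℝ (Γ.X.tangentSpace (((0, 0), 0) : Γ.space.X 1)) = n + 1 := by
    have hr : Γ.X.tangentSpace (((0, 0), 0) : Γ.space.X 1) =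
        LinearMap.range (LinearMap.inl ℝ (EuclideanSpace ℝ (Fin n) × ℝ) (Γ.sobolev 0)) := by
      rw [tangentSpace_eq_range]
      ext v
      constructor
      · rintro ⟨u, rfl⟩
        exact ⟨u.1, (Γ.frame_of_nonpos 0 le_rfl _ u).symm⟩
      · rintro ⟨y, rfl⟩
        exact ⟨(y, 0), Γ.frame_of_nonpos 0 le_rfl _ _⟩
    rw [hr]
    refine (LinearMap.finrank_range_of_inj LinearMap.inl_injective).trans ?_
    simp
  have e2 : Module.finrank ℝ (Γ.X.tangentSpace (((0, 1), 0) : Γ.space.X 1)) = n + 1 + k := by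
    refine (congrArg (fun S : Submodule ℝ (Γ.space.X 0) => Module.finrank ℝ S)
      (Γ.tangentSpace_eq_range _)).trans
      ((LinearMap.finrank_range_of_inj fun u u' huu => ?_).trans finrank_model)
    have key := fun u => Γ.flatDeriv_frame (Γ.mk_mem_pts (t := 1)) one_pos u
    rw [← key u, ← key u']
    exact congrArg (fun z => Γ.flatDeriv 0 (_, z)) huu
  rw [e1] at h1
  rw [e2] at h2
  have hn : Odd n := by rwa [Nat.even_add_one, Nat.not_even_iff_odd] at h1
  exact ⟨hn, (Nat.even_add.1 h2).1 h1⟩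

/-! ### The complex structure and the metric -/

theorem xi_eq (m : ℕ) {p : Γ.space.X (m + 1)} (hp : 0 < p.1.2) :
    Γ.xi m p.1.2 p.2 = ∑ j, Γ.coeff j (m + 1) p • Γ.rho m p.1.2 j := by
  rw [xi]
  exact Finset.sum_congr rfl fun j _ => by rw [Γ.coeff_of_pos j (m + 1) hp]

theorem vert_frame (m : ℕ) {p : Γ.space.X (m + 1)} (hp : 0 < p.1.2) (u : Model n k) :
    Γ.vert m p (Γ.frame m p.1.2 (fun j => Γ.coeff j (m + 1) p) u) = extendZero u.2 := by
  ext i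
  unfold vert extendZero
  split_ifs with h
  · rw [frame_of_pos _ _ hp, xi_eq _ _ hp]
    simp only [add_sub_cancel_right, pair_sum_moved]
  · rfl

/-- In frame coordinates J is the constant rotation: subtracting δt ξ_t leaves a combination of the
orthonormal γ_{j,t}, whose coefficients are rotated, and the new δt multiplies the same ξ_t. -/
theorem J_frame (m : ℕ) (p : Γ.space.X (m + 1)) (u : Model n k) :
    Γ.J m (p, Γ.frame m p.1.2 (fun j => Γ.coeff j (m + 1) p) u) =
      (p, Γ.frame m p.1.2 (fun j => Γ.coeff j (m + 1) p) (modelJ u)) := by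
  have h1 : (Γ.frame m p.1.2 (fun j => Γ.coeff j (m + 1) p) u).1 = u.1 := rfl
  unfold J
  refine Prod.ext rfl ?_
  simp only [h1]
  rcases le_or_gt p.1.2 0 with hp | hp
  · rw [if_pos hp, frame_of_nonpos _ _ hp]
    rfl
  · rw [if_neg hp.not_ge, vert_frame _ _ hp, xi_eq _ _ hp, frame_of_pos _ _ hp]
    rfl

/-- For t ≤ 0 the metric has no vertical sum whereas the model has one; it is enough that one of the
two vectors has no vertical part. -/
theorem g_frame {p : Γ.space.X 1} {u v : Model n k} (hu : p.1.2 ≤ 0 → u.2 = 0) :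
    Γ.g p (Γ.frame 0 p.1.2 (fun j => Γ.coeff j 1 p) u) (Γ.frame 0 p.1.2 (fun j => Γ.coeff j 1 p) v) =
      modelMetric u v := by
  rw [modelMetric_apply]
  unfold g
  simp only
  congr 1
  split_ifs with hp
  · simp [hu hp]
  · rw [vert_frame _ _ (not_le.1 hp), vert_frame _ _ (not_le.1 hp)]
    simp only [extendZero_val]

theorem fib_J {p : Γ.space.X 1} (hp : p ∈ Γ.X.pts 1) {v : Γ.space.X 0}
    (hv : v ∈ Γ.X.tangentSpace p) : Γ.X.fib Γ.J p v =
      Γ.frame 0 p.1.2 (fun j => Γ.coeff j 1 p) (modelJ (Γ.flatDeriv 0 (p, v))) := by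
  have h := Γ.J_frame 0 p (Γ.flatDeriv 0 (p, v))
  rw [Γ.frame_flatDeriv hp hv] at h
  exact congrArg Prod.snd h

theorem flatDeriv_fib_J {p : Γ.space.X 1} (hp : p ∈ Γ.X.pts 1) {v : Γ.space.X 0}
    (hv : v ∈ Γ.X.tangentSpace p) :
    Γ.flatDeriv 0 (p, Γ.X.fib Γ.J p v) = modelJ (Γ.flatDeriv 0 (p, v)) := by
  rw [Γ.fib_J hp hv]
  rcases le_or_gt p.1.2 0 with ht | ht
  · rw [flatDeriv_of_nonpos _ _ ht, flatDeriv_of_nonpos _ _ ht, modelJ_apply, map_zero]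
    rfl
  · exact Γ.flatDeriv_frame hp ht _

theorem g_eq {p : Γ.space.X 1} (hp : p ∈ Γ.X.pts 1) {v w : Γ.space.X 0}
    (hv : v ∈ Γ.X.tangentSpace p) (hw : w ∈ Γ.X.tangentSpace p) :
    Γ.g p v w = modelMetric (Γ.flatDeriv 0 (p, v)) (Γ.flatDeriv 0 (p, w)) := by
  have h := Γ.g_frame (p := p) (u := Γ.flatDeriv 0 (p, v)) (v := Γ.flatDeriv 0 (p, w)) fun h => by
    rw [flatDeriv_of_nonpos _ _ h]
  rwa [Γ.frame_flatDeriv hp hv, Γ.frame_flatDeriv hp hw] at h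

/-- The field `coeffDeriv i • γ_j(· + e^{1/t})`, which is `0` for `t ≤ 0`. -/
noncomputable def spinField (i j : Fin k) (m : ℕ) (y : Γ.space.tangent.X m) : Γ.sobolev m :=
  flatFamily 0 0 (Γ.rank m m (Γ.γ i) (Γ.γ j)) y.1.1.2 y.2.2 -
    y.2.1.2 • flatFamily 2 1 (Γ.rank (m + 1) m (Γ.γ i).deriv (Γ.γ j)) y.1.1.2 y.1.2

theorem spinField_of_nonpos (i j : Fin k) (m : ℕ) {y : Γ.space.tangent.X m} (hy : y.1.1.2 ≤ 0) :
    Γ.spinField i j m y = 0 := by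
  rw [spinField, flatFamily_of_nonpos _ _ _ hy, flatFamily_of_nonpos _ _ _ hy, zero_apply,
    zero_apply, smul_zero, sub_zero]

theorem spinField_of_pos (i j : Fin k) (m : ℕ) {y : Γ.space.tangent.X m} (hy : 0 < y.1.1.2) :
    Γ.spinField i j m y = Γ.coeffDeriv i m y • Γ.ofCc m (Γ.moved y.1.1.2 j) := by
  rw [spinField, flatFamily_of_pos _ _ _ hy, flatFamily_of_pos _ _ _ hy,
    Γ.coeffDeriv_of_pos i m hy, smul_apply, smul_apply, SobolevWeights.rank_apply,
    SobolevWeights.rank_apply, moved, moved, one_div]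
  module

/-- The field `-⟨f, γ_j(· + e^{1/t})⟩ ρ_{j,t}`, which is `0` for `t ≤ 0`. -/
noncomputable def rhoField (j : Fin k) (m : ℕ) (y : Γ.space.tangent.X m) : Γ.sobolev m :=
  flatFamily 2 1 (Γ.rank (m + 1) m (Γ.γ j) (Γ.γ j).deriv) y.1.1.2 y.1.2

theorem rhoField_of_nonpos (j : Fin k) (m : ℕ) {y : Γ.space.tangent.X m} (hy : y.1.1.2 ≤ 0) :
    Γ.rhoField j m y = 0 := by
  rw [rhoField, flatFamily_of_nonpos _ _ _ hy, zero_apply]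

theorem rhoField_of_pos (j : Fin k) (m : ℕ) {y : Γ.space.tangent.X m} (hy : 0 < y.1.1.2) :
    Γ.rhoField j m y = -(Γ.coeff j (m + 1) y.1 • Γ.rho m y.1.1.2 j) := by
  rw [rhoField, flatFamily_of_pos _ _ _ hy, Γ.coeff_of_pos j (m + 1) hy, smul_apply,
    SobolevWeights.rank_apply, rho, moved, one_div]
  module

/-- The map `(p, ((δx, δt), h)) ↦ δt`. -/
noncomputable def timeDiff (m : ℕ) : Γ.space.tangent.X m →L[ℝ] ℝ :=
  (ContinuousLinearMap.fst ℝ ℝ (Γ.sobolev m)).comp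
    ((Γ.forget m).comp (ContinuousLinearMap.snd ℝ (Γ.space.X (m + 1)) (Γ.space.X m)))

/-- The map `(p, ((δx, δt), h)) ↦ (δx, δt)`. -/
noncomputable def baseDiff (m : ℕ) : Γ.space.tangent.X m →L[ℝ] EuclideanSpace ℝ (Fin n) × ℝ :=
  (ContinuousLinearMap.fst ℝ (EuclideanSpace ℝ (Fin n) × ℝ) (Γ.sobolev m)).comp
    (ContinuousLinearMap.snd ℝ (Γ.space.X (m + 1)) (Γ.space.X m))

/-- The map `(((x, t), f), v) ↦ (t, f)`. -/
noncomputable def footForget (m : ℕ) : Γ.space.tangent.X m →L[ℝ] ℝ × Γ.sobolev (m + 1) :=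
  (Γ.forget (m + 1)).comp (ContinuousLinearMap.fst ℝ (Γ.space.X (m + 1)) (Γ.space.X m))

/-- The map `(((x, t), f), ((δx, δt), h)) ↦ (t, h)`. -/
noncomputable def mixedForget (m : ℕ) : Γ.space.tangent.X m →L[ℝ] ℝ × Γ.sobolev m :=
  ((ContinuousLinearMap.fst ℝ ℝ (Γ.sobolev (m + 1))).comp (Γ.footForget m)).prod
    ((ContinuousLinearMap.snd ℝ ℝ (Γ.sobolev m)).comp
      ((Γ.forget m).comp (ContinuousLinearMap.snd ℝ (Γ.space.X (m + 1)) (Γ.space.X m))))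

theorem isSc_footFamily (φ ψ : CcFun) (l : ℕ) : IsSc l Γ.space.tangent Γ.scale univ
    (fun m y => flatFamily 2 1 (Γ.rank (m + 1) m φ ψ) y.1.1.2 y.1.2) :=
  (Γ.isSc_rank_shift 2 1 φ ψ l).comp_clm (E := Γ.space.tangent) Γ.isScBanach_space.tangent
    ((ScScale.IsScBanach.const ℝ).prod Γ.isScBanach_scale.shift) isOpen_univ Γ.footForget
    fun _ _ => rfl

theorem isSc_mixedFamily (i j : Fin k) (l : ℕ) : IsSc l Γ.space.tangent Γ.scale univ
    (fun m y => flatFamily 0 0 (Γ.rank m m (Γ.γ i) (Γ.γ j)) y.1.1.2 y.2.2) :=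
  ((Γ.isSc_and_isTangentMap_rank (Γ.γ i) (Γ.γ j)).1 l).comp_clm (E := Γ.space.tangent)
    Γ.isScBanach_space.tangent ((ScScale.IsScBanach.const ℝ).prod Γ.isScBanach_scale) isOpen_univ
    Γ.mixedForget fun _ _ => rfl

/-- The coefficients and the translated functions are not treated separately, since the bound for
the translates grows as t tends to 0. Inside a rank-one operator the decay of the pairing
compensates. Distinct i and j are needed because J exchanges the γ_j. -/
theorem isSc_spinField (i j : Fin k) (l : ℕ) :
    IsSc l Γ.space.tangent Γ.scale univ (Γ.spinField i j) := by
  have hE := Γ.isScBanach_space.tangent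
  have h1 : IsSc l Γ.space.tangent (ScScale.const ℝ) univ fun m y => Γ.timeDiff m y :=
    isSc_linear _ _ fun _ _ => rfl
  exact (Γ.isSc_mixedFamily i j l).sub hE Γ.isScBanach_scale isOpen_univ
    (h1.smul hE Γ.isScBanach_scale isOpen_univ (Γ.isSc_footFamily _ _ l))

/-- The last component of `J ∘ Tr`. -/
noncomputable def vertField (m : ℕ) (y : Γ.space.tangent.X m) : Γ.sobolev m :=
  (∑ j, ∑ i, vertJ (Pi.single i 1) j • Γ.spinField i j m y) -
    (horizJ y.2.1).2 • ∑ j, Γ.rhoField j m y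

theorem isSc_vertField (l : ℕ) : IsSc l Γ.space.tangent Γ.scale univ Γ.vertField := by
  have hE := Γ.isScBanach_space.tangent
  have hF := Γ.isScBanach_scale
  have h1 : IsSc l Γ.space.tangent (ScScale.const ℝ) univ fun m y =>
      ((ContinuousLinearMap.snd ℝ (EuclideanSpace ℝ (Fin n)) ℝ).comp
        ((LinearMap.toContinuousLinearMap horizJLin).comp (Γ.baseDiff m))) y :=
    isSc_linear (F := ScScale.const ℝ) (fun m =>
      ((ContinuousLinearMap.snd ℝ (EuclideanSpace ℝ (Fin n)) ℝ).comp
        ((LinearMap.toContinuousLinearMap horizJLin).comp (Γ.baseDiff m)))) _ fun _ _ => rfl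
  have h2 : IsSc l Γ.space.tangent Γ.scale univ fun m y => ∑ j, Γ.rhoField j m y :=
    IsSc.sum Finset.univ hE hF isOpen_univ fun j _ => Γ.isSc_footFamily _ _ l
  have h3 : IsSc l Γ.space.tangent Γ.scale univ fun m y =>
      ∑ j, ∑ i, vertJ (Pi.single i 1) j • Γ.spinField i j m y :=
    IsSc.sum Finset.univ hE hF isOpen_univ fun j _ => IsSc.sum Finset.univ hE hF isOpen_univ
      fun i _ => (Γ.isSc_spinField i j l).const_smul _ hE hF isOpen_univ
  exact h3.sub hE hF isOpen_univ (h1.smul hE hF isOpen_univ h2)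

theorem vertJ_eq_sum (a : Fin k → ℝ) (j : Fin k) :
    vertJ a j = ∑ i, vertJ (Pi.single i 1) j * a i := by
  rw [LinearMap.pi_apply_eq_sum_univ vertJ, Finset.sum_apply]
  refine Finset.sum_congr rfl fun i _ => ?_
  have h : (fun l => if i = l then 1 else 0 : Fin k → ℝ) = Pi.single i 1 := by
    ext l
    simp [Pi.single_apply, eq_comm]
  rw [Pi.smul_apply, smul_eq_mul, mul_comm, h]

/-- This rewrites J ∘ Tr in terms of rank-one families, which is what makes its sc-smoothness
visible; for t ≤ 0 both sides have vanishing last component. -/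
theorem frame_modelJ (m : ℕ) (y : Γ.space.tangent.X m) :
    Γ.frame m y.1.1.2 (fun j => Γ.coeff j (m + 1) y.1) (modelJ (Γ.flatDeriv m y)) =
      (horizJ y.2.1, Γ.vertField m y) := by
  rcases le_or_gt y.1.1.2 0 with hy | hy
  · rw [frame_of_nonpos _ _ hy, vertField]
    simp only [Γ.spinField_of_nonpos _ _ m hy, Γ.rhoField_of_nonpos _ m hy, smul_zero,
      Finset.sum_const_zero, sub_zero]
    rfl
  · rw [frame_of_pos _ _ hy, vertField]
    simp only [Γ.spinField_of_pos _ _ m hy, Γ.rhoField_of_pos _ m hy, Finset.sum_neg_distrib,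
      smul_neg, sub_neg_eq_add]
    refine Prod.ext rfl ?_
    simp only
    congr 1
    refine Finset.sum_congr rfl fun j _ => ?_
    simp only [smul_smul, ← Finset.sum_smul]
    congr 1
    exact vertJ_eq_sum _ j

theorem J_Tr (m : ℕ) (y : Γ.space.tangent.X m) :
    Γ.J m (Γ.X.Tr m y) = (Γ.retr (m + 1) y.1, (horizJ y.2.1, Γ.vertField m y)) := by
  have h := Γ.J_frame m (Γ.retr (m + 1) y.1) (Γ.flatDeriv m y)
  simp only [coeff_retr] at h
  rw [Tr_eq]
  exact h.trans (Prod.ext rfl (Γ.frame_modelJ m y))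

theorem isSc_J_Tr (l : ℕ) : IsSc l Γ.space.tangent Γ.space.tangent univ
    (fun m y => Γ.J m (Γ.X.Tr m y)) := by
  have hE := Γ.isScBanach_space
  have hB := (ScScale.IsScBanach.const (EuclideanSpace ℝ (Fin n))).prod (ScScale.IsScBanach.const ℝ)
  have h1 : IsSc l Γ.space.tangent Γ.space.shift univ fun m y => Γ.retr (m + 1) y.1 :=
    ((Γ.isSc_retr l).shift hE hE isOpen_univ).comp_clm (E := Γ.space.tangent) hE.tangent hE.shift
      isOpen_univ (fun m => ContinuousLinearMap.fst ℝ (Γ.space.X (m + 1)) (Γ.space.X m))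
      fun _ _ => rfl
  have h2 : IsSc l Γ.space.tangent
      ((ScScale.const (EuclideanSpace ℝ (Fin n))).prod (ScScale.const ℝ)) univ fun m y =>
        (LinearMap.toContinuousLinearMap horizJLin).comp (Γ.baseDiff m) y :=
    isSc_linear (F := (ScScale.const (EuclideanSpace ℝ (Fin n))).prod (ScScale.const ℝ)) (fun m =>
      (LinearMap.toContinuousLinearMap horizJLin).comp (Γ.baseDiff m)) _ fun _ _ => rfl
  exact (h1.prodMk hE.tangent hE.shift hE isOpen_univ (h2.prodMk hE.tangent hB Γ.isScBanach_scale
    isOpen_univ (Γ.isSc_vertField l))).congr fun m y _ => Γ.J_Tr m y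

theorem ι_frame (m : ℕ) (t : ℝ) (c : Fin k → ℝ) (u : Model n k) :
    Γ.space.ι m (Γ.frame (m + 1) t c u) = Γ.frame m t c u := by
  refine Prod.ext rfl ?_
  change Γ.sobolevIncl m (Γ.frame (m + 1) t c u).2 = (Γ.frame m t c u).2
  unfold frame
  split_ifs with ht
  · exact map_zero _
  · simp only [map_add, map_sum, map_smul, SobolevWeights.sobolevIncl_ofCc, rho]

theorem incl_frame (m : ℕ) (t : ℝ) (c : Fin k → ℝ) (u : Model n k) :
    Γ.space.incl m (Γ.frame m t c u) = Γ.frame 0 t c u := by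
  induction m with
  | zero => rfl
  | succ m ih => rw [ScScale.incl_succ_apply, ι_frame, ih]

/-- The map `J_p` on the tangent space at `p`, extended to a linear map. -/
noncomputable def fibLin (p : Γ.space.X 1) : Γ.space.X 0 →ₗ[ℝ] Γ.space.X 0 :=
  (Γ.frameLin 0 p.1.2 fun j => Γ.coeff j 1 p).comp (modelJ.toLinearMap.comp
    (scDeriv Γ.space (ScScale.const (Model n k)) univ Γ.flat p).toLinearMap)

theorem fibLin_eq {p : Γ.space.X 1} (hp : p ∈ Γ.X.pts 1) {v : Γ.space.X 0}
    (hv : v ∈ Γ.X.tangentSpace p) : Γ.X.fib Γ.J p v = Γ.fibLin p v := by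
  rw [Γ.fib_J hp hv, ← scDeriv_flat]
  rfl

theorem isTensor11 : Γ.X.IsTensor11 Γ.J where
  smooth := Γ.isSc_J_Tr
  base p _ v _ := rfl
  mem (p : Γ.space.X 1) hp v hv := by
    rw [Γ.fib_J hp hv]
    exact Γ.frame_mem _
  add (p : Γ.space.X 1) hp v hv w hw := by
    rw [Γ.fibLin_eq hp hv, Γ.fibLin_eq hp hw]
    exact (Γ.fibLin_eq hp (add_mem hv hw)).trans (map_add (Γ.fibLin p) v w)
  smul (p : Γ.space.X 1) hp a v hv := by
    rw [Γ.fibLin_eq hp hv]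
    exact (Γ.fibLin_eq hp (Submodule.smul_mem _ a hv)).trans (map_smul (Γ.fibLin p) a v)
  scContinuous (p : Γ.space.X 1) hp := by
    -- J_p factors through the finite-dimensional model, and frame vectors lie on every level; hence
    -- it is continuous on each level.
    refine ⟨fun m v => Γ.frameLin m p.1.2 (fun j => Γ.coeff j 1 p) (modelJ
      (scDeriv Γ.space (ScScale.const (Model n k)) univ Γ.flat p (Γ.space.incl m v))),
      fun m => ⟨Continuous.continuousOn ?_, fun v hv => ?_⟩⟩
    · exact (Γ.frameLin m p.1.2 fun j => Γ.coeff j 1 p).continuous_of_finiteDimensional.comp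
        (modelJ.continuous.comp ((ContinuousLinearMap.continuous _).comp
          (Γ.isScBanach_space.continuous_incl m)))
    · refine (Γ.incl_frame m _ _ _).trans ?_
      rw [scDeriv_flat]
      exact (Γ.fib_J hp hv).symm

end GammaData

theorem corollary4p2 (n k : ℕ) (Γ : GammaData n k) (heven : Γ.X.IsEvenDimensional) :
    Γ.X.IsComplexMPolyfold Γ.J ∧ Γ.X.NijenhuisVanishes Γ.J ∧
      Γ.X.IsStrongKaehler Γ.J Γ.g Γ.fundForm := by
  obtain ⟨hn, hk⟩ := Γ.odd_and_even heven
  have hM := Γ.isMPolyfold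
  have hΦ := Γ.isImmersion_flat
  have hT := Γ.isTensor11
  have hJ0 := GammaData.modelJ_modelJ (n := n) (k := k) hn hk
  have hJΦ : ∀ p ∈ Γ.X.pts 1, ∀ v ∈ Γ.X.tangentSpace p,
      scDeriv Γ.X.E (ScScale.const (GammaData.Model n k)) univ Γ.flat p (Γ.X.fib Γ.J p v) =
        GammaData.modelJ (scDeriv Γ.X.E (ScScale.const (GammaData.Model n k)) univ Γ.flat p v) := by
    intro p hp v hv
    exact (Γ.scDeriv_flat p _).trans ((Γ.flatDeriv_fib_J hp hv).trans
      (congrArg GammaData.modelJ (Γ.scDeriv_flat p v).symm))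
  have hg : ∀ p ∈ Γ.X.pts 1, ∀ v ∈ Γ.X.tangentSpace p, ∀ w ∈ Γ.X.tangentSpace p, Γ.g p v w =
      GammaData.modelMetric
        (scDeriv Γ.X.E (ScScale.const (GammaData.Model n k)) univ Γ.flat p v)
        (scDeriv Γ.X.E (ScScale.const (GammaData.Model n k)) univ Γ.flat p w) := by
    intro p hp v hv w hw
    exact (Γ.g_eq hp hv hw).trans (congrArg₂ (fun a b => GammaData.modelMetric a b)
      (Γ.scDeriv_flat p v).symm (Γ.scDeriv_flat p w).symm)
  have hΩ : ∀ p ∈ Γ.X.pts 1, ∀ v ∈ Γ.X.tangentSpace p, ∀ w ∈ Γ.X.tangentSpace p,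
      Γ.fundForm p v w = GammaData.modelForm
        (scDeriv Γ.X.E (ScScale.const (GammaData.Model n k)) univ Γ.flat p v)
        (scDeriv Γ.X.E (ScScale.const (GammaData.Model n k)) univ Γ.flat p w) := by
    intro p hp v hv w hw
    rw [GammaData.modelForm_apply, ← hJΦ p hp v hv]
    exact hg p hp _ (hT.mem p hp v hv) w hw
  have hpos : ∀ p ∈ Γ.X.pts 1, ∀ v ∈ Γ.X.tangentSpace p, v ≠ 0 → 0 < Γ.g p v v := by
    intro p hp v hv h0
    rw [hg p hp v hv v hv]
    exact GammaData.modelMetric_pos fun h => h0 (hΦ.injective p hp v hv h)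
  have hcomp : ∀ p ∈ Γ.X.pts 1, ∀ v ∈ Γ.X.tangentSpace p, ∀ w ∈ Γ.X.tangentSpace p,
      Γ.g p (Γ.X.fib Γ.J p v) (Γ.X.fib Γ.J p w) = Γ.g p v w := by
    intro p hp v hv w hw
    rw [hg p hp _ (hT.mem p hp v hv) _ (hT.mem p hp w hw), hJΦ p hp v hv, hJΦ p hp w hw,
      GammaData.modelMetric_modelJ hn hk, hg p hp v hv w hw]
  have hsq : ∀ p ∈ Γ.X.pts 1, ∀ v ∈ Γ.X.tangentSpace p,
      Γ.X.fib Γ.J p (Γ.X.fib Γ.J p v) = -v := by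
    intro p hp v hv
    have h1 := hT.mem p hp v hv
    -- J² = -1 holds in the model and is carried back by injectivity on the tangent space.
    refine eq_neg_of_add_eq_zero_left (hΦ.injective p hp _ (add_mem (hT.mem p hp _ h1) hv) ?_)
    rw [map_add, hJΦ p hp _ h1, hJΦ p hp v hv, hJ0, neg_add_cancel]
  have hX : Γ.X.IsComplexMPolyfold Γ.J :=
    ⟨⟨hM, heven, Γ.isReflexive_space, hT, hsq⟩, hΦ.isIntegrable hM hT hJ0 hJΦ⟩
  have hanti := GammaData.modelForm_antisymm (n := n) (k := k) hn hk
  refine ⟨hX, hΦ.nijenhuisVanishes hM hT (fun _ _ => rfl) hJ0 hJΦ, hX,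
    ⟨hΦ.isTensor02 hM Γ.flat_retr hg, fun p hp v hv w hw => ?_,
      hΦ.isStronglyNondegenerate hg fun p hp v hv h0 => ⟨v, hv, (hpos p hp v hv h0).ne'⟩, hpos⟩,
    hcomp, fun _ _ _ _ _ _ => rfl,
    ⟨⟨hΦ.isTensor02 hM Γ.flat_retr hΩ, fun p hp v hv => ?_⟩,
      hΦ.isClosedForm hM GammaData.modelForm hanti hΩ,
      hΦ.isStronglyNondegenerate hΩ fun p hp v hv h0 => ⟨Γ.X.fib Γ.J p v, hT.mem p hp v hv, ?_⟩⟩⟩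
  · rw [hg p hp v hv w hw, hg p hp w hw v hv, GammaData.modelMetric_comm]
  · rw [hΩ p hp v hv v hv]
    have h := hanti (scDeriv Γ.X.E (ScScale.const (GammaData.Model n k)) univ Γ.flat p v)
      (scDeriv Γ.X.E (ScScale.const (GammaData.Model n k)) univ Γ.flat p v)
    linarith
  -- The vector Jv detects v: ω(v, Jv) = g(Jv, Jv) = g(v, v) > 0.
  · exact ((hcomp p hp v hv v hv).trans_gt (hpos p hp v hv h0)).ne'
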